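/- **Setting.** Let $A\in\mathbb R^{n\times n}$, $B\in\mathbb R^{n\times k}$ of full rank, $Q\in\mathbb R^{n\times n}$ symmetric positive semidefinite, $R\in\mathbb R^{k\times k}$ symmetric positive definite, $\gamma\in(0,1)$, $\tau>0$. Let $x_{t+1}=Ax_t+Bu_t+w_t$, where $x_0\sim\mathcal D$ has a finite second moment and the $w_t$ are i.i.d., independent of $x_0$, with mean $0$ and finite second moment $W=\mathbb E[w_tw_t^\top]$. Write $\|\cdot\|$ for the spectral norm and $\sigma_{\min}$ for the smallest singular value, $D_0=\mathbb E[x_0x_0^\top]$, and assume $\mu:=\sigma_{\min}(D_0)>0$. For $K\in\mathbb R^{k\times n}$ and $\Sigma\in\mathbb R^{k\times k}$ symmetric positive definite let $\pi_{K,\Sigma}(\cdot|x)=\mathcal N(-Kx,\Sigma)$ and, with $u_t\sim\pi_{K,\Sigma}(\cdot|x_t)$, $$C(K,\Sigma)=\mathbb E\sum_{t\ge0}\gamma^t\big(x_t^\top Qx_t+u_t^\top Ru_t+\tau\log\pi_{K,\Sigma}(u_t|x_t)\big),\qquad S_{K,\Sigma}=\mathbb E\sum_{t\ge0}\gamma^tx_tx_t^\top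 .$$ Let $P_K$ be the matrix of the quadratic part of the value function of $\pi_{K,\Sigma}$, i.e. the (smallest) positive semidefinite solution of $P_K=Q+K^\top RK+\gamma(A-BK)^\top P_K(A-BK)$, and let $E_K=-\gamma B^\top P_K(A-BK)+RK$. Let $(K^*,\Sigma^*)$ be the parameters of the optimal policy (a minimizer of $C$ among the pairs $(K,\Sigma)$ of finite cost), $S^*=S_{K^*,\Sigma^*}$, and let $\rho\in(0,1)$ satisfy $\|A-BK^*\|\le\rho$. Iterative policy optimization (IPO) is, for $t\ge0$, $$K^{(t+1)}=K^{(t)}-(R+\gamma B^\top P_{K^{(t)}}B)^{-1}E_{K^{(t)}},\qquad \Sigma^{(t+1)}=\tfrac\tau2(R+\gamma B^\top P_{K^{(t)}}B)^{-1}.$$ **Constants.** $$\xi=\frac{1-\gamma\rho^2+\gamma}{(1-\gamma\rho^2)^2},\quad \zeta=\frac{2-\rho^2}{(1-\rho^2)^2(1-\gamma)}+\frac1{(1-\rho^2)^2(1-\gamma\rho^2)},\quad \omega=\frac1{(1-\rho^2)(1-\gamma)}+\frac1{(1-\rho^2)(1-\gamma\rho^2)},$$ $$\kappa=\frac{\rho+\|A\|}{\sigma_{\min}(B)},\qquad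 c=2\rho\,\xi\|B\|(\|Q\|+\|R\|\kappa^2)+\tfrac1\mu\|S^*\|\|R\|(\kappa+\|K^*\|),$$ $$c_1=\big(\xi\|D_0\|+\zeta\|B\Sigma^*B^\top+W\|\big)\,2\rho\|B\|\,\Big(1+\sigma_{\min}(R)\|R+\gamma B^\top P_{K^*}B\|+c\gamma\,\sigma_{\min}(R)(\|B\|\|A\|+\|B\|^2\kappa)\Big),$$ $$c_2=\frac{c\,\tau\gamma\,\omega\|B\|^4}{2\sigma_{\min}(R)^2},\qquad \delta=\min\Big\{\frac{\sigma_{\min}(S^*)}{c_1+c_2},\ \frac{\rho-\|A-BK^*\|}{\|B\|}\Big\}.$$ **Theorem (local super-linear convergence of IPO).** Let $(K^{(0)},\Sigma^{(0)})$, $\Sigma^{(0)}$ positive definite, have finite cost and satisfy $$C(K^{(0)},\Sigma^{(0)})-C(K^*,\Sigma^*)\le\Big(\frac1\mu-\frac1{\|S^*\|}\Big)^{-1}\sigma_{\min}(R+\gamma B^\top P_{K^*}B)\,\delta^2 .$$ Then for every $t=0,1,2,\dots$ the matrix $\Sigma^{(t+1)}$ is positive definite, $C(K^{(t+1)},\Sigma^{(t+1)})$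 is finite, and $$C(K^{(t+1)},\Sigma^{(t+1)})-C(K^*,\Sigma^*)\le\frac{(c_1+c_2)\,\big(C(K^{(t)},\Sigma^{(t)})-C(K^*,\Sigma^*)\big)^{1.5}}{\sigma_{\min}(S^*)\sqrt{\mu\,\sigma_{\min}(R+\gamma B^\top P_{K^*}B)}} .$$ -/

import Mathlib

open MeasureTheory ProbabilityTheory Matrix
open scoped Matrix.Norms.L2Operator

noncomputable section

namespace EntropyLQC

/-- The state space `ℝⁿ` and the action space `ℝᵏ` are Euclidean spaces. -/
abbrev Vec (d : ℕ) : Type := EuclideanSpace ℝ (Fin d)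

/-- Smallest singular value of an `m × d` matrix: the last one of its `min m d` singular values
(Mathlib lists them in decreasing order, starting from index `0`). -/
def sigmaMin {m d : ℕ} (Z : Matrix (Fin m) (Fin d) ℝ) : ℝ :=
  (Matrix.toEuclideanLin Z).singularValues (min m d - 1)

/-- The matrix `𝔼[x xᵀ]` of a distribution on `ℝᵈ`. -/
def secondMoment {d : ℕ} (m : Measure (Vec d)) : Matrix (Fin d) (Fin d) ℝ :=
  Matrix.of fun i j => ∫ x, x i * x j ∂m

/-- The quadratic form `xᵀ M x`. -/
def quad {d : ℕ} (M : Matrix (Fin d) (Fin d) ℝ) (x : Vec d) : ℝ :=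
  x.ofLp ⬝ᵥ (M *ᵥ x.ofLp)

/-- Lebesgue density at `u` of the normal distribution `N(m, S)` on `ℝᵏ`, `S` positive definite. -/
def gaussianDensity {k : ℕ} (m : Vec k) (S : Matrix (Fin k) (Fin k) ℝ) (u : Vec k) : ℝ :=
  Real.exp (-(1 / 2) * quad S⁻¹ (u - m)) / √((2 * Real.pi) ^ k * S.det)

/-- Data of a discounted entropy-regularized linear-quadratic control problem:
dynamics `x_{t+1} = A x_t + B u_t + w_t`, running cost `xᵀ Q x + uᵀ R u + τ log π(u|x)`,
discount factor `γ`, distribution `init` of `x_0`, common distribution `noise` of the `w_t`. -/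
structure Model (n k : ℕ) where
  A : Matrix (Fin n) (Fin n) ℝ
  B : Matrix (Fin n) (Fin k) ℝ
  Q : Matrix (Fin n) (Fin n) ℝ
  R : Matrix (Fin k) (Fin k) ℝ
  γ : ℝ
  τ : ℝ
  init : Measure (Vec n)
  noise : Measure (Vec n)
  Q_posSemidef : Q.PosSemidef
  R_posDef : R.PosDef
  γ_pos : 0 < γ
  γ_lt_one : γ < 1
  τ_pos : 0 < τ
  init_prob : IsProbabilityMeasure init
  init_memLp : MemLp (fun x : Vec n => x) 2 init
  noise_prob : IsProbabilityMeasure noise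
  noise_memLp : MemLp (fun w : Vec n => w) 2 noise
  noise_mean : ∫ w, w ∂noise = 0

namespace Model

variable {n k : ℕ} (M : Model n k)

/-! ### Closed loop under the Gaussian policy `π_{K,S}(·|x) = N(-K x, S)` -/

/-- A sample point: the system noises `w_t` and the policy's randomizations `η_t`. -/
abbrev Noise (n k : ℕ) : Type := (ℕ → Vec n) × (ℕ → Vec k)

/-- Law of the randomness: the `w_t` are i.i.d. with law `noise`, the `η_t` are i.i.d. with law
`N(0, S)`, and the two sequences are independent. -/
def noiseLaw (S : Matrix (Fin k) (Fin k) ℝ) : Measure (Noise n k) :=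
  haveI := M.noise_prob
  (Measure.infinitePi fun _ : ℕ => M.noise).prod
    (Measure.infinitePi fun _ : ℕ => multivariateGaussian (0 : Vec k) S)

/-- Action `u = -K x + η` in the state `x`, so that `u ∼ N(-K x, S)` given `x`. -/
def action (K : Matrix (Fin k) (Fin n) ℝ) (x : Vec n) (η : Vec k) : Vec k :=
  -(Matrix.toEuclideanLin K x) + η

/-- The state `x_t` of the closed loop started at `x_0 = x`. -/
def state (K : Matrix (Fin k) (Fin n) ℝ) (x : Vec n) (ω : Noise n k) : ℕ → Vec n
  | 0 => x
  | t + 1 =>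
      Matrix.toEuclideanLin M.A (state K x ω t) +
        Matrix.toEuclideanLin M.B (action K (state K x ω t) (ω.2 t)) + ω.1 t

/-- The action `u_t` taken at time `t`. -/
def control (K : Matrix (Fin k) (Fin n) ℝ) (x : Vec n) (ω : Noise n k) (t : ℕ) : Vec k :=
  action K (M.state K x ω t) (ω.2 t)

/-- The cost `x_tᵀ Q x_t + u_tᵀ R u_t + τ log π_{K,S}(u_t | x_t)` at time `t`. -/
def stageCost (K : Matrix (Fin k) (Fin n) ℝ) (S : Matrix (Fin k) (Fin k) ℝ)
    (x : Vec n) (ω : Noise n k) (t : ℕ) : ℝ :=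
  quad M.Q (M.state K x ω t) + quad M.R (M.control K x ω t) +
    M.τ * Real.log
      (gaussianDensity (-(Matrix.toEuclideanLin K (M.state K x ω t))) S (M.control K x ω t))

/-- The value function `J_{K,S}(x)`. -/
def valueFn (K : Matrix (Fin k) (Fin n) ℝ) (S : Matrix (Fin k) (Fin k) ℝ) (x : Vec n) : ℝ :=
  ∫ ω, ∑' t : ℕ, M.γ ^ t * M.stageCost K S x ω t ∂(M.noiseLaw S)

/-- The objective `C(K,S) = 𝔼_{x ∼ init} J_{K,S}(x)`; meaningful if `M.FiniteCost K S`. -/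
def cost (K : Matrix (Fin k) (Fin n) ℝ) (S : Matrix (Fin k) (Fin k) ℝ) : ℝ :=
  ∫ x, M.valueFn K S x ∂M.init

/-- The policy `N(-K x, S)` has a finite expected cost: the discounted series of stage costs
converges absolutely in expectation. (The quadratic costs are nonnegative and, for `S` positive
definite, the log-densities have the same finite absolute moment at every time, so the cost fails
to be finite only by being `+∞`.) -/
def FiniteCost (K : Matrix (Fin k) (Fin n) ℝ) (S : Matrix (Fin k) (Fin k) ℝ) : Prop :=
  ∫⁻ x, ∫⁻ ω, ∑' t : ℕ, ENNReal.ofReal (M.γ ^ t * |M.stageCost K S x ω t|)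
    ∂(M.noiseLaw S) ∂M.init < ⊤

/-- `(Kst, Sst)` are the parameters of an optimal policy: it has finite cost, and the cost of no
policy `N(-K x, S)` is smaller (policies of infinite cost need not be compared). -/
def IsOptimal (Kst : Matrix (Fin k) (Fin n) ℝ) (Sst : Matrix (Fin k) (Fin k) ℝ) : Prop :=
  Sst.PosDef ∧ M.FiniteCost Kst Sst ∧
    ∀ (K : Matrix (Fin k) (Fin n) ℝ) (S : Matrix (Fin k) (Fin k) ℝ),
      S.PosDef → M.FiniteCost K S → M.cost Kst Sst ≤ M.cost K S

/-- The discounted state correlation matrix `S_{K,S} = 𝔼 ∑_t γ^t x_t x_tᵀ`. -/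
def stateCorr (K : Matrix (Fin k) (Fin n) ℝ) (S : Matrix (Fin k) (Fin k) ℝ) :
    Matrix (Fin n) (Fin n) ℝ :=
  Matrix.of fun i j =>
    ∫ x, ∫ ω, ∑' t : ℕ, M.γ ^ t * (M.state K x ω t i * M.state K x ω t j)
      ∂(M.noiseLaw S) ∂M.init

/-- `D₀ = 𝔼[x_0 x_0ᵀ]`. -/
def D0 : Matrix (Fin n) (Fin n) ℝ := secondMoment M.init

/-- `W = 𝔼[w_t w_tᵀ]`. -/
def W : Matrix (Fin n) (Fin n) ℝ := secondMoment M.noise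

/-- `μ = σ_min(𝔼[x_0 x_0ᵀ])`. -/
def mu : ℝ := sigmaMin M.D0

/-! ### The iteration -/

/-- The terms of the series that defines `P_K`. -/
def valueMatrixTerm (K : Matrix (Fin k) (Fin n) ℝ) (t : ℕ) : Matrix (Fin n) (Fin n) ℝ :=
  M.γ ^ t • (((M.A - M.B * K)ᵀ) ^ t * (M.Q + Kᵀ * M.R * K) * (M.A - M.B * K) ^ t)

/-- The matrix `P_K` of the quadratic part of the value function of `N(-K x, S)`: the (smallest)
positive semidefinite solution of `P = Q + Kᵀ R K + γ (A - B K)ᵀ P (A - B K)`, written as the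
series obtained by unrolling this equation. -/
def valueMatrix (K : Matrix (Fin k) (Fin n) ℝ) : Matrix (Fin n) (Fin n) ℝ :=
  ∑' t : ℕ, M.valueMatrixTerm K t

theorem valueMatrix_eq (K : Matrix (Fin k) (Fin n) ℝ) (h : Summable (M.valueMatrixTerm K)) :
    M.valueMatrix K = M.Q + Kᵀ * M.R * K +
      M.γ • ((M.A - M.B * K)ᵀ * M.valueMatrix K * (M.A - M.B * K)) := by
  have h1 : ∀ t, M.valueMatrixTerm K (t + 1) =
      M.γ • ((M.A - M.B * K)ᵀ * M.valueMatrixTerm K t * (M.A - M.B * K)) := by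
    intro t
    simp only [valueMatrixTerm, pow_succ' (M.A - M.B * K)ᵀ, pow_succ (M.A - M.B * K),
      pow_succ' M.γ, Matrix.mul_smul, Matrix.smul_mul, smul_smul, Matrix.mul_assoc]
  have h2 : ∑' t, M.valueMatrixTerm K (t + 1) =
      M.γ • ((M.A - M.B * K)ᵀ * M.valueMatrix K * (M.A - M.B * K)) := by
    simp only [h1, valueMatrix]
    rw [((h.mul_left (M.A - M.B * K)ᵀ).mul_right (M.A - M.B * K)).tsum_const_smul,
      (h.mul_left (M.A - M.B * K)ᵀ).tsum_mul_right, h.tsum_mul_left]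
  rw [← h2, valueMatrix, h.tsum_eq_zero_add]
  simp [valueMatrixTerm]

theorem valueMatrix_posSemidef (K : Matrix (Fin k) (Fin n) ℝ)
    (h : Summable (M.valueMatrixTerm K)) : (M.valueMatrix K).PosSemidef := by
  have h0 : ∀ t, (M.valueMatrixTerm K t).PosSemidef := by
    intro t
    have h1 : (M.Q + Kᵀ * M.R * K).PosSemidef := by
      refine M.Q_posSemidef.add ?_
      simpa [Matrix.conjTranspose_eq_transpose_of_trivial] using
        M.R_posDef.posSemidef.conjTranspose_mul_mul_same K
    have h2 := h1.conjTranspose_mul_mul_same ((M.A - M.B * K) ^ t)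
    rw [Matrix.conjTranspose_eq_transpose_of_trivial, Matrix.transpose_pow] at h2
    exact h2.smul (pow_nonneg M.γ_pos.le t)
  refine Matrix.PosSemidef.of_dotProduct_mulVec_nonneg ?_ ?_
  · rw [Matrix.IsHermitian, valueMatrix, Matrix.conjTranspose_tsum]
    exact tsum_congr fun t => (h0 t).isHermitian
  · intro x
    have hc : Continuous fun P : Matrix (Fin n) (Fin n) ℝ => star x ⬝ᵥ (P *ᵥ x) := by fun_prop
    have hs := h.hasSum.map
      ({ toFun := fun P => star x ⬝ᵥ (P *ᵥ x), map_zero' := by simp,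
         map_add' := fun P P' => by rw [Matrix.add_mulVec, dotProduct_add] } :
        Matrix (Fin n) (Fin n) ℝ →+ ℝ) hc
    exact hs.nonneg fun t => (h0 t).dotProduct_mulVec_nonneg x

/-- `R + γ Bᵀ P_K B`. -/
def hess (K : Matrix (Fin k) (Fin n) ℝ) : Matrix (Fin k) (Fin k) ℝ :=
  M.R + M.γ • (M.Bᵀ * M.valueMatrix K * M.B)

/-- `E_K = -γ Bᵀ P_K (A - B K) + R K`. -/
def gradE (K : Matrix (Fin k) (Fin n) ℝ) : Matrix (Fin k) (Fin n) ℝ :=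
  -(M.γ • (M.Bᵀ * M.valueMatrix K * (M.A - M.B * K))) + M.R * K

/-- The sequence `(K t, S t)` is generated by iterative policy optimization. -/
def IsIPO (K : ℕ → Matrix (Fin k) (Fin n) ℝ) (S : ℕ → Matrix (Fin k) (Fin k) ℝ) : Prop :=
  ∀ t, K (t + 1) = K t - (M.hess (K t))⁻¹ * M.gradE (K t) ∧
    S (t + 1) = (M.τ / 2) • (M.hess (K t))⁻¹

/-! ### The constants -/

def xi (ρ : ℝ) : ℝ := (1 - M.γ * ρ ^ 2 + M.γ) / (1 - M.γ * ρ ^ 2) ^ 2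

def zeta (ρ : ℝ) : ℝ :=
  (2 - ρ ^ 2) / ((1 - ρ ^ 2) ^ 2 * (1 - M.γ)) + 1 / ((1 - ρ ^ 2) ^ 2 * (1 - M.γ * ρ ^ 2))

def omega (ρ : ℝ) : ℝ :=
  1 / ((1 - ρ ^ 2) * (1 - M.γ)) + 1 / ((1 - ρ ^ 2) * (1 - M.γ * ρ ^ 2))

def kappa (ρ : ℝ) : ℝ := (ρ + ‖M.A‖) / sigmaMin M.B

def c (ρ : ℝ) (Kst : Matrix (Fin k) (Fin n) ℝ) (Sst : Matrix (Fin k) (Fin k) ℝ) : ℝ :=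
  2 * ρ * M.xi ρ * ‖M.B‖ * (‖M.Q‖ + ‖M.R‖ * M.kappa ρ ^ 2) +
    1 / M.mu * ‖M.stateCorr Kst Sst‖ * ‖M.R‖ * (M.kappa ρ + ‖Kst‖)

def c₁ (ρ : ℝ) (Kst : Matrix (Fin k) (Fin n) ℝ) (Sst : Matrix (Fin k) (Fin k) ℝ) : ℝ :=
  (M.xi ρ * ‖M.D0‖ + M.zeta ρ * ‖M.B * Sst * M.Bᵀ + M.W‖) * (2 * ρ * ‖M.B‖) *
    (1 + sigmaMin M.R * ‖M.hess Kst‖ +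
      M.c ρ Kst Sst * M.γ * sigmaMin M.R * (‖M.B‖ * ‖M.A‖ + ‖M.B‖ ^ 2 * M.kappa ρ))

def c₂ (ρ : ℝ) (Kst : Matrix (Fin k) (Fin n) ℝ) (Sst : Matrix (Fin k) (Fin k) ℝ) : ℝ :=
  M.c ρ Kst Sst * M.τ * M.γ * M.omega ρ * ‖M.B‖ ^ 4 / (2 * sigmaMin M.R ^ 2)

def delta (ρ : ℝ) (Kst : Matrix (Fin k) (Fin n) ℝ) (Sst : Matrix (Fin k) (Fin k) ℝ) : ℝ :=
  min (1 / (M.c₁ ρ Kst Sst + M.c₂ ρ Kst Sst) * sigmaMin (M.stateCorr Kst Sst))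
    ((ρ - ‖M.A - M.B * Kst‖) / ‖M.B‖)

end Model

end EntropyLQC

end

noncomputable section

namespace EntropyLQC

open scoped MatrixOrder

/-! ### Matrices in the Loewner order -/

section Loewner

variable {d m : ℕ}

/-! IPO is policy iteration, that is, Newton's method for the Riccati equation. Write H_K = R +
γBᵀP_K B, F_K = A − BK, G_K = E_Kᵀ H_K⁻¹ E_K and K' for the improved gain. Completing the square,
the Bellman operator of a gain L sends P_K to P_K − G_K + (L − K')ᵀ H_K (L − K')
(`bellman_eq_square`). Hence P_{K'} ≤ P_K − G_K, and P_K − P_L solves a discounted Lyapunov equation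
with source G_K for L = K', and the corresponding inequality for every L.

The cost is tr(P_K X_Σ) plus a function of Σ, with X_Σ = D₀ + γ/(1−γ)·(BΣBᵀ + W). As a function of Σ
it is a linear trace minus a log-determinant, minimal only at (τ/2)H_K⁻¹ (`cost_bestCov_le`).
Duality of the two Lyapunov operators (`trace_mul_lyapunov`) turns tr((P_K − P_L) X_Σ) into the
trace of the source against S_{L,Σ}. Let e ≥ 0 be what the best covariance gains at the old gain.
Then the gap is at most tr(G_K S*) + e, while one step gains exactly tr(G_K S') + e, where S'
belongs to the new policy and its closed loop is stable. So the gap contracts by ‖S' − S*‖/σ_min(S*)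
(`gap_newton_le_of_stable`). Without stability, X_Σ ≥ μ still gives the linear rate 1 − μ/‖S*‖
(`gap_newton_le`).

It remains to bound ‖S' − S*‖ by the square root of the gap. Optimality gives E_{K*} = 0 and P_{K*}
≤ P_K in the Loewner order, so ‖P_K − P_{K*}‖ is at most gap/μ. The errors of K' and Σ' are bounded
linearly by that of P_K, and a perturbation bound for Lyapunov equations carries them over to S'.
With ε² = gap/(μ σ_min(H_{K*})) the required factor is (c₁+c₂)ε/σ_min(S*). If it is at least 1 −
μ/‖S*‖, the linear rate is enough. Otherwise ε is small; with the second part of δ this gives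
‖F_{K'}‖ ≤ ρ and ‖S' − S*‖ ≤ (c₁+c₂)ε (`gap_step`). Costs never increase, so the initial smallness
persists. -/

theorem exists_transpose_mul_self {X : Matrix (Fin d) (Fin d) ℝ} (hX : 0 ≤ X) :
    ∃ Y : Matrix (Fin d) (Fin d) ℝ, X = Yᵀ * Y := by
  refine ⟨CFC.sqrt X, ?_⟩
  have h : (CFC.sqrt X)ᵀ = CFC.sqrt X := by
    have := (Matrix.nonneg_iff_posSemidef.1 (CFC.sqrt_nonneg X)).isHermitian
    rwa [Matrix.IsHermitian, conjTranspose_eq_transpose_of_trivial] at this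
  rw [h, CFC.sqrt_mul_sqrt_self X hX]

theorem isHermitian_of_nonneg {X : Matrix (Fin d) (Fin d) ℝ} (hX : 0 ≤ X) : X.IsHermitian :=
  (Matrix.nonneg_iff_posSemidef.1 hX).isHermitian

theorem transpose_eq_of_nonneg {X : Matrix (Fin d) (Fin d) ℝ} (hX : 0 ≤ X) : Xᵀ = X := by
  have := isHermitian_of_nonneg hX
  rwa [Matrix.IsHermitian, conjTranspose_eq_transpose_of_trivial] at this

theorem congr_nonneg {X : Matrix (Fin d) (Fin d) ℝ} (hX : 0 ≤ X) (Y : Matrix (Fin d) (Fin m) ℝ) :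
    0 ≤ Yᵀ * X * Y := by
  have := (Matrix.nonneg_iff_posSemidef.1 hX).conjTranspose_mul_mul_same Y
  rw [conjTranspose_eq_transpose_of_trivial] at this
  exact Matrix.nonneg_iff_posSemidef.2 this

theorem congr_mono {X X' : Matrix (Fin d) (Fin d) ℝ} (hX : X ≤ X')
    (Y : Matrix (Fin d) (Fin m) ℝ) : Yᵀ * X * Y ≤ Yᵀ * X' * Y := by
  have := congr_nonneg (sub_nonneg.2 hX) Y
  rwa [Matrix.mul_sub, Matrix.sub_mul, sub_nonneg] at this

theorem congr_nonneg' {X : Matrix (Fin d) (Fin d) ℝ} (hX : 0 ≤ X) (Y : Matrix (Fin m) (Fin d) ℝ) :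
    0 ≤ Y * X * Yᵀ := by
  simpa using congr_nonneg hX Yᵀ

theorem congr_mono' {X X' : Matrix (Fin d) (Fin d) ℝ} (hX : X ≤ X')
    (Y : Matrix (Fin m) (Fin d) ℝ) : Y * X * Yᵀ ≤ Y * X' * Yᵀ := by
  simpa using congr_mono hX Yᵀ

theorem transpose_mul_self_nonneg (Y : Matrix (Fin m) (Fin d) ℝ) : 0 ≤ Yᵀ * Y := by
  have := Matrix.posSemidef_conjTranspose_mul_self Y
  rw [conjTranspose_eq_transpose_of_trivial] at this
  exact Matrix.nonneg_iff_posSemidef.2 this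

theorem norm_transpose (Y : Matrix (Fin m) (Fin d) ℝ) : ‖Yᵀ‖ = ‖Y‖ := by
  rw [← conjTranspose_eq_transpose_of_trivial, l2_opNorm_conjTranspose]

theorem norm_transpose_mul_self (Y : Matrix (Fin m) (Fin d) ℝ) : ‖Yᵀ * Y‖ = ‖Y‖ ^ 2 := by
  rw [← conjTranspose_eq_transpose_of_trivial, l2_opNorm_conjTranspose_mul_self, sq]

theorem trace_nonneg_of_nonneg {X : Matrix (Fin d) (Fin d) ℝ} (hX : 0 ≤ X) : 0 ≤ X.trace :=
  (Matrix.nonneg_iff_posSemidef.1 hX).trace_nonneg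

/-- Cyclicity moves one factor of X = ZᵀZ to the other side and leaves the trace of a congruence of
Y. Cost comparisons are read off from Loewner inequalities in this way. -/
theorem trace_mul_nonneg {X Y : Matrix (Fin d) (Fin d) ℝ} (hX : 0 ≤ X) (hY : 0 ≤ Y) :
    0 ≤ (X * Y).trace := by
  obtain ⟨Z, rfl⟩ := exists_transpose_mul_self hX
  rw [Matrix.mul_assoc, Matrix.trace_mul_comm]
  exact trace_nonneg_of_nonneg (congr_nonneg' hY Z)

theorem trace_mul_mono {G X Y : Matrix (Fin d) (Fin d) ℝ} (hG : 0 ≤ G) (h : X ≤ Y) :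
    (G * X).trace ≤ (G * Y).trace := by
  have := trace_mul_nonneg hG (sub_nonneg.2 h)
  rwa [Matrix.mul_sub, trace_sub, sub_nonneg] at this

theorem trace_mul_mono_left {G X Y : Matrix (Fin d) (Fin d) ℝ} (hG : 0 ≤ G) (h : X ≤ Y) :
    (X * G).trace ≤ (Y * G).trace := by
  rw [trace_mul_comm X, trace_mul_comm Y]
  exact trace_mul_mono hG h

theorem trace_mono {X Y : Matrix (Fin d) (Fin d) ℝ} (h : X ≤ Y) : X.trace ≤ Y.trace := by
  have := trace_nonneg_of_nonneg (sub_nonneg.2 h)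
  rwa [trace_sub, sub_nonneg] at this

theorem smul_one_le_iff {X : Matrix (Fin d) (Fin d) ℝ} (hX : X.IsHermitian) {r : ℝ} :
    r • (1 : Matrix (Fin d) (Fin d) ℝ) ≤ X ↔ ∀ i, r ≤ hX.eigenvalues i := by
  rw [← Algebra.algebraMap_eq_smul_one, algebraMap_le_iff_le_spectrum hX,
    hX.spectrum_real_eq_range_eigenvalues, Set.forall_mem_range]

theorem le_smul_one_iff {X : Matrix (Fin d) (Fin d) ℝ} (hX : X.IsHermitian) {r : ℝ} :
    X ≤ r • (1 : Matrix (Fin d) (Fin d) ℝ) ↔ ∀ i, hX.eigenvalues i ≤ r := by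
  rw [← Algebra.algebraMap_eq_smul_one, le_algebraMap_iff_spectrum_le hX,
    hX.spectrum_real_eq_range_eigenvalues, Set.forall_mem_range]

theorem abs_eigenvalues_le_norm {X : Matrix (Fin d) (Fin d) ℝ} (hX : X.IsHermitian) (i : Fin d) :
    |hX.eigenvalues i| ≤ ‖X‖ := by
  have : Nonempty (Fin d) := ⟨i⟩
  have := spectrum.norm_le_norm_of_mem (hX.eigenvalues_mem_spectrum_real i)
  rwa [Real.norm_eq_abs] at this

theorem le_norm_smul_one {X : Matrix (Fin d) (Fin d) ℝ} (hX : X.IsHermitian) :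
    X ≤ ‖X‖ • (1 : Matrix (Fin d) (Fin d) ℝ) :=
  (le_smul_one_iff hX).2 fun i => (le_abs_self _).trans (abs_eigenvalues_le_norm hX i)

theorem neg_norm_smul_one_le {X : Matrix (Fin d) (Fin d) ℝ} (hX : X.IsHermitian) :
    (-‖X‖) • (1 : Matrix (Fin d) (Fin d) ℝ) ≤ X :=
  (smul_one_le_iff hX).2 fun i => neg_le.2 ((neg_le_abs _).trans (abs_eigenvalues_le_norm hX i))

theorem abs_trace_mul_le {G X : Matrix (Fin d) (Fin d) ℝ} (hG : 0 ≤ G) (hX : X.IsHermitian) :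
    |(G * X).trace| ≤ ‖X‖ * G.trace := by
  have h1 := trace_mul_mono hG (le_norm_smul_one hX)
  have h2 := trace_mul_mono hG (neg_norm_smul_one_le hX)
  simp only [Matrix.mul_smul, Matrix.mul_one, trace_smul, smul_eq_mul] at h1 h2
  exact abs_le.2 ⟨by linarith, h1⟩

theorem le_trace_smul_one {X : Matrix (Fin d) (Fin d) ℝ} (hX : 0 ≤ X) :
    X ≤ X.trace • (1 : Matrix (Fin d) (Fin d) ℝ) := by
  have hP := Matrix.nonneg_iff_posSemidef.1 hX
  refine (le_smul_one_iff hP.isHermitian).2 fun i => ?_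
  rw [hP.isHermitian.trace_eq_sum_eigenvalues]
  exact Finset.single_le_sum (f := fun j => hP.isHermitian.eigenvalues j)
    (fun j _ => hP.eigenvalues_nonneg j) (Finset.mem_univ i)

/-- For X = YᵀY the Loewner bound says ‖Yx‖² ≤ r‖x‖², and ‖X‖ = ‖Y‖². -/
theorem norm_le_of_le_smul_one {X : Matrix (Fin d) (Fin d) ℝ} (hX : 0 ≤ X) {r : ℝ} (hr : 0 ≤ r)
    (h : X ≤ r • (1 : Matrix (Fin d) (Fin d) ℝ)) : ‖X‖ ≤ r := by
  obtain ⟨Y, rfl⟩ := exists_transpose_mul_self hX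
  have key : ‖Y‖ ≤ √r := by
    rw [l2_opNorm_def]
    refine ContinuousLinearMap.opNorm_le_bound _ (Real.sqrt_nonneg r) fun x => ?_
    have h1 := (Matrix.le_iff.1 h).dotProduct_mulVec_nonneg x.ofLp
    rw [Matrix.sub_mulVec, dotProduct_sub, smul_mulVec, one_mulVec, dotProduct_smul,
      ← Matrix.mulVec_mulVec, dotProduct_mulVec, vecMul_transpose] at h1
    simp only [star_trivial, smul_eq_mul, sub_nonneg] at h1
    rw [← Real.sqrt_sq (norm_nonneg x), ← Real.sqrt_mul hr]
    refine Real.le_sqrt_of_sq_le ?_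
    rw [EuclideanSpace.norm_sq_eq, EuclideanSpace.norm_sq_eq]
    simpa [dotProduct, sq, Matrix.toLpLin_apply] using h1
  rw [norm_transpose_mul_self]
  calc ‖Y‖ ^ 2 ≤ √r ^ 2 := by gcongr
    _ = r := Real.sq_sqrt hr

theorem norm_le_trace {X : Matrix (Fin d) (Fin d) ℝ} (hX : 0 ≤ X) : ‖X‖ ≤ X.trace :=
  norm_le_of_le_smul_one hX (trace_nonneg_of_nonneg hX) (le_trace_smul_one hX)

theorem norm_mono_of_nonneg {X Y : Matrix (Fin d) (Fin d) ℝ} (hX : 0 ≤ X) (h : X ≤ Y) :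
    ‖X‖ ≤ ‖Y‖ :=
  norm_le_of_le_smul_one hX (norm_nonneg Y)
    (h.trans (le_norm_smul_one (isHermitian_of_nonneg (hX.trans h))))

theorem smul_one_mono {r s : ℝ} (h : r ≤ s) :
    r • (1 : Matrix (Fin d) (Fin d) ℝ) ≤ s • (1 : Matrix (Fin d) (Fin d) ℝ) := by
  rw [← sub_nonneg, ← sub_smul]
  exact smul_nonneg (sub_nonneg.2 h) zero_le_one

theorem le_of_smul_one_le_smul_one (hd : 0 < d) {r s : ℝ}
    (h : r • (1 : Matrix (Fin d) (Fin d) ℝ) ≤ s • (1 : Matrix (Fin d) (Fin d) ℝ)) : r ≤ s := by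
  have h1 := trace_mono h
  simp only [trace_smul, trace_one, Fintype.card_fin, smul_eq_mul] at h1
  exact le_of_mul_le_mul_right h1 (by exact_mod_cast hd)

theorem congr_smul_one_le {Y : Matrix (Fin m) (Fin d) ℝ} {r ρ : ℝ} (hr : 0 ≤ r) (hY : ‖Y‖ ≤ ρ) :
    Yᵀ * (r • (1 : Matrix (Fin m) (Fin m) ℝ)) * Y ≤
      (ρ ^ 2 * r) • (1 : Matrix (Fin d) (Fin d) ℝ) := by
  have h := le_norm_smul_one (isHermitian_of_nonneg (transpose_mul_self_nonneg Y))
  rw [norm_transpose_mul_self] at h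
  have h2 : Yᵀ * Y ≤ ρ ^ 2 • (1 : Matrix (Fin d) (Fin d) ℝ) := h.trans (smul_one_mono (by gcongr))
  have h3 := smul_le_smul_of_nonneg_left h2 hr
  rw [smul_smul, mul_comm r] at h3
  simpa [Matrix.mul_smul, Matrix.smul_mul] using h3

theorem nonneg_of_forall_neg_smul_one_le {X : Matrix (Fin d) (Fin d) ℝ} (hX : X.IsHermitian)
    (u : ℕ → ℝ) (hu : Filter.Tendsto u Filter.atTop (nhds 0))
    (h : ∀ t, u t • (1 : Matrix (Fin d) (Fin d) ℝ) ≤ X) : 0 ≤ X := by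
  rw [← zero_smul ℝ (1 : Matrix (Fin d) (Fin d) ℝ), smul_one_le_iff hX]
  exact fun i => le_of_tendsto' hu fun t => (smul_one_le_iff hX).1 (h t) i

/-- On positive semidefinite matrices the trace dominates the norm, so convergence becomes a
question about scalar series. -/
theorem summable_of_trace_summable {f : ℕ → Matrix (Fin d) (Fin d) ℝ} (hf : ∀ t, 0 ≤ f t)
    (h : Summable fun t => (f t).trace) : Summable f :=
  Summable.of_norm_bounded h fun t => norm_le_trace (hf t)

theorem sum_range_trace_le {f : ℕ → Matrix (Fin d) (Fin d) ℝ} {P : Matrix (Fin d) (Fin d) ℝ}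
    (h : ∀ T, ∑ t ∈ Finset.range T, f t ≤ P) (T : ℕ) :
    ∑ t ∈ Finset.range T, (f t).trace ≤ P.trace := by
  rw [← trace_sum]
  exact trace_mono (h T)

theorem summable_of_sum_range_le_matrix {f : ℕ → Matrix (Fin d) (Fin d) ℝ}
    {P : Matrix (Fin d) (Fin d) ℝ} (hf : ∀ t, 0 ≤ f t)
    (h : ∀ T, ∑ t ∈ Finset.range T, f t ≤ P) : Summable f :=
  summable_of_trace_summable hf
    (summable_of_sum_range_le (fun t => trace_nonneg_of_nonneg (hf t)) (sum_range_trace_le h))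

theorem isClosed_nonneg_matrix : IsClosed {X : Matrix (Fin d) (Fin d) ℝ | 0 ≤ X} := by
  have : {X : Matrix (Fin d) (Fin d) ℝ | 0 ≤ X} =
      {X | Xᴴ = X} ∩ ⋂ x : Fin d → ℝ, {X | 0 ≤ star x ⬝ᵥ (X *ᵥ x)} := by
    ext X
    simp [Matrix.nonneg_iff_posSemidef, posSemidef_iff_dotProduct_mulVec, Matrix.IsHermitian]
  rw [this]
  refine (isClosed_eq (by fun_prop) continuous_id).inter (isClosed_iInter fun x => ?_)
  exact isClosed_le continuous_const (by fun_prop)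

theorem hasSum_le_matrix {f : ℕ → Matrix (Fin d) (Fin d) ℝ} {F P : Matrix (Fin d) (Fin d) ℝ}
    (hF : HasSum f F) (h : ∀ T, ∑ t ∈ Finset.range T, f t ≤ P) : F ≤ P := by
  have := isClosed_nonneg_matrix.mem_of_tendsto (hF.tendsto_sum_nat.const_sub P)
    (Filter.Eventually.of_forall fun T => sub_nonneg.2 (h T))
  exact sub_nonneg.1 this

theorem hasSum_nonneg_matrix {f : ℕ → Matrix (Fin d) (Fin d) ℝ} {F : Matrix (Fin d) (Fin d) ℝ}
    (hF : HasSum f F) (hf : ∀ t, 0 ≤ f t) : 0 ≤ F :=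
  isClosed_nonneg_matrix.mem_of_tendsto hF.tendsto_sum_nat
    (Filter.Eventually.of_forall fun _ => Finset.sum_nonneg fun t _ => hf t)

end Loewner

/-! ### Smallest singular values -/

section SigmaMin

variable {d : ℕ}

theorem sigmaMin_nonneg {m d : ℕ} (Z : Matrix (Fin m) (Fin d) ℝ) : 0 ≤ sigmaMin Z :=
  LinearMap.singularValues_nonneg _ _

theorem sigmaMin_pos_left {m d : ℕ} {Z : Matrix (Fin m) (Fin d) ℝ} (h : 0 < sigmaMin Z) :
    0 < m := by
  rcases Nat.eq_zero_or_pos m with rfl | hm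
  · have : Z = 0 := Subsingleton.elim _ _
    simp [sigmaMin, this] at h
  · exact hm

theorem sigmaMin_pos_ne_zero {m d : ℕ} {Z : Matrix (Fin m) (Fin d) ℝ} (h : 0 < sigmaMin Z) :
    Z ≠ 0 := by
  rintro rfl
  simp [sigmaMin] at h

theorem sigmaMin_pos_right {m d : ℕ} {Z : Matrix (Fin m) (Fin d) ℝ} (h : 0 < sigmaMin Z) :
    0 < d := by
  rcases Nat.eq_zero_or_pos d with rfl | hm
  · exact absurd (Subsingleton.elim _ _) (sigmaMin_pos_ne_zero h)
  · exact hm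

/-- An eigenvalue λ of X gives the eigenvalue λ² of XᵀX, so λ ≥ 0 is itself a singular value; the
one of index d − 1 is the last in decreasing order. -/
theorem sigmaMin_smul_one_le {X : Matrix (Fin d) (Fin d) ℝ} (hX : 0 ≤ X) :
    sigmaMin X • (1 : Matrix (Fin d) (Fin d) ℝ) ≤ X := by
  have hP := Matrix.nonneg_iff_posSemidef.1 hX
  have hH := hP.isHermitian
  rw [smul_one_le_iff hH]
  intro i
  set T := Matrix.toEuclideanLin X with hT
  have hadj : LinearMap.adjoint T = T := by
    rw [hT, ← Matrix.toEuclideanLin_conjTranspose_eq_adjoint, hH.eq]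
  have hv : T (hH.eigenvectorBasis i) = hH.eigenvalues i • hH.eigenvectorBasis i := by
    rw [hT, Matrix.toLpLin_apply, hH.mulVec_eigenvectorBasis]
    rfl
  have hev : Module.End.HasEigenvalue (LinearMap.adjoint T ∘ₗ T) (hH.eigenvalues i ^ 2) := by
    refine Module.End.hasEigenvalue_of_hasEigenvector (x := hH.eigenvectorBasis i) ⟨?_, ?_⟩
    · rw [Module.End.mem_eigenspace_iff, hadj, LinearMap.comp_apply, hv, map_smul, hv, smul_smul,
        sq]
    · exact hH.eigenvectorBasis.toBasis.ne_zero i |> fun h => by simpa using h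
  have hfr : Module.finrank ℝ (EuclideanSpace ℝ (Fin d)) = d := by simp
  obtain ⟨j, hj⟩ := T.isSymmetric_adjoint_comp_self.exists_eigenvalues_eq hfr hev
  have h1 := T.sq_singularValues_fin hfr j
  have h2 : T.singularValues j ^ 2 = hH.eigenvalues i ^ 2 := by
    rw [h1]; exact hj
  have h3 : T.singularValues j = hH.eigenvalues i :=
    (sq_eq_sq₀ (T.singularValues_nonneg _) (hP.eigenvalues_nonneg i)).1 h2
  rw [← h3, sigmaMin]
  refine T.singularValues_antitone ?_
  simp only [min_self]
  omega

/-- Test on a right singular vector v: r‖v‖² ≤ ⟨Xv, v⟩ ≤ ‖Xv‖‖v‖ = σ_min‖v‖². For d > 0 the index d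
− 1 is that of a genuine singular value. -/
theorem le_sigmaMin (hd : 0 < d) {X : Matrix (Fin d) (Fin d) ℝ} {r : ℝ}
    (h : r • (1 : Matrix (Fin d) (Fin d) ℝ) ≤ X) : r ≤ sigmaMin X := by
  set T := Matrix.toEuclideanLin X with hT
  have hlt : min d d - 1 < Module.finrank ℝ (EuclideanSpace ℝ (Fin d)) := by simp; omega
  obtain ⟨v, hv⟩ := (T.hasEigenvalue_adjoint_comp_self_sq_singularValues hlt).exists_hasEigenvector
  have hv0 : v ≠ 0 := hv.2
  have h1 : LinearMap.adjoint T (T v) = (sigmaMin X) ^ 2 • v :=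
    Module.End.mem_eigenspace_iff.1 hv.1
  have h2 : ‖T v‖ ^ 2 = (sigmaMin X * ‖v‖) ^ 2 := by
    rw [← real_inner_self_eq_norm_sq, ← LinearMap.adjoint_inner_left, h1, inner_smul_left,
      real_inner_self_eq_norm_sq, mul_pow]
    simp
  have h3 : ‖T v‖ = sigmaMin X * ‖v‖ :=
    (sq_eq_sq₀ (norm_nonneg _) (mul_nonneg (sigmaMin_nonneg X) (norm_nonneg v))).1 h2
  have h4 := (Matrix.le_iff.1 h).dotProduct_mulVec_nonneg v.ofLp
  rw [Matrix.sub_mulVec, dotProduct_sub, smul_mulVec, one_mulVec, dotProduct_smul] at h4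
  simp only [star_trivial, smul_eq_mul, sub_nonneg] at h4
  have h5 : v.ofLp ⬝ᵥ v.ofLp = ‖v‖ ^ 2 := by
    rw [EuclideanSpace.norm_sq_eq]; simp [dotProduct, sq]
  have h6 : v.ofLp ⬝ᵥ (X *ᵥ v.ofLp) = inner ℝ (T v) v := by
    rw [hT, Matrix.toLpLin_apply, EuclideanSpace.inner_eq_star_dotProduct]
    simp
  have h7 := real_inner_le_norm (T v) v
  have hv1 : 0 < ‖v‖ := norm_pos_iff.2 hv0
  rw [h5, h6] at h4
  refine le_of_mul_le_mul_right ?_ (pow_pos hv1 2)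
  calc r * ‖v‖ ^ 2 ≤ ‖T v‖ * ‖v‖ := h4.trans h7
    _ = sigmaMin X * ‖v‖ ^ 2 := by rw [h3]; ring

theorem sigmaMin_le_norm (hd : 0 < d) {X : Matrix (Fin d) (Fin d) ℝ} (hX : 0 ≤ X) :
    sigmaMin X ≤ ‖X‖ :=
  le_of_smul_one_le_smul_one hd
    ((sigmaMin_smul_one_le hX).trans (le_norm_smul_one (isHermitian_of_nonneg hX)))

theorem posDef_of_smul_one_le {X : Matrix (Fin d) (Fin d) ℝ} {r : ℝ} (hr : 0 < r)
    (h : r • (1 : Matrix (Fin d) (Fin d) ℝ) ≤ X) : X.PosDef := by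
  have h1 : X = (X - r • 1) + r • 1 := by abel
  rw [h1]
  exact Matrix.PosDef.posSemidef_add (Matrix.le_iff.1 h) (Matrix.PosDef.one.smul hr)

theorem sigmaMin_pos_of_posDef (hd : 0 < d) {X : Matrix (Fin d) (Fin d) ℝ} (hX : X.PosDef) :
    0 < sigmaMin X := by
  have : Nonempty (Fin d) := ⟨⟨0, hd⟩⟩
  obtain ⟨i, hi⟩ := Finite.exists_min hX.isHermitian.eigenvalues
  exact (hX.eigenvalues_pos i).trans_le (le_sigmaMin hd ((smul_one_le_iff hX.isHermitian).2 hi))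

/-- With X⁻¹ = YᵀY one has Y X Yᵀ = 1, so congruence by Y turns the hypothesis into r·YYᵀ ≤ 1; and
YYᵀ and YᵀY have the same norm. -/
theorem norm_inv_le {X : Matrix (Fin d) (Fin d) ℝ} {r : ℝ} (hr : 0 < r)
    (h : r • (1 : Matrix (Fin d) (Fin d) ℝ) ≤ X) : ‖X⁻¹‖ ≤ r⁻¹ := by
  have hX := posDef_of_smul_one_le hr h
  have hI := hX.inv
  have hdet : IsUnit X.det := (Matrix.isUnit_iff_isUnit_det _).1 hX.isUnit
  refine norm_le_of_le_smul_one (Matrix.nonneg_iff_posSemidef.2 hI.posSemidef) (by positivity) ?_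
  obtain ⟨Y, hY⟩ := exists_transpose_mul_self (Matrix.nonneg_iff_posSemidef.2 hI.posSemidef)
  have hYY : IsUnit Y := by
    rw [Matrix.isUnit_iff_isUnit_det]
    have h1 : IsUnit (X⁻¹).det := (Matrix.isUnit_iff_isUnit_det _).1 hI.isUnit
    rw [hY, det_mul] at h1
    exact isUnit_of_mul_isUnit_right h1
  have hYd : IsUnit Y.det := (Matrix.isUnit_iff_isUnit_det _).1 hYY
  have h2 := congr_mono' h Y
  have h3 : Y * X * Yᵀ = 1 := by
    have h4 : X = Y⁻¹ * (Yᵀ)⁻¹ := by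
      rw [← Matrix.mul_inv_rev, ← hY, Matrix.nonsing_inv_nonsing_inv _ hdet]
    have hYt : IsUnit (Yᵀ).det := by rwa [det_transpose]
    rw [h4, ← Matrix.mul_assoc, Matrix.mul_nonsing_inv _ hYd, Matrix.one_mul,
      Matrix.nonsing_inv_mul _ hYt]
  rw [h3, Matrix.mul_smul, Matrix.smul_mul, Matrix.mul_one] at h2
  have h5 : Y * Yᵀ ≤ r⁻¹ • (1 : Matrix (Fin d) (Fin d) ℝ) := by
    have := smul_le_smul_of_nonneg_left h2 (inv_pos.2 hr).le
    rwa [smul_smul, inv_mul_cancel₀ hr.ne', one_smul] at this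
  have h6 : ‖Y‖ ^ 2 ≤ r⁻¹ := by
    rw [← norm_transpose, ← norm_transpose_mul_self, transpose_transpose]
    refine norm_le_of_le_smul_one ?_ (by positivity) h5
    simpa using transpose_mul_self_nonneg Yᵀ
  rw [hY]
  refine (le_norm_smul_one (isHermitian_of_nonneg (transpose_mul_self_nonneg Y))).trans
    (smul_one_mono ?_)
  rwa [norm_transpose_mul_self]

end SigmaMin

/-! ### The trace and the log-determinant -/

section LogDet

variable {d : ℕ}

/-- The inequality log λ ≤ λ − 1, summed over the eigenvalues; equality forces every λ to be 1. -/
theorem card_add_log_det_le_trace {X : Matrix (Fin d) (Fin d) ℝ} (hX : X.PosDef) :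
    d + Real.log X.det ≤ X.trace := by
  have hH := hX.isHermitian
  have h1 : Real.log X.det = ∑ i, Real.log (hH.eigenvalues i) := by
    rw [hH.det_eq_prod_eigenvalues, ← Real.log_prod]
    · rfl
    · exact fun i _ => (hX.eigenvalues_pos i).ne'
  have h2 : (d : ℝ) = ∑ _i : Fin d, (1 : ℝ) := by simp
  rw [h1, h2, hH.trace_eq_sum_eigenvalues, ← Finset.sum_add_distrib]
  refine Finset.sum_le_sum fun i _ => ?_
  have := Real.log_le_sub_one_of_pos (hX.eigenvalues_pos i)
  simp only [RCLike.ofReal_real_eq_id, id]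
  linarith

theorem eq_one_of_trace_le {X : Matrix (Fin d) (Fin d) ℝ} (hX : X.PosDef)
    (h : X.trace ≤ d + Real.log X.det) : X = 1 := by
  have hH := hX.isHermitian
  have h1 : Real.log X.det = ∑ i, Real.log (hH.eigenvalues i) := by
    rw [hH.det_eq_prod_eigenvalues, ← Real.log_prod]
    · rfl
    · exact fun i _ => (hX.eigenvalues_pos i).ne'
  have h2 : (d : ℝ) = ∑ _i : Fin d, (1 : ℝ) := by simp
  rw [h1, h2, hH.trace_eq_sum_eigenvalues, ← Finset.sum_add_distrib] at h
  simp only [RCLike.ofReal_real_eq_id, id] at h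
  have h3 : ∀ i, 1 + Real.log (hH.eigenvalues i) ≤ hH.eigenvalues i := fun i => by
    have := Real.log_le_sub_one_of_pos (hX.eigenvalues_pos i)
    linarith
  have h4 := (Finset.sum_eq_sum_iff_of_le (s := Finset.univ) fun i _ => h3 i).1
    (le_antisymm (Finset.sum_le_sum fun i _ => h3 i) h)
  have h5 : ∀ i, hH.eigenvalues i = 1 := fun i => by
    by_contra hne
    have := Real.log_lt_sub_one_of_pos (hX.eigenvalues_pos i) hne
    have := h4 i (Finset.mem_univ i)
    linarith
  refine le_antisymm ?_ ?_
  · have := (le_smul_one_iff hH (r := 1)).2 fun i => (h5 i).le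
    rwa [one_smul] at this
  · have := (smul_one_le_iff hH (r := 1)).2 fun i => (h5 i).ge
    rwa [one_smul] at this

/-- The function `Σ ↦ tr (H Σ) - log det Σ` is minimal at `H⁻¹` only. -/
theorem trace_mul_sub_log_det_ge {H X : Matrix (Fin d) (Fin d) ℝ} (hH : H.PosDef)
    (hX : X.PosDef) : d + Real.log H.det ≤ (H * X).trace - Real.log X.det ∧
      ((H * X).trace - Real.log X.det ≤ d + Real.log H.det → X = H⁻¹) := by
  obtain ⟨Y, hY⟩ := exists_transpose_mul_self (Matrix.nonneg_iff_posSemidef.2 hH.posSemidef)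
  have hdet : IsUnit H.det := (Matrix.isUnit_iff_isUnit_det _).1 hH.isUnit
  have hYd : IsUnit Y.det := by
    rw [hY, det_mul] at hdet
    exact isUnit_of_mul_isUnit_right hdet
  have hYt : IsUnit (Yᵀ).det := by rwa [det_transpose]
  -- With H = YᵀY, passing from X to Y X Yᵀ reduces the claim to H = 1.
  have hZ : (Y * X * Yᵀ).PosDef := by
    have := hX.mul_mul_conjTranspose_same (B := Y) (Matrix.vecMul_injective_of_isUnit
      ((Matrix.isUnit_iff_isUnit_det _).2 hYd))
    rwa [conjTranspose_eq_transpose_of_trivial] at this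
  have htr : (Y * X * Yᵀ).trace = (H * X).trace := by
    rw [trace_mul_comm, ← Matrix.mul_assoc, hY]
  have hld : Real.log (Y * X * Yᵀ).det = Real.log H.det + Real.log X.det := by
    rw [← Real.log_mul hH.det_pos.ne' hX.det_pos.ne', det_mul, det_mul, hY, det_mul]
    ring_nf
  refine ⟨?_, fun h => ?_⟩
  · have := card_add_log_det_le_trace hZ
    rw [htr, hld] at this
    linarith
  · have h1 := eq_one_of_trace_le hZ (by rw [htr, hld]; linarith)
    have h2 : H * X = 1 := by
      have : Yᵀ * (Y * X * Yᵀ) * (Yᵀ)⁻¹ = 1 := by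
        rw [h1, Matrix.mul_one, Matrix.mul_nonsing_inv _ hYt]
      rw [← this, hY]
      simp only [Matrix.mul_assoc, Matrix.mul_nonsing_inv _ hYt, Matrix.mul_one]
    exact (Matrix.inv_eq_right_inv h2).symm

end LogDet

/-! ### Discrete Lyapunov equations and inequalities -/

section Lyapunov

variable {d : ℕ}

/-- Iterating gives Z ≤ γ^t‖Z‖, since congruence by a contraction does not enlarge multiples of the
identity. The decay comes from the discount alone, so ‖F‖ ≤ 1 suffices. -/
theorem nonpos_of_le_discounted_congr {F Z : Matrix (Fin d) (Fin d) ℝ} {γ : ℝ} (hγ0 : 0 ≤ γ)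
    (hγ1 : γ < 1) (hF : ‖F‖ ≤ 1) (hZ : Z.IsHermitian) (h : Z ≤ γ • (Fᵀ * Z * F)) : Z ≤ 0 := by
  have key : ∀ t : ℕ, Z ≤ (γ ^ t * ‖Z‖) • (1 : Matrix (Fin d) (Fin d) ℝ) := by
    intro t
    induction t with
    | zero => simpa using le_norm_smul_one hZ
    | succ t ih =>
      refine h.trans ((smul_le_smul_of_nonneg_left (congr_mono ih F) hγ0).trans ?_)
      have h1 := smul_le_smul_of_nonneg_left
        (congr_smul_one_le (Y := F) (r := γ ^ t * ‖Z‖) (by positivity) hF) hγ0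
      refine h1.trans (le_of_eq ?_)
      rw [smul_smul]
      congr 1
      ring
  have h2 : 0 ≤ -Z := by
    refine nonneg_of_forall_neg_smul_one_le hZ.neg (fun t => -(γ ^ t * ‖Z‖)) ?_ fun t => ?_
    · simpa using ((tendsto_pow_atTop_nhds_zero_of_lt_one hγ0 hγ1).mul_const ‖Z‖).neg
    · rw [neg_smul]
      exact neg_le_neg (key t)
  simpa using h2

/-- The multiple y = g/(1−γ) of the identity is a supersolution, as y = g + γy; subtracting it
leaves the homogeneous inequality. -/
theorem le_smul_one_of_le_add_discounted_congr {F Z : Matrix (Fin d) (Fin d) ℝ} {γ g : ℝ}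
    (hγ0 : 0 ≤ γ) (hγ1 : γ < 1) (hg : 0 ≤ g) (hF : ‖F‖ ≤ 1) (hZ : Z.IsHermitian)
    (h : Z ≤ g • (1 : Matrix (Fin d) (Fin d) ℝ) + γ • (Fᵀ * Z * F)) :
    Z ≤ (g / (1 - γ)) • (1 : Matrix (Fin d) (Fin d) ℝ) := by
  have h1γ : 0 < 1 - γ := by linarith
  set y := g / (1 - γ) with hy
  have hy0 : 0 ≤ y := by positivity
  have hyg : g = y - γ * y := by rw [hy]; field_simp
  rw [← sub_nonpos]
  refine nonpos_of_le_discounted_congr hγ0 hγ1 hF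
    (hZ.sub ((Matrix.isHermitian_one).smul (IsSelfAdjoint.all y))) ?_
  have h2 := smul_le_smul_of_nonneg_left (congr_smul_one_le (Y := F) hy0 hF) hγ0
  simp only [one_pow, one_mul] at h2
  rw [Matrix.mul_sub, Matrix.sub_mul, smul_sub]
  calc Z - y • 1 ≤ (g • (1 : Matrix (Fin d) (Fin d) ℝ) + γ • (Fᵀ * Z * F)) - y • 1 :=
        sub_le_sub_right h _
    _ = γ • (Fᵀ * Z * F) - γ • y • (1 : Matrix (Fin d) (Fin d) ℝ) := by
        rw [hyg, sub_smul, smul_smul]; abel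
    _ ≤ _ := sub_le_sub_left h2 _

theorem norm_le_of_lyapunov {F S X : Matrix (Fin d) (Fin d) ℝ} {γ ρ : ℝ} (hγ0 : 0 ≤ γ)
    (hγρ : γ * ρ ^ 2 < 1) (hF : ‖F‖ ≤ ρ) (hS : S = X + γ • (F * S * Fᵀ)) :
    ‖S‖ ≤ ‖X‖ / (1 - γ * ρ ^ 2) := by
  have hρ : 0 ≤ ρ := (norm_nonneg F).trans hF
  have h1 : ‖F * S * Fᵀ‖ ≤ ρ ^ 2 * ‖S‖ := by
    calc ‖F * S * Fᵀ‖ ≤ ‖F‖ * ‖S‖ * ‖Fᵀ‖ :=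
          (norm_mul_le _ _).trans (mul_le_mul_of_nonneg_right (norm_mul_le _ _) (norm_nonneg _))
      _ ≤ ρ * ‖S‖ * ρ := by rw [norm_transpose]; gcongr
      _ = ρ ^ 2 * ‖S‖ := by ring
  have h2 : ‖S‖ ≤ ‖X‖ + γ * (ρ ^ 2 * ‖S‖) := by
    conv_lhs => rw [hS]
    refine (norm_add_le _ _).trans ?_
    rw [norm_smul, Real.norm_eq_abs, abs_of_nonneg hγ0]
    gcongr
  rw [le_div_iff₀ (by linarith)]
  linarith

theorem norm_congr_sub_congr_le {F F' S : Matrix (Fin d) (Fin d) ℝ} {ρ : ℝ} (hF : ‖F‖ ≤ ρ)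
    (hF' : ‖F'‖ ≤ ρ) : ‖F' * S * F'ᵀ - F * S * Fᵀ‖ ≤ 2 * ρ * ‖F' - F‖ * ‖S‖ := by
  have hρ : 0 ≤ ρ := (norm_nonneg F).trans hF
  have h0 : F' * S * F'ᵀ - F * S * Fᵀ = (F' - F) * S * F'ᵀ + F * S * (F' - F)ᵀ := by
    simp only [Matrix.sub_mul, Matrix.mul_sub, transpose_sub]; abel
  have h1 : ‖(F' - F) * S * F'ᵀ‖ ≤ ‖F' - F‖ * ‖S‖ * ρ := by
    refine (norm_mul_le _ _).trans ?_
    rw [norm_transpose]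
    gcongr
    exact norm_mul_le _ _
  have h2 : ‖F * S * (F' - F)ᵀ‖ ≤ ρ * ‖S‖ * ‖F' - F‖ := by
    refine (norm_mul_le _ _).trans ?_
    rw [norm_transpose]
    gcongr
    exact (norm_mul_le _ _).trans (by gcongr)
  rw [h0]
  refine (norm_add_le _ _).trans ?_
  linarith

/-- S' − S solves the Lyapunov equation of F', whose source is X' − X plus the effect on S of
replacing F by F'. -/
theorem norm_lyapunov_sub_le {F F' S S' X X' : Matrix (Fin d) (Fin d) ℝ} {γ ρ : ℝ} (hγ0 : 0 ≤ γ)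
    (hγρ : γ * ρ ^ 2 < 1) (hF : ‖F‖ ≤ ρ) (hF' : ‖F'‖ ≤ ρ) (hS : S = X + γ • (F * S * Fᵀ))
    (hS' : S' = X' + γ • (F' * S' * F'ᵀ)) :
    ‖S' - S‖ ≤ (‖X' - X‖ + γ * (2 * ρ * ‖F' - F‖ * (‖X‖ / (1 - γ * ρ ^ 2)))) /
      (1 - γ * ρ ^ 2) := by
  have hρ : 0 ≤ ρ := (norm_nonneg F).trans hF
  have h1 : S' - S = ((X' - X) + γ • (F' * S * F'ᵀ - F * S * Fᵀ)) +
      γ • (F' * (S' - S) * F'ᵀ) := by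
    conv_lhs => rw [hS, hS']
    simp only [Matrix.sub_mul, Matrix.mul_sub, smul_sub]; abel
  have h2 := norm_le_of_lyapunov hγ0 hγρ hF' h1
  have h4 : 0 < 1 - γ * ρ ^ 2 := by linarith
  refine h2.trans ?_
  gcongr
  refine (norm_add_le _ _).trans ?_
  rw [norm_smul, Real.norm_eq_abs, abs_of_nonneg hγ0]
  gcongr
  refine (norm_congr_sub_congr_le hF hF').trans ?_
  gcongr
  exact norm_le_of_lyapunov hγ0 hγρ hF hS

/-- Duality between the two Lyapunov operators. -/
theorem trace_mul_lyapunov {F D S X : Matrix (Fin d) (Fin d) ℝ} {γ : ℝ}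
    (hS : S = X + γ • (F * S * Fᵀ)) :
    (D * X).trace = ((D - γ • (Fᵀ * D * F)) * S).trace := by
  have hX : X = S - γ • (F * S * Fᵀ) := by rw [eq_sub_iff_add_eq]; exact hS.symm
  rw [Matrix.sub_mul, trace_sub, hX, Matrix.mul_sub, trace_sub]
  congr 1
  rw [Matrix.mul_smul, Matrix.smul_mul, trace_smul, trace_smul]
  congr 1
  rw [Matrix.mul_assoc Fᵀ, Matrix.mul_assoc Fᵀ, trace_mul_comm Fᵀ]
  simp only [Matrix.mul_assoc]

end Lyapunov

/-! ### Value matrices and policy improvement -/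

namespace Model

variable {n k : ℕ} (M : Model n k)

/-- The matrix of the quadratic stage cost under the feedback `u = -K x`. -/
def stageMatrix (K : Matrix (Fin k) (Fin n) ℝ) : Matrix (Fin n) (Fin n) ℝ :=
  M.Q + Kᵀ * M.R * K

/-- The Bellman operator of the feedback `u = -L x`, applied to the quadratic form of `P`. -/
def bellman (P : Matrix (Fin n) (Fin n) ℝ) (L : Matrix (Fin k) (Fin n) ℝ) :
    Matrix (Fin n) (Fin n) ℝ :=
  M.stageMatrix L + M.γ • ((M.A - M.B * L)ᵀ * P * (M.A - M.B * L))

/-- The decrease of the value matrix in one step of policy improvement. -/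
def decrement (K : Matrix (Fin k) (Fin n) ℝ) : Matrix (Fin n) (Fin n) ℝ :=
  (M.gradE K)ᵀ * (M.hess K)⁻¹ * M.gradE K

/-- The improved gain `K - (R + γ Bᵀ P_K B)⁻¹ E_K`. -/
def newton (K : Matrix (Fin k) (Fin n) ℝ) : Matrix (Fin k) (Fin n) ℝ :=
  K - (M.hess K)⁻¹ * M.gradE K

theorem R_nonneg : 0 ≤ M.R := Matrix.nonneg_iff_posSemidef.2 M.R_posDef.posSemidef

theorem stageMatrix_nonneg (K : Matrix (Fin k) (Fin n) ℝ) : 0 ≤ M.stageMatrix K :=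
  add_nonneg (Matrix.nonneg_iff_posSemidef.2 M.Q_posSemidef) (congr_nonneg M.R_nonneg K)

theorem valueMatrixTerm_zero (K : Matrix (Fin k) (Fin n) ℝ) :
    M.valueMatrixTerm K 0 = M.stageMatrix K := by
  simp [valueMatrixTerm, stageMatrix]

theorem valueMatrixTerm_succ (K : Matrix (Fin k) (Fin n) ℝ) (t : ℕ) :
    M.valueMatrixTerm K (t + 1) =
      M.γ • ((M.A - M.B * K)ᵀ * M.valueMatrixTerm K t * (M.A - M.B * K)) := by
  simp only [valueMatrixTerm, pow_succ' (M.A - M.B * K)ᵀ, pow_succ (M.A - M.B * K),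
    pow_succ' M.γ, Matrix.mul_smul, Matrix.smul_mul, smul_smul, Matrix.mul_assoc]

theorem valueMatrixTerm_nonneg (K : Matrix (Fin k) (Fin n) ℝ) (t : ℕ) :
    0 ≤ M.valueMatrixTerm K t := by
  have := congr_nonneg (M.stageMatrix_nonneg K) ((M.A - M.B * K) ^ t)
  rw [transpose_pow] at this
  exact smul_nonneg (pow_nonneg M.γ_pos.le t) this

theorem valueMatrix_nonneg (K : Matrix (Fin k) (Fin n) ℝ) : 0 ≤ M.valueMatrix K := by
  by_cases h : Summable (M.valueMatrixTerm K)
  · exact Matrix.nonneg_iff_posSemidef.2 (M.valueMatrix_posSemidef K h)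
  -- A divergent series has the default sum 0, which is nonnegative too; so the Hessian is positive
  -- definite at every gain.
  · rw [valueMatrix, tsum_eq_zero_of_not_summable h]

theorem hess_posDef (K : Matrix (Fin k) (Fin n) ℝ) : (M.hess K).PosDef :=
  M.R_posDef.add_posSemidef (Matrix.nonneg_iff_posSemidef.1
    (smul_nonneg M.γ_pos.le (congr_nonneg (M.valueMatrix_nonneg K) M.B)))

theorem hess_nonneg (K : Matrix (Fin k) (Fin n) ℝ) : 0 ≤ M.hess K :=
  Matrix.nonneg_iff_posSemidef.2 (M.hess_posDef K).posSemidef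

theorem hess_inv_nonneg (K : Matrix (Fin k) (Fin n) ℝ) : 0 ≤ (M.hess K)⁻¹ :=
  Matrix.nonneg_iff_posSemidef.2 (M.hess_posDef K).inv.posSemidef

theorem isUnit_det_hess (K : Matrix (Fin k) (Fin n) ℝ) : IsUnit (M.hess K).det :=
  (Matrix.isUnit_iff_isUnit_det _).1 (M.hess_posDef K).isUnit

theorem decrement_nonneg (K : Matrix (Fin k) (Fin n) ℝ) : 0 ≤ M.decrement K :=
  congr_nonneg (M.hess_inv_nonneg K) _

theorem bellman_valueMatrix {K : Matrix (Fin k) (Fin n) ℝ} (h : Summable (M.valueMatrixTerm K)) :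
    M.bellman (M.valueMatrix K) K = M.valueMatrix K :=
  (M.valueMatrix_eq K h).symm

theorem bellman_mono {P P' : Matrix (Fin n) (Fin n) ℝ} (h : P ≤ P')
    (L : Matrix (Fin k) (Fin n) ℝ) : M.bellman P L ≤ M.bellman P' L :=
  add_le_add_right (smul_le_smul_of_nonneg_left (congr_mono h _) M.γ_pos.le) _

/-- A policy whose Bellman operator decreases `P` has a value matrix, and that is at most `P`. -/
theorem summable_and_valueMatrix_le {P : Matrix (Fin n) (Fin n) ℝ}
    {L : Matrix (Fin k) (Fin n) ℝ} (hP : 0 ≤ P) (h : M.bellman P L ≤ P) :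
    Summable (M.valueMatrixTerm L) ∧ M.valueMatrix L ≤ M.bellman P L := by
  -- The partial sums are the iterates of the monotone Bellman operator started at 0, so they stay
  -- below the supersolution P.
  have key : ∀ T, ∑ t ∈ Finset.range T, M.valueMatrixTerm L t ≤ P := by
    intro T
    induction T with
    | zero => simpa using hP
    | succ T ih =>
      rw [Finset.sum_range_succ']
      simp only [valueMatrixTerm_succ, valueMatrixTerm_zero]
      rw [← Finset.smul_sum, ← Finset.sum_mul, ← Finset.mul_sum, add_comm]
      exact (M.bellman_mono ih L).trans h
  have hs := summable_of_sum_range_le_matrix (M.valueMatrixTerm_nonneg L) key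
  refine ⟨hs, ?_⟩
  rw [← M.bellman_valueMatrix hs]
  exact M.bellman_mono (hasSum_le_matrix hs.hasSum key) L

/-- The Bellman operator is quadratic in the gain. For P = P_K the linear coefficient is E_K and the
quadratic one is H_K. -/
theorem bellman_add (P : Matrix (Fin n) (Fin n) ℝ) (hP : Pᵀ = P)
    (K D : Matrix (Fin k) (Fin n) ℝ) :
    M.bellman P (K + D) = M.bellman P K +
      Dᵀ * (-(M.γ • (M.Bᵀ * P * (M.A - M.B * K))) + M.R * K) +
      (-(M.γ • (M.Bᵀ * P * (M.A - M.B * K))) + M.R * K)ᵀ * D +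
      Dᵀ * (M.R + M.γ • (M.Bᵀ * P * M.B)) * D := by
  have hR : M.Rᵀ = M.R := transpose_eq_of_nonneg M.R_nonneg
  have h1 : M.A - M.B * (K + D) = (M.A - M.B * K) - M.B * D := by
    rw [Matrix.mul_add]; abel
  rw [bellman, h1, bellman, stageMatrix, stageMatrix]
  generalize M.A - M.B * K = F
  simp only [transpose_add, transpose_sub, transpose_neg, transpose_smul, transpose_mul,
    transpose_transpose, hP, hR, Matrix.mul_add, Matrix.add_mul, Matrix.mul_sub, Matrix.sub_mul,
    Matrix.mul_neg, Matrix.neg_mul, Matrix.mul_smul, Matrix.smul_mul, smul_sub, Matrix.mul_assoc]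
  abel

/-- Completing the square in the Bellman operator. -/
theorem bellman_eq_square {K : Matrix (Fin k) (Fin n) ℝ} (h : Summable (M.valueMatrixTerm K))
    (L : Matrix (Fin k) (Fin n) ℝ) :
    M.bellman (M.valueMatrix K) L = M.valueMatrix K - M.decrement K +
      (L - M.newton K)ᵀ * M.hess K * (L - M.newton K) := by
  have h1 := M.bellman_add (M.valueMatrix K) (transpose_eq_of_nonneg (M.valueMatrix_nonneg K))
    K (L - K)
  rw [add_sub_cancel, M.bellman_valueMatrix h] at h1
  rw [h1]
  change M.valueMatrix K + (L - K)ᵀ * M.gradE K + (M.gradE K)ᵀ * (L - K) +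
    (L - K)ᵀ * M.hess K * (L - K) = _
  have h2 : L - M.newton K = (L - K) + (M.hess K)⁻¹ * M.gradE K := by rw [newton]; abel
  have h3 := transpose_eq_of_nonneg (M.hess_inv_nonneg K)
  rw [h2, decrement]
  generalize L - K = D
  have h4 : (M.hess K)⁻¹ * M.hess K = 1 := Matrix.nonsing_inv_mul _ (M.isUnit_det_hess K)
  have h5 : M.hess K * (M.hess K)⁻¹ = 1 := Matrix.mul_nonsing_inv _ (M.isUnit_det_hess K)
  have h6 : M.hess K * ((M.hess K)⁻¹ * M.gradE K) = M.gradE K := by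
    rw [← Matrix.mul_assoc, h5, Matrix.one_mul]
  have h7 : (M.gradE K)ᵀ * (M.hess K)⁻¹ * M.hess K = (M.gradE K)ᵀ := by
    rw [Matrix.mul_assoc, h4, Matrix.mul_one]
  simp only [transpose_add, transpose_mul, h3, Matrix.add_mul, Matrix.mul_add]
  rw [h7, Matrix.mul_assoc Dᵀ (M.hess K) ((M.hess K)⁻¹ * M.gradE K), h6, ← Matrix.mul_assoc
    (M.gradE K)ᵀ (M.hess K)⁻¹ (M.gradE K)]
  abel

theorem bellman_newton {K : Matrix (Fin k) (Fin n) ℝ} (h : Summable (M.valueMatrixTerm K)) :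
    M.bellman (M.valueMatrix K) (M.newton K) = M.valueMatrix K - M.decrement K := by
  rw [M.bellman_eq_square h]; simp

theorem sub_decrement_le_bellman {K : Matrix (Fin k) (Fin n) ℝ}
    (h : Summable (M.valueMatrixTerm K)) (L : Matrix (Fin k) (Fin n) ℝ) :
    M.valueMatrix K - M.decrement K ≤ M.bellman (M.valueMatrix K) L := by
  rw [M.bellman_eq_square h]
  exact le_add_of_nonneg_right (congr_nonneg (M.hess_nonneg K) _)

/-- Policy improvement. -/
theorem newton_summable_and_le {K : Matrix (Fin k) (Fin n) ℝ}
    (h : Summable (M.valueMatrixTerm K)) :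
    Summable (M.valueMatrixTerm (M.newton K)) ∧
      M.valueMatrix (M.newton K) ≤ M.valueMatrix K - M.decrement K := by
  have h1 := M.bellman_newton h
  have h2 := M.summable_and_valueMatrix_le (M.valueMatrix_nonneg K) (L := M.newton K)
    (by rw [h1]; exact sub_le_self _ (M.decrement_nonneg K))
  rwa [h1] at h2

theorem valueMatrix_sub_newton {K : Matrix (Fin k) (Fin n) ℝ}
    (h : Summable (M.valueMatrixTerm K)) :
    M.valueMatrix K - M.valueMatrix (M.newton K) = M.decrement K +
      M.γ • ((M.A - M.B * M.newton K)ᵀ * (M.valueMatrix K - M.valueMatrix (M.newton K)) *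
        (M.A - M.B * M.newton K)) := by
  have h1 := M.bellman_newton h
  have h2 := M.bellman_valueMatrix (M.newton_summable_and_le h).1
  have h3 : M.valueMatrix K = M.bellman (M.valueMatrix K) (M.newton K) + M.decrement K := by
    rw [h1]; abel
  conv_lhs => rw [h3, ← h2]
  simp only [bellman, Matrix.mul_sub, Matrix.sub_mul, smul_sub]
  abel

/-- Dropping the completed square turns the Lyapunov equation of the improved gain into an
inequality for any L, with the same source. For L = K* the decrement thus controls the suboptimality
of K. -/
theorem valueMatrix_sub_le {K L : Matrix (Fin k) (Fin n) ℝ}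
    (hK : Summable (M.valueMatrixTerm K)) (hL : Summable (M.valueMatrixTerm L)) :
    M.valueMatrix K - M.valueMatrix L ≤ M.decrement K +
      M.γ • ((M.A - M.B * L)ᵀ * (M.valueMatrix K - M.valueMatrix L) * (M.A - M.B * L)) := by
  have h1 := M.sub_decrement_le_bellman hK L
  have h2 := M.bellman_valueMatrix hL
  calc M.valueMatrix K - M.valueMatrix L
      ≤ (M.bellman (M.valueMatrix K) L + M.decrement K) - M.valueMatrix L :=
        sub_le_sub_right (sub_le_iff_le_add.1 h1) _
    _ = _ := by
        conv_lhs => rw [← h2]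
        simp only [bellman, Matrix.mul_sub, Matrix.sub_mul, smul_sub]
        abel

/-- The stationarity relation RL = γBᵀP_L(A − BL) cancels all but P_K − P_L, so the error of the new
gain is controlled by that of the value matrix. -/
theorem newton_sub_of_gradE_eq_zero {K L : Matrix (Fin k) (Fin n) ℝ} (hL : M.gradE L = 0) :
    M.newton K - L = (M.hess K)⁻¹ *
      (M.γ • (M.Bᵀ * (M.valueMatrix K - M.valueMatrix L) * (M.A - M.B * L))) := by
  have h1 : M.R * L = M.γ • (M.Bᵀ * M.valueMatrix L * (M.A - M.B * L)) := by
    rw [gradE, neg_add_eq_zero] at hL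
    exact hL.symm
  have h4 : (M.hess K)⁻¹ * M.hess K = 1 := Matrix.nonsing_inv_mul _ (M.isUnit_det_hess K)
  have h2 : M.newton K - L = (M.hess K)⁻¹ * (M.hess K * (K - L) - M.gradE K) := by
    rw [Matrix.mul_sub, ← Matrix.mul_assoc, h4, Matrix.one_mul, newton]; abel
  rw [h2]
  congr 1
  have h3 : M.hess K * (K - L) - M.gradE K =
      M.γ • (M.Bᵀ * M.valueMatrix K * (M.A - M.B * L)) - M.R * L := by
    rw [hess, gradE]
    simp only [Matrix.add_mul, Matrix.mul_sub, Matrix.smul_mul, Matrix.mul_assoc, smul_sub]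
    abel
  rw [h3, h1]
  simp only [Matrix.sub_mul, Matrix.mul_sub, smul_sub]
  abel

theorem decrement_eq_zero_iff {K : Matrix (Fin k) (Fin n) ℝ} :
    M.decrement K = 0 ↔ M.gradE K = 0 := by
  refine ⟨fun h => ?_, fun h => by simp [decrement, h]⟩
  have h4 : M.hess K * (M.hess K)⁻¹ = 1 := Matrix.mul_nonsing_inv _ (M.isUnit_det_hess K)
  obtain ⟨Y, hY⟩ := exists_transpose_mul_self (M.hess_inv_nonneg K)
  have h1 : (Y * M.gradE K)ᵀ * (Y * M.gradE K) = 0 := by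
    rw [← h, decrement, hY, transpose_mul]
    simp only [Matrix.mul_assoc]
  have h2 : Y * M.gradE K = 0 := by
    rw [← norm_eq_zero]
    have := norm_transpose_mul_self (Y * M.gradE K)
    rw [h1, norm_zero] at this
    exact pow_eq_zero_iff (two_ne_zero) |>.1 this.symm
  calc M.gradE K = M.hess K * (M.hess K)⁻¹ * M.gradE K := by rw [h4, Matrix.one_mul]
    _ = M.hess K * Yᵀ * (Y * M.gradE K) := by rw [hY]; simp only [Matrix.mul_assoc]
    _ = 0 := by rw [h2, Matrix.mul_zero]

/-- Policy iteration converges to the optimal value matrix from above: if `L` is stabilizing and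
no iterate has a smaller value in the direction of a positive definite `X`, then the value matrix
of `L` is at most the first one. -/
theorem valueMatrix_le_of_policy_iteration {K : ℕ → Matrix (Fin k) (Fin n) ℝ}
    {L : Matrix (Fin k) (Fin n) ℝ} {X : Matrix (Fin n) (Fin n) ℝ} {r : ℝ}
    (hK : Summable (M.valueMatrixTerm (K 0))) (hnewton : ∀ j, K (j + 1) = M.newton (K j))
    (hL : Summable (M.valueMatrixTerm L)) (hstab : ‖M.A - M.B * L‖ ≤ 1) (hr : 0 < r)
    (hX : r • (1 : Matrix (Fin n) (Fin n) ℝ) ≤ X)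
    (hopt : ∀ j, Summable (M.valueMatrixTerm (K j)) →
      (M.valueMatrix L * X).trace ≤ (M.valueMatrix (K j) * X).trace) :
    M.valueMatrix L ≤ M.valueMatrix (K 0) := by
  have hX0 : 0 ≤ X := (smul_nonneg hr.le zero_le_one).trans hX
  have hs : ∀ j, Summable (M.valueMatrixTerm (K j)) := by
    intro j
    induction j with
    | zero => exact hK
    | succ j ih => rw [hnewton]; exact (M.newton_summable_and_le ih).1
  have hstep : ∀ j, M.valueMatrix (K (j + 1)) ≤ M.valueMatrix (K j) - M.decrement (K j) :=
    fun j => by rw [hnewton]; exact (M.newton_summable_and_le (hs j)).2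
  -- Telescoping: the decrements have a bounded sum, so they tend to zero.
  have hsum : ∀ T, ∑ j ∈ Finset.range T, M.decrement (K j) + M.valueMatrix (K T) ≤
      M.valueMatrix (K 0) := by
    intro T
    induction T with
    | zero => simp
    | succ T ih =>
      refine le_trans ?_ ih
      rw [Finset.sum_range_succ, add_assoc]
      exact add_le_add_right (add_comm (M.decrement (K T)) _ ▸ le_sub_iff_add_le.1 (hstep T)) _
  have hdec : ∀ j, M.valueMatrix (K j) ≤ M.valueMatrix (K 0) := fun j =>
    (le_add_of_nonneg_left (Finset.sum_nonneg fun i _ => M.decrement_nonneg (K i))).trans (hsum j)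
  have htr : Summable fun j => (M.decrement (K j)).trace := by
    refine summable_of_sum_range_le (c := (M.valueMatrix (K 0)).trace)
      (fun j => trace_nonneg_of_nonneg (M.decrement_nonneg _)) fun T => ?_
    refine sum_range_trace_le (fun T => ?_) T
    exact (le_add_of_nonneg_right (M.valueMatrix_nonneg _)).trans (hsum T)
  set D := fun j => M.valueMatrix (K j) - M.valueMatrix L with hD
  have hDH : ∀ j, (D j).IsHermitian := fun j =>
    (isHermitian_of_nonneg (M.valueMatrix_nonneg _)).sub
      (isHermitian_of_nonneg (M.valueMatrix_nonneg _))
  set y := fun j => (M.decrement (K j)).trace / (1 - M.γ) with hy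
  have h1γ : 0 < 1 - M.γ := by linarith [M.γ_lt_one]
  -- Upper bound from the Lyapunov inequality along the closed loop of L, whose source is at most
  -- its trace times the identity.
  have hDy : ∀ j, D j ≤ y j • (1 : Matrix (Fin n) (Fin n) ℝ) := fun j => by
    refine le_smul_one_of_le_add_discounted_congr M.γ_pos.le M.γ_lt_one
      (trace_nonneg_of_nonneg (M.decrement_nonneg _)) hstab (hDH j) ?_
    exact (M.valueMatrix_sub_le (hs j) hL).trans
      (add_le_add_left (le_trace_smul_one (M.decrement_nonneg _)) _)
  -- Lower bound: Z = y_j − D_j is nonnegative, and optimality of L in the direction X bounds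
  -- tr(ZX), hence tr Z, hence Z, by a multiple of y_j.
  have hlow : ∀ j, (y j - y j * X.trace / r) • (1 : Matrix (Fin n) (Fin n) ℝ) ≤ D j := fun j => by
    set Z := y j • (1 : Matrix (Fin n) (Fin n) ℝ) - D j with hZ
    have hZ0 : 0 ≤ Z := sub_nonneg.2 (hDy j)
    have h1 : (Z * X).trace ≤ y j * X.trace := by
      rw [hZ, Matrix.sub_mul, trace_sub, Matrix.smul_mul, Matrix.one_mul, trace_smul, smul_eq_mul,
        sub_le_self_iff, hD, Matrix.sub_mul, trace_sub, sub_nonneg]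
      exact hopt j (hs j)
    have h2 := trace_mul_mono hZ0 hX
    rw [Matrix.mul_smul, Matrix.mul_one, trace_smul, smul_eq_mul] at h2
    have h3 : Z.trace ≤ y j * X.trace / r := by
      rw [le_div_iff₀ hr]; linarith
    have h4 : Z ≤ (y j * X.trace / r) • (1 : Matrix (Fin n) (Fin n) ℝ) :=
      (le_trace_smul_one hZ0).trans (smul_one_mono h3)
    rw [sub_smul, sub_le_comm]
    exact h4
  -- The value matrices decrease, so each lower bound for D_j is one for D_0; these bounds tend to
  -- zero.
  refine sub_nonneg.1 (nonneg_of_forall_neg_smul_one_le (hDH 0)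
    (fun j => y j - y j * X.trace / r) ?_ fun j => (hlow j).trans (sub_le_sub_right (hdec j) _))
  have hy0 : Filter.Tendsto y Filter.atTop (nhds 0) := by
    simpa using htr.tendsto_atTop_zero.div_const (1 - M.γ)
  simpa using hy0.sub ((hy0.mul_const X.trace).div_const r)

end Model

/-! ### Integrals of series and of quadratic forms -/

section Integrals

/-- Summable L¹ norms allow the series to be integrated term by term on the product space and make
its sum integrable, so that Fubini applies. -/
theorem hasSum_iterated_integral {α β : Type*} [MeasurableSpace α] [MeasurableSpace β]
    {μ : Measure α} {ν : Measure β} [SFinite μ] [SFinite ν] {f : ℕ → α × β → ℝ}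
    (hm : ∀ t, Measurable (f t)) (hf : ∀ t, Integrable (f t) (μ.prod ν))
    (hs : Summable fun t => ∫ z, ‖f t z‖ ∂μ.prod ν) :
    HasSum (fun t => ∫ z, f t z ∂μ.prod ν) (∫ x, ∫ y, ∑' t, f t (x, y) ∂ν ∂μ) := by
  have hint : Integrable (fun z => ∑' t, f t z) (μ.prod ν) := by
    refine ⟨(Measurable.tsum hm).aestronglyMeasurable, ?_⟩
    refine lt_of_le_of_lt (lintegral_mono fun z => enorm_tsum_le_tsum_enorm) ?_
    rw [lintegral_tsum fun t => (hm t).enorm.aemeasurable]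
    simp_rw [← ofReal_integral_norm_eq_lintegral_enorm (hf _)]
    rw [← ENNReal.ofReal_tsum_of_nonneg (fun t => integral_nonneg fun z => norm_nonneg _) hs]
    exact ENNReal.ofReal_lt_top
  have := hasSum_integral_of_summable_integral_norm hf hs
  rwa [integral_prod _ hint] at this

theorem integral_comp_measurePreserving {α β : Type*} [MeasurableSpace α] [MeasurableSpace β]
    {μ : Measure α} {ν : Measure β} {φ : α → β} (hφ : MeasurePreserving φ μ ν) {h : β → ℝ}
    (hh : Measurable h) : ∫ a, h (φ a) ∂μ = ∫ b, h b ∂ν := by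
  rw [← hφ.map_eq, integral_map hφ.measurable.aemeasurable hh.aestronglyMeasurable]

variable {Ω : Type*} [MeasurableSpace Ω] {P : Measure Ω} {a b : ℕ}

theorem integrable_dotProduct_mulVec {f : Ω → Fin a → ℝ} {g : Ω → Fin b → ℝ}
    (hf : ∀ i, MemLp (fun ω => f ω i) 2 P) (hg : ∀ j, MemLp (fun ω => g ω j) 2 P)
    (G : Matrix (Fin a) (Fin b) ℝ) : Integrable (fun ω => f ω ⬝ᵥ (G *ᵥ g ω)) P := by
  simp only [dotProduct, mulVec, Finset.mul_sum]
  refine integrable_finsetSum _ fun i _ => integrable_finsetSum _ fun j _ => ?_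
  have := ((hf i).integrable_mul (hg j)).const_mul (G i j)
  refine this.congr (Filter.Eventually.of_forall fun ω => ?_)
  simp only [Pi.mul_apply]
  ring

theorem integral_dotProduct_mulVec {f : Ω → Fin a → ℝ} {g : Ω → Fin b → ℝ}
    (hf : ∀ i, MemLp (fun ω => f ω i) 2 P) (hg : ∀ j, MemLp (fun ω => g ω j) 2 P)
    (G : Matrix (Fin a) (Fin b) ℝ) {V : Matrix (Fin b) (Fin a) ℝ}
    (hV : ∀ i j, ∫ ω, f ω i * g ω j ∂P = V j i) :
    ∫ ω, f ω ⬝ᵥ (G *ᵥ g ω) ∂P = (G * V).trace := by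
  have hint : ∀ i j, Integrable (fun ω => f ω i * (G i j * g ω j)) P := fun i j => by
    have := ((hf i).integrable_mul (hg j)).const_mul (G i j)
    refine this.congr (Filter.Eventually.of_forall fun ω => ?_)
    simp only [Pi.mul_apply]
    ring
  simp only [dotProduct, mulVec, Finset.mul_sum, trace, diag, Matrix.mul_apply]
  rw [integral_finsetSum _ fun i _ => integrable_finsetSum _ fun j _ => hint i j]
  refine Finset.sum_congr rfl fun i _ => ?_
  rw [integral_finsetSum _ fun j _ => hint i j]
  refine Finset.sum_congr rfl fun j _ => ?_
  rw [← hV, ← integral_const_mul]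
  exact integral_congr_ae (Filter.Eventually.of_forall fun ω => by ring)

theorem secondMoment_nonneg {d : ℕ} {m : Measure (Vec d)} (h : MemLp (fun x : Vec d => x) 2 m) :
    0 ≤ secondMoment m := by
  refine Matrix.nonneg_iff_posSemidef.2 (Matrix.PosSemidef.of_dotProduct_mulVec_nonneg ?_ ?_)
  · ext i j
    simp [secondMoment, mul_comm]
  · intro v
    have hx : ∀ i, MemLp (fun x : Vec d => x i) 2 m := fun i => h.eval_piLp i
    -- The rank-one matrix vvᵀ turns the quadratic form into (v·x)², whose mean is the quadratic
    -- form of the second moment at v.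
    have h1 := integral_dotProduct_mulVec hx hx (vecMulVec v v) (V := secondMoment m)
      fun i j => by simp [secondMoment, mul_comm]
    have h2 : (vecMulVec v v * secondMoment m).trace = star v ⬝ᵥ (secondMoment m *ᵥ v) := by
      rw [trace_mul_comm, Matrix.mul_vecMulVec, trace_vecMulVec, star_trivial, dotProduct_comm]
    rw [← h2, ← h1]
    refine integral_nonneg fun x => ?_
    have h3 : x.ofLp ⬝ᵥ (vecMulVec v v *ᵥ x.ofLp) = (v ⬝ᵥ x.ofLp) ^ 2 := by
      rw [vecMulVec_mulVec, dotProduct_smul, dotProduct_comm]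
      simp [sq]
    simpa [h3] using sq_nonneg (v ⬝ᵥ x.ofLp)

end Integrals

/-! ### Second moments of linear systems driven by white noise -/

section LinearSystem

variable {n : ℕ}

/-- The second moments of `x_{t+1} = F x_t + ξ_t`, for white noise `ξ` with second moment `N`. -/
def momentSeq (F D N : Matrix (Fin n) (Fin n) ℝ) : ℕ → Matrix (Fin n) (Fin n) ℝ
  | 0 => D
  | t + 1 => F * momentSeq F D N t * Fᵀ + N

theorem momentSeq_nonneg {F D N : Matrix (Fin n) (Fin n) ℝ} (hD : 0 ≤ D) (hN : 0 ≤ N) (t : ℕ) :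
    0 ≤ momentSeq F D N t := by
  induction t with
  | zero => exact hD
  | succ t ih => exact add_nonneg (congr_nonneg' ih F) hN

theorem momentSeq_eq (F D N : Matrix (Fin n) (Fin n) ℝ) (t : ℕ) :
    momentSeq F D N t = F ^ t * D * Fᵀ ^ t + ∑ j ∈ Finset.range t, F ^ j * N * Fᵀ ^ j := by
  induction t with
  | zero => simp [momentSeq]
  | succ t ih =>
    rw [momentSeq, ih, Finset.sum_range_succ']
    simp only [Matrix.mul_add, Matrix.add_mul, Finset.mul_sum, Finset.sum_mul, pow_succ' F,
      pow_succ Fᵀ, Matrix.mul_assoc, pow_zero, Matrix.one_mul, Matrix.mul_one, add_assoc]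

variable {Ω : Type*} [MeasurableSpace Ω] {P : Measure Ω} {F D N : Matrix (Fin n) (Fin n) ℝ}
  {X ξ : ℕ → Ω → Fin n → ℝ}

theorem memLp_linear_system (hrec : ∀ t ω i, X (t + 1) ω i = ∑ l, F i l * X t ω l + ξ t ω i)
    (h0 : ∀ i, MemLp (fun ω => X 0 ω i) 2 P) (hξ : ∀ t i, MemLp (fun ω => ξ t ω i) 2 P)
    (t : ℕ) (i : Fin n) : MemLp (fun ω => X t ω i) 2 P := by
  induction t generalizing i with
  | zero => exact h0 i
  | succ t ih =>
    simp only [hrec]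
    exact (memLp_finsetSum _ fun l _ => (ih l).const_mul (F i l)).add (hξ t i)

/-- The state is linear in the initial state and the earlier disturbances, so it inherits their
orthogonality to g. Only correlations matter, not independence. -/
theorem integral_linear_system_mul_eq_zero
    (hrec : ∀ t ω i, X (t + 1) ω i = ∑ l, F i l * X t ω l + ξ t ω i)
    (h0 : ∀ i, MemLp (fun ω => X 0 ω i) 2 P) (hξ : ∀ t i, MemLp (fun ω => ξ t ω i) 2 P)
    {g : Ω → ℝ} (hg : MemLp g 2 P) (hg0 : ∀ i, ∫ ω, X 0 ω i * g ω ∂P = 0) (t : ℕ)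
    (hgξ : ∀ s < t, ∀ i, ∫ ω, ξ s ω i * g ω ∂P = 0) (i : Fin n) :
    ∫ ω, X t ω i * g ω ∂P = 0 := by
  induction t generalizing i with
  | zero => exact hg0 i
  | succ t ih =>
    have hX := memLp_linear_system hrec h0 hξ t
    have h1 : ∀ l, Integrable (fun ω => F i l * (X t ω l * g ω)) P := fun l =>
      ((hX l).integrable_mul hg).const_mul (F i l)
    have h2 : Integrable (fun ω => ξ t ω i * g ω) P := (hξ t i).integrable_mul hg
    have h3 : ∀ ω, X (t + 1) ω i * g ω = ∑ l, F i l * (X t ω l * g ω) + ξ t ω i * g ω :=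
      fun ω => by
        rw [hrec, add_mul, Finset.sum_mul]
        simp only [mul_assoc]
    simp only [h3]
    rw [integral_add (integrable_finsetSum _ fun l _ => h1 l) h2,
      integral_finsetSum _ fun l _ => h1 l, hgξ t (Nat.lt_succ_self t) i]
    simp [integral_const_mul, ih fun s hs => hgξ s (hs.trans (Nat.lt_succ_self t))]

theorem integral_linear_system_mul
    (hrec : ∀ t ω i, X (t + 1) ω i = ∑ l, F i l * X t ω l + ξ t ω i)
    (h0 : ∀ i, MemLp (fun ω => X 0 ω i) 2 P) (hξ : ∀ t i, MemLp (fun ω => ξ t ω i) 2 P)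
    (hD : ∀ i j, ∫ ω, X 0 ω i * X 0 ω j ∂P = D i j)
    (hN : ∀ t i j, ∫ ω, ξ t ω i * ξ t ω j ∂P = N i j)
    (hcross : ∀ t i j, ∫ ω, X t ω i * ξ t ω j ∂P = 0) (t : ℕ) (i j : Fin n) :
    ∫ ω, X t ω i * X t ω j ∂P = momentSeq F D N t i j := by
  induction t generalizing i j with
  | zero => exact hD i j
  | succ t ih =>
    have hX := memLp_linear_system hrec h0 hξ t
    have h1 : ∀ l m, Integrable (fun ω => F i l * F j m * (X t ω l * X t ω m)) P := fun l m =>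
      ((hX l).integrable_mul (hX m)).const_mul _
    have h2 : ∀ l, Integrable (fun ω => F i l * (X t ω l * ξ t ω j)) P := fun l =>
      ((hX l).integrable_mul (hξ t j)).const_mul _
    have h3 : ∀ l, Integrable (fun ω => F j l * (X t ω l * ξ t ω i)) P := fun l =>
      ((hX l).integrable_mul (hξ t i)).const_mul _
    have h4 : Integrable (fun ω => ξ t ω i * ξ t ω j) P := (hξ t i).integrable_mul (hξ t j)
    have h5 : ∀ ω, X (t + 1) ω i * X (t + 1) ω j =
        ((∑ l, ∑ m, F i l * F j m * (X t ω l * X t ω m) +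
          ∑ l, F i l * (X t ω l * ξ t ω j)) + ∑ l, F j l * (X t ω l * ξ t ω i)) +
            ξ t ω i * ξ t ω j := fun ω => by
      have e1 : ∑ l, ∑ m, F i l * F j m * (X t ω l * X t ω m) =
          (∑ l, F i l * X t ω l) * ∑ m, F j m * X t ω m := by
        rw [Finset.sum_mul_sum]
        exact Finset.sum_congr rfl fun l _ => Finset.sum_congr rfl fun m _ => by ring
      have e2 : ∀ (i : Fin n) (c : ℝ), ∑ l, F i l * (X t ω l * c) =
          (∑ l, F i l * X t ω l) * c := fun i c => by
        rw [Finset.sum_mul]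
        exact Finset.sum_congr rfl fun l _ => by ring
      rw [hrec, hrec, e1, e2, e2]
      ring
    have s1 : Integrable (fun ω => ∑ l, ∑ m, F i l * F j m * (X t ω l * X t ω m)) P :=
      integrable_finsetSum _ fun l _ => integrable_finsetSum _ fun m _ => h1 l m
    have s2 : Integrable (fun ω => ∑ l, F i l * (X t ω l * ξ t ω j)) P :=
      integrable_finsetSum _ fun l _ => h2 l
    have s3 : Integrable (fun ω => ∑ l, F j l * (X t ω l * ξ t ω i)) P :=
      integrable_finsetSum _ fun l _ => h3 l
    have s12 : Integrable (fun ω => ∑ l, ∑ m, F i l * F j m * (X t ω l * X t ω m) +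
        ∑ l, F i l * (X t ω l * ξ t ω j)) P := s1.add s2
    have s123 : Integrable (fun ω => ∑ l, ∑ m, F i l * F j m * (X t ω l * X t ω m) +
        ∑ l, F i l * (X t ω l * ξ t ω j) + ∑ l, F j l * (X t ω l * ξ t ω i)) P := s12.add s3
    rw [integral_congr_ae (Filter.Eventually.of_forall h5), integral_add s123 h4,
      integral_add s12 s3, integral_add s1 s2,
      integral_finsetSum _ fun l _ => h2 l, integral_finsetSum _ fun l _ => h3 l,
      integral_finsetSum _ fun l _ => integrable_finsetSum _ fun m _ => h1 l m]
    simp only [integral_const_mul, hcross, mul_zero, Finset.sum_const_zero, add_zero, hN]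
    rw [momentSeq, Matrix.add_apply]
    congr 1
    simp only [Matrix.mul_apply, transpose_apply, Finset.sum_mul]
    rw [Finset.sum_comm]
    refine Finset.sum_congr rfl fun l _ => ?_
    rw [integral_finsetSum _ fun m _ => h1 l m]
    refine Finset.sum_congr rfl fun m _ => ?_
    rw [integral_const_mul, ih]
    ring

end LinearSystem

/-! ### Second moments of the closed loop -/

namespace Model

variable {n k : ℕ} (M : Model n k)

instance instIsProbabilityMeasureInit : IsProbabilityMeasure M.init := M.init_prob

instance instIsProbabilityMeasureNoise : IsProbabilityMeasure M.noise := M.noise_prob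

instance instIsProbabilityMeasureNoiseLaw (S : Matrix (Fin k) (Fin k) ℝ) :
    IsProbabilityMeasure (M.noiseLaw S) := by
  unfold noiseLaw; infer_instance

/-- The joint law of the initial state and of the randomness. -/
def sampleLaw (S : Matrix (Fin k) (Fin k) ℝ) : Measure (Vec n × Noise n k) :=
  M.init.prod (M.noiseLaw S)

instance instIsProbabilityMeasureSampleLaw (S : Matrix (Fin k) (Fin k) ℝ) :
    IsProbabilityMeasure (M.sampleLaw S) := by
  unfold sampleLaw; infer_instance

/-- The second moment of the total disturbance `B η + w` of the closed loop. -/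
def disturbance (S : Matrix (Fin k) (Fin k) ℝ) : Matrix (Fin n) (Fin n) ℝ :=
  M.B * S * M.Bᵀ + M.W

/-- The total disturbance `B η_t + w_t` of the closed loop. -/
def innovation (t : ℕ) (p : Vec n × Noise n k) : Fin n → ℝ :=
  fun i => (∑ l, M.B i l * p.2.2 t l) + p.2.1 t i

theorem measurable_state (K : Matrix (Fin k) (Fin n) ℝ) (t : ℕ) :
    Measurable fun p : Vec n × Noise n k => M.state K p.1 p.2 t := by
  induction t with
  | zero => exact measurable_fst
  | succ t ih =>
    simp only [state, action]
    have h1 : Measurable fun p : Vec n × Noise n k => p.2.1 t :=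
      (measurable_pi_apply t).comp (measurable_fst.comp measurable_snd)
    have h2 : Measurable fun p : Vec n × Noise n k => p.2.2 t :=
      (measurable_pi_apply t).comp (measurable_snd.comp measurable_snd)
    have hL : ∀ {a b : ℕ} (Z : Matrix (Fin a) (Fin b) ℝ),
        Measurable fun x : Vec b => Matrix.toEuclideanLin Z x := fun Z => by fun_prop
    exact (((hL M.A).comp ih).add ((hL M.B).comp ((((hL K).comp ih).neg).add h2))).add h1

theorem measurable_control (K : Matrix (Fin k) (Fin n) ℝ) (t : ℕ) :
    Measurable fun p : Vec n × Noise n k => M.control K p.1 p.2 t := by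
  have h2 : Measurable fun p : Vec n × Noise n k => p.2.2 t :=
    (measurable_pi_apply t).comp (measurable_snd.comp measurable_snd)
  have hL : Measurable fun x : Vec n => Matrix.toEuclideanLin K x := by fun_prop
  exact ((hL.comp (M.measurable_state K t)).neg).add h2

theorem state_succ (K : Matrix (Fin k) (Fin n) ℝ) (t : ℕ) (p : Vec n × Noise n k) (i : Fin n) :
    M.state K p.1 p.2 (t + 1) i =
      ∑ l, (M.A - M.B * K) i l * M.state K p.1 p.2 t l + M.innovation t p i := by
  have h : (M.state K p.1 p.2 (t + 1)).ofLp =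
      (M.A - M.B * K) *ᵥ (M.state K p.1 p.2 t).ofLp +
        (M.B *ᵥ (p.2.2 t).ofLp + (p.2.1 t).ofLp) := by
    simp only [state, action, Matrix.toLpLin_apply, WithLp.ofLp_add, WithLp.ofLp_neg,
      Matrix.mulVec_add, Matrix.mulVec_neg, Matrix.sub_mulVec, Matrix.mulVec_mulVec]
    abel
  have := congrFun h i
  simpa [innovation, mulVec, dotProduct] using this

/-! ### Moments of the initial state and of the noises -/

theorem measurePreserving_initial (S : Matrix (Fin k) (Fin k) ℝ) :
    MeasurePreserving (fun p : Vec n × Noise n k => p.1) (M.sampleLaw S) M.init :=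
  measurePreserving_fst

theorem measurePreserving_noises (S : Matrix (Fin k) (Fin k) ℝ) :
    MeasurePreserving (fun p : Vec n × Noise n k => p.2.1) (M.sampleLaw S)
      (Measure.infinitePi fun _ : ℕ => M.noise) :=
  measurePreserving_fst.comp measurePreserving_snd

theorem measurePreserving_randomizations (S : Matrix (Fin k) (Fin k) ℝ) :
    MeasurePreserving (fun p : Vec n × Noise n k => p.2.2) (M.sampleLaw S)
      (Measure.infinitePi fun _ : ℕ => multivariateGaussian (0 : Vec k) S) :=
  measurePreserving_snd.comp measurePreserving_snd

theorem measurePreserving_noise (S : Matrix (Fin k) (Fin k) ℝ) (t : ℕ) :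
    MeasurePreserving (fun p : Vec n × Noise n k => p.2.1 t) (M.sampleLaw S) M.noise :=
  (measurePreserving_eval_infinitePi (fun _ : ℕ => M.noise) t).comp (M.measurePreserving_noises S)

theorem measurePreserving_randomization (S : Matrix (Fin k) (Fin k) ℝ) (t : ℕ) :
    MeasurePreserving (fun p : Vec n × Noise n k => p.2.2 t) (M.sampleLaw S)
      (multivariateGaussian (0 : Vec k) S) :=
  (measurePreserving_eval_infinitePi
    (fun _ : ℕ => multivariateGaussian (0 : Vec k) S) t).comp
      (M.measurePreserving_randomizations S)

theorem memLp_initial (S : Matrix (Fin k) (Fin k) ℝ) (i : Fin n) :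
    MemLp (fun p : Vec n × Noise n k => p.1 i) 2 (M.sampleLaw S) :=
  (M.init_memLp.eval_piLp i).comp_measurePreserving (M.measurePreserving_initial S)

theorem memLp_noise (S : Matrix (Fin k) (Fin k) ℝ) (t : ℕ) (i : Fin n) :
    MemLp (fun p : Vec n × Noise n k => p.2.1 t i) 2 (M.sampleLaw S) :=
  (M.noise_memLp.eval_piLp i).comp_measurePreserving (M.measurePreserving_noise S t)

theorem memLp_gaussian_eval (S : Matrix (Fin k) (Fin k) ℝ) (i : Fin k) :
    MemLp (fun η : Vec k => η i) 2 (multivariateGaussian (0 : Vec k) S) :=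
  (IsGaussian.memLp_two_id (μ := multivariateGaussian (0 : Vec k) S)).eval_piLp i

theorem memLp_randomization (S : Matrix (Fin k) (Fin k) ℝ) (t : ℕ) (i : Fin k) :
    MemLp (fun p : Vec n × Noise n k => p.2.2 t i) 2 (M.sampleLaw S) :=
  (memLp_gaussian_eval S i).comp_measurePreserving (M.measurePreserving_randomization S t)

theorem integral_noise_eval (i : Fin n) : ∫ w, w i ∂M.noise = 0 := by
  rw [← eval_integral_piLp (f := fun w : Vec n => w) (fun j =>
    (M.noise_memLp.eval_piLp j).integrable (by norm_num)) i, M.noise_mean]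
  simp

theorem integral_gaussian_eval (S : Matrix (Fin k) (Fin k) ℝ) (i : Fin k) :
    ∫ η : Vec k, η i ∂(multivariateGaussian (0 : Vec k) S) = 0 := by
  rw [← eval_integral_piLp (f := fun w : Vec k => w) (fun j =>
    (memLp_gaussian_eval S j).integrable (by norm_num)) i, integral_id_multivariateGaussian]
  simp

theorem integral_gaussian_eval_mul {S : Matrix (Fin k) (Fin k) ℝ} (hS : 0 ≤ S) (i j : Fin k) :
    ∫ η : Vec k, η i * η j ∂(multivariateGaussian (0 : Vec k) S) = S i j := by
  have h := covariance_eval_multivariateGaussian (μ := (0 : Vec k))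
    (Matrix.nonneg_iff_posSemidef.1 hS) i j
  rw [covariance_eq_sub (memLp_gaussian_eval S i) (memLp_gaussian_eval S j),
    integral_gaussian_eval] at h
  simpa using h

theorem integral_infinitePi_mul {d : ℕ} (ν : Measure (Vec d)) [IsProbabilityMeasure ν]
    {s t : ℕ} (hst : s ≠ t) (i j : Fin d) (h0 : ∫ w, w i ∂ν = 0) :
    ∫ w : ℕ → Vec d, w s i * w t j ∂(Measure.infinitePi fun _ : ℕ => ν) = 0 := by
  have h1 : ∫ w : ℕ → Vec d, w s i * w t j ∂(Measure.infinitePi fun _ : ℕ => ν) =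
      ∫ z : Vec d × Vec d, z.1 i * z.2 j ∂(ν.prod ν) := by
    rw [← Measure.infinitePi_map_eval_prod (P := fun _ : ℕ => ν) hst, integral_map]
    · exact Measurable.aemeasurable (by fun_prop)
    · exact Measurable.aestronglyMeasurable (by fun_prop)
  rw [h1, integral_prod_mul (fun x : Vec d => x i) fun x : Vec d => x j, h0, zero_mul]

theorem integral_noise_mul (S : Matrix (Fin k) (Fin k) ℝ) (s t : ℕ) (i j : Fin n) :
    ∫ p : Vec n × Noise n k, p.2.1 s i * p.2.1 t j ∂(M.sampleLaw S) =
      if s = t then M.W i j else 0 := by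
  split_ifs with h
  · subst h
    exact integral_comp_measurePreserving (M.measurePreserving_noise S s)
      (h := fun w : Vec n => w i * w j) (by fun_prop)
  · rw [← integral_infinitePi_mul M.noise h i j (M.integral_noise_eval i)]
    exact integral_comp_measurePreserving (M.measurePreserving_noises S)
      (h := fun w : ℕ → Vec n => w s i * w t j) (by fun_prop)

theorem integral_randomization_mul {S : Matrix (Fin k) (Fin k) ℝ} (hS : 0 ≤ S) (s t : ℕ)
    (i j : Fin k) :
    ∫ p : Vec n × Noise n k, p.2.2 s i * p.2.2 t j ∂(M.sampleLaw S) =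
      if s = t then S i j else 0 := by
  split_ifs with h
  · subst h
    rw [← integral_gaussian_eval_mul hS i j]
    exact integral_comp_measurePreserving (M.measurePreserving_randomization S s)
      (h := fun w : Vec k => w i * w j) (by fun_prop)
  · rw [← integral_infinitePi_mul (multivariateGaussian (0 : Vec k) S) h i j
      (integral_gaussian_eval S i)]
    exact integral_comp_measurePreserving (M.measurePreserving_randomizations S)
      (h := fun w : ℕ → Vec k => w s i * w t j) (by fun_prop)

theorem integral_randomization (S : Matrix (Fin k) (Fin k) ℝ) (t : ℕ) (j : Fin k) :
    ∫ p : Vec n × Noise n k, p.2.2 t j ∂(M.sampleLaw S) = 0 := by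
  rw [← integral_gaussian_eval S j]
  exact integral_comp_measurePreserving (M.measurePreserving_randomization S t)
      (h := fun w : Vec k => w j) (by fun_prop)

theorem integral_noise (S : Matrix (Fin k) (Fin k) ℝ) (t : ℕ) (j : Fin n) :
    ∫ p : Vec n × Noise n k, p.2.1 t j ∂(M.sampleLaw S) = 0 := by
  rw [← M.integral_noise_eval j]
  exact integral_comp_measurePreserving (M.measurePreserving_noise S t)
      (h := fun w : Vec n => w j) (by fun_prop)

theorem integral_noise_mul_randomization (S : Matrix (Fin k) (Fin k) ℝ) (s t : ℕ) (i : Fin n)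
    (j : Fin k) : ∫ p : Vec n × Noise n k, p.2.1 s i * p.2.2 t j ∂(M.sampleLaw S) = 0 := by
  have h1 := integral_comp_measurePreserving (μ := M.sampleLaw S) (ν := M.noiseLaw S)
    measurePreserving_snd (h := fun p : Noise n k => p.1 s i * p.2 t j) (by fun_prop)
  refine h1.trans ?_
  have h2 := integral_prod_mul (μ := Measure.infinitePi fun _ : ℕ => M.noise)
    (ν := Measure.infinitePi fun _ : ℕ => multivariateGaussian (0 : Vec k) S)
    (fun w : ℕ → Vec n => w s i) fun η : ℕ → Vec k => η t j
  refine h2.trans ?_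
  have h3 := integral_comp_measurePreserving
    (measurePreserving_eval_infinitePi (fun _ : ℕ => M.noise) s)
    (h := fun w : Vec n => w i) (by fun_prop)
  rw [M.integral_noise_eval] at h3
  simp only [Function.eval] at h3
  rw [h3, zero_mul]

/-- Independence factors the expectation. The initial state need not be centred; it is the mean of g
that vanishes. -/
theorem integral_initial_mul_eq_zero (S : Matrix (Fin k) (Fin k) ℝ) (i : Fin n)
    {g : Noise n k → ℝ} (hg : Measurable g)
    (h0 : ∫ p : Vec n × Noise n k, g p.2 ∂(M.sampleLaw S) = 0) :
    ∫ p : Vec n × Noise n k, p.1 i * g p.2 ∂(M.sampleLaw S) = 0 := by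
  have h1 := integral_comp_measurePreserving (μ := M.sampleLaw S) (ν := M.noiseLaw S)
    measurePreserving_snd hg
  have h2 := integral_prod_mul (μ := M.init) (ν := M.noiseLaw S) (fun x : Vec n => x i) g
  refine h2.trans ?_
  rw [← h1, h0, mul_zero]

/-! ### Moments of the total disturbance and of the state -/

variable {S : Matrix (Fin k) (Fin k) ℝ}

theorem memLp_innovation (t : ℕ) (i : Fin n) :
    MemLp (fun p => M.innovation t p i) 2 (M.sampleLaw S) :=
  (memLp_finsetSum _ fun l _ => (M.memLp_randomization S t l).const_mul (M.B i l)).add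
    (M.memLp_noise S t i)

theorem integral_innovation_mul_randomization (hS : 0 ≤ S) (s t : ℕ) (i : Fin n) (j : Fin k) :
    ∫ p, M.innovation s p i * p.2.2 t j ∂(M.sampleLaw S) =
      if s = t then (M.B * S) i j else 0 := by
  have h1 : ∀ l, Integrable (fun p : Vec n × Noise n k => M.B i l * (p.2.2 s l * p.2.2 t j))
      (M.sampleLaw S) := fun l =>
    ((M.memLp_randomization S s l).integrable_mul (M.memLp_randomization S t j)).const_mul _
  have h2 : Integrable (fun p : Vec n × Noise n k => p.2.1 s i * p.2.2 t j) (M.sampleLaw S) :=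
    (M.memLp_noise S s i).integrable_mul (M.memLp_randomization S t j)
  have h3 : ∀ p : Vec n × Noise n k, M.innovation s p i * p.2.2 t j =
      ∑ l, M.B i l * (p.2.2 s l * p.2.2 t j) + p.2.1 s i * p.2.2 t j := fun p => by
    rw [innovation, add_mul, Finset.sum_mul]
    simp only [mul_assoc]
  rw [integral_congr_ae (Filter.Eventually.of_forall h3),
    integral_add (integrable_finsetSum _ fun l _ => h1 l) h2,
    integral_finsetSum _ fun l _ => h1 l, M.integral_noise_mul_randomization, add_zero]
  simp only [integral_const_mul, M.integral_randomization_mul hS]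
  split_ifs
  · rw [Matrix.mul_apply]
  · simp

theorem integral_innovation_mul_noise (s t : ℕ) (i j : Fin n) :
    ∫ p, M.innovation s p i * p.2.1 t j ∂(M.sampleLaw S) = if s = t then M.W i j else 0 := by
  have h1 : ∀ l, Integrable (fun p : Vec n × Noise n k => M.B i l * (p.2.1 t j * p.2.2 s l))
      (M.sampleLaw S) := fun l =>
    ((M.memLp_noise S t j).integrable_mul (M.memLp_randomization S s l)).const_mul _
  have h2 : Integrable (fun p : Vec n × Noise n k => p.2.1 s i * p.2.1 t j) (M.sampleLaw S) :=
    (M.memLp_noise S s i).integrable_mul (M.memLp_noise S t j)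
  have h3 : ∀ p : Vec n × Noise n k, M.innovation s p i * p.2.1 t j =
      ∑ l, M.B i l * (p.2.1 t j * p.2.2 s l) + p.2.1 s i * p.2.1 t j := fun p => by
    rw [innovation, add_mul, Finset.sum_mul]
    congr 1
    exact Finset.sum_congr rfl fun l _ => by ring
  rw [integral_congr_ae (Filter.Eventually.of_forall h3),
    integral_add (integrable_finsetSum _ fun l _ => h1 l) h2,
    integral_finsetSum _ fun l _ => h1 l, M.integral_noise_mul]
  simp [integral_const_mul, M.integral_noise_mul_randomization]

theorem integral_innovation_mul (hS : 0 ≤ S) (s t : ℕ) (i j : Fin n) :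
    ∫ p, M.innovation s p i * M.innovation t p j ∂(M.sampleLaw S) =
      if s = t then M.disturbance S i j else 0 := by
  have h1 : ∀ l, Integrable (fun p : Vec n × Noise n k =>
      M.B j l * (M.innovation s p i * p.2.2 t l)) (M.sampleLaw S) := fun l =>
    ((M.memLp_innovation s i).integrable_mul (M.memLp_randomization S t l)).const_mul _
  have h2 : Integrable (fun p : Vec n × Noise n k => M.innovation s p i * p.2.1 t j)
      (M.sampleLaw S) := (M.memLp_innovation s i).integrable_mul (M.memLp_noise S t j)
  have h3 : ∀ p : Vec n × Noise n k, M.innovation s p i * M.innovation t p j =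
      ∑ l, M.B j l * (M.innovation s p i * p.2.2 t l) + M.innovation s p i * p.2.1 t j :=
    fun p => by
      conv_lhs => rw [innovation.eq_def M t p]
      simp only [mul_add, Finset.mul_sum]
      congr 1
      exact Finset.sum_congr rfl fun l _ => by ring
  rw [integral_congr_ae (Filter.Eventually.of_forall h3),
    integral_add (integrable_finsetSum _ fun l _ => h1 l) h2,
    integral_finsetSum _ fun l _ => h1 l, M.integral_innovation_mul_noise]
  simp only [integral_const_mul, M.integral_innovation_mul_randomization hS]
  split_ifs
  · rw [disturbance, Matrix.add_apply, Matrix.mul_apply]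
    congr 1
    exact Finset.sum_congr rfl fun l _ => by rw [transpose_apply]; ring
  · simp

/-- The coordinates of the state, as functions of the sample point. -/
def stateFun (K : Matrix (Fin k) (Fin n) ℝ) (t : ℕ) (p : Vec n × Noise n k) (i : Fin n) : ℝ :=
  M.state K p.1 p.2 t i

theorem stateFun_succ (K : Matrix (Fin k) (Fin n) ℝ) (t : ℕ) (p : Vec n × Noise n k)
    (i : Fin n) : M.stateFun K (t + 1) p i =
      ∑ l, (M.A - M.B * K) i l * M.stateFun K t p l + M.innovation t p i :=
  M.state_succ K t p i

theorem stateFun_zero (K : Matrix (Fin k) (Fin n) ℝ) (p : Vec n × Noise n k) (i : Fin n) :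
    M.stateFun K 0 p i = p.1 i := rfl

theorem memLp_stateFun_zero (K : Matrix (Fin k) (Fin n) ℝ) (i : Fin n) :
    MemLp (fun p => M.stateFun K 0 p i) 2 (M.sampleLaw S) := by
  simp only [stateFun_zero]
  exact M.memLp_initial S i

theorem memLp_stateFun (K : Matrix (Fin k) (Fin n) ℝ) (t : ℕ) (i : Fin n) :
    MemLp (fun p => M.stateFun K t p i) 2 (M.sampleLaw S) :=
  memLp_linear_system (M.stateFun_succ K) (M.memLp_stateFun_zero K) M.memLp_innovation t i

theorem measurable_innovation (t : ℕ) (i : Fin n) :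
    Measurable fun p : Noise n k => (∑ l, M.B i l * p.2 t l) + p.1 t i := by
  fun_prop

theorem integral_innovation (t : ℕ) (i : Fin n) :
    ∫ p, M.innovation t p i ∂(M.sampleLaw S) = 0 := by
  have h1 : ∀ l, Integrable (fun p : Vec n × Noise n k => M.B i l * p.2.2 t l)
      (M.sampleLaw S) := fun l =>
    ((M.memLp_randomization S t l).integrable (by norm_num)).const_mul _
  have h2 : Integrable (fun p : Vec n × Noise n k => p.2.1 t i) (M.sampleLaw S) :=
    (M.memLp_noise S t i).integrable (by norm_num)
  simp only [innovation]
  rw [integral_add (integrable_finsetSum _ fun l _ => h1 l) h2,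
    integral_finsetSum _ fun l _ => h1 l, M.integral_noise]
  simp [integral_const_mul, M.integral_randomization]

theorem integral_stateFun_mul_innovation (hS : 0 ≤ S) (K : Matrix (Fin k) (Fin n) ℝ) (t : ℕ)
    (i j : Fin n) :
    ∫ p, M.stateFun K t p i * M.innovation t p j ∂(M.sampleLaw S) = 0 := by
  refine integral_linear_system_mul_eq_zero (M.stateFun_succ K) (M.memLp_stateFun_zero K)
    M.memLp_innovation (M.memLp_innovation t j) (fun i => ?_) t (fun s hs i => ?_) i
  · simp only [stateFun_zero]
    exact M.integral_initial_mul_eq_zero S i (M.measurable_innovation t j)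
      (M.integral_innovation t j)
  · rw [M.integral_innovation_mul hS, if_neg hs.ne]

theorem integral_stateFun_mul_randomization (hS : 0 ≤ S) (K : Matrix (Fin k) (Fin n) ℝ) (t : ℕ)
    (i : Fin n) (j : Fin k) :
    ∫ p, M.stateFun K t p i * p.2.2 t j ∂(M.sampleLaw S) = 0 := by
  refine integral_linear_system_mul_eq_zero (M.stateFun_succ K) (M.memLp_stateFun_zero K)
    M.memLp_innovation (M.memLp_randomization S t j) (fun i => ?_) t (fun s hs i => ?_) i
  · simp only [stateFun_zero]
    exact M.integral_initial_mul_eq_zero S i (g := fun p => p.2 t j) (by fun_prop)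
      (M.integral_randomization S t j)
  · rw [M.integral_innovation_mul_randomization hS, if_neg hs.ne]

/-- The second moments `𝔼[x_t x_tᵀ]` of the closed loop. -/
def stateMoment (K : Matrix (Fin k) (Fin n) ℝ) (S : Matrix (Fin k) (Fin k) ℝ) (t : ℕ) :
    Matrix (Fin n) (Fin n) ℝ :=
  momentSeq (M.A - M.B * K) M.D0 (M.disturbance S) t

theorem integral_stateFun_mul (hS : 0 ≤ S) (K : Matrix (Fin k) (Fin n) ℝ) (t : ℕ)
    (i j : Fin n) : ∫ p, M.stateFun K t p i * M.stateFun K t p j ∂(M.sampleLaw S) =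
      M.stateMoment K S t i j := by
  refine integral_linear_system_mul (M.stateFun_succ K) (M.memLp_stateFun_zero K)
    M.memLp_innovation (fun i j => ?_) (fun t i j => ?_)
    (M.integral_stateFun_mul_innovation hS K) t i j
  · simp only [stateFun_zero]
    exact integral_comp_measurePreserving (M.measurePreserving_initial S)
      (h := fun x : Vec n => x i * x j) (by fun_prop)
  · rw [M.integral_innovation_mul hS, if_pos rfl]

theorem D0_nonneg : 0 ≤ M.D0 := secondMoment_nonneg M.init_memLp

theorem W_nonneg : 0 ≤ M.W := secondMoment_nonneg M.noise_memLp

theorem disturbance_nonneg (hS : 0 ≤ S) : 0 ≤ M.disturbance S :=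
  add_nonneg (congr_nonneg' hS M.B) M.W_nonneg

theorem stateMoment_nonneg (hS : 0 ≤ S) (K : Matrix (Fin k) (Fin n) ℝ) (t : ℕ) :
    0 ≤ M.stateMoment K S t :=
  momentSeq_nonneg M.D0_nonneg (M.disturbance_nonneg hS) t

end Model

/-! ### The expected cost and the state correlation matrix -/

theorem log_gaussianDensity {k : ℕ} {S : Matrix (Fin k) (Fin k) ℝ} (hS : S.PosDef)
    (m u : Vec k) : Real.log (gaussianDensity m S u) =
      -(1 / 2) * quad S⁻¹ (u - m) - 1 / 2 * Real.log ((2 * Real.pi) ^ k * S.det) := by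
  have h : 0 < (2 * Real.pi) ^ k * S.det := mul_pos (by positivity) hS.det_pos
  rw [gaussianDensity, Real.log_div (Real.exp_ne_zero _) (Real.sqrt_ne_zero'.2 h), Real.log_exp,
    Real.log_sqrt h.le]
  ring

theorem measurable_quad {d : ℕ} (G : Matrix (Fin d) (Fin d) ℝ) :
    Measurable fun x : Vec d => quad G x := by
  unfold quad
  simp only [dotProduct, mulVec]
  fun_prop

theorem quad_nonneg {d : ℕ} {G : Matrix (Fin d) (Fin d) ℝ} (hG : 0 ≤ G) (x : Vec d) :
    0 ≤ quad G x := by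
  have := (Matrix.nonneg_iff_posSemidef.1 hG).dotProduct_mulVec_nonneg x.ofLp
  simpa [quad] using this

/-- Shift the index by one. The noise enters from time 1 on, and its geometric series gives γ/(1−γ).
-/
theorem hasSum_discounted_moments {n : ℕ} {γ : ℝ} (hγ0 : 0 ≤ γ) (hγ1 : γ < 1)
    {F N Γ : Matrix (Fin n) (Fin n) ℝ} {V : ℕ → Matrix (Fin n) (Fin n) ℝ}
    (hV : ∀ t, V (t + 1) = F * V t * Fᵀ + N) (h : HasSum (fun t : ℕ => γ ^ t • V t) Γ) :
    Γ = V 0 + (γ / (1 - γ)) • N + γ • (F * Γ * Fᵀ) := by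
  have h1 : ∀ t : ℕ, γ ^ (t + 1) • V (t + 1) = γ • (F * (γ ^ t • V t) * Fᵀ) + (γ ^ t * γ) • N :=
    fun t => by rw [hV, smul_add, Matrix.mul_smul, Matrix.smul_mul, smul_smul, pow_succ, mul_comm γ]
  have h2 := (h.mul_left F).mul_right Fᵀ
  have h3 := h2.const_smul γ
  have h4 : HasSum (fun t : ℕ => γ ^ t * γ) ((1 - γ)⁻¹ * γ) :=
    (hasSum_geometric_of_lt_one hγ0 hγ1).mul_right γ
  have h5 := (h3.add (h4.smul_const N)).congr_fun h1
  have h6 := h.unique h5.zero_add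
  rw [pow_zero, one_smul] at h6
  have h7 : γ / (1 - γ) = (1 - γ)⁻¹ * γ := by rw [div_eq_mul_inv, mul_comm]
  rw [h7]
  conv_lhs => rw [h6]
  abel

namespace Model

variable {n k : ℕ} (M : Model n k) {S : Matrix (Fin k) (Fin k) ℝ}

theorem Q_nonneg : 0 ≤ M.Q := Matrix.nonneg_iff_posSemidef.2 M.Q_posSemidef

/-- The part of the stage cost that the entropy regularization contributes. -/
def entropyTerm (S : Matrix (Fin k) (Fin k) ℝ) (η : Vec k) : ℝ :=
  M.τ * (-(1 / 2) * quad S⁻¹ η - 1 / 2 * Real.log ((2 * Real.pi) ^ k * S.det))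

/-- The expected stage cost of the randomization of the policy. -/
def randomizationCost (S : Matrix (Fin k) (Fin k) ℝ) : ℝ :=
  (M.R * S).trace - M.τ / 2 * (k + Real.log ((2 * Real.pi) ^ k * S.det))

theorem quad_action (K : Matrix (Fin k) (Fin n) ℝ) (x : Vec n) (η : Vec k) :
    quad M.R (action K x η) = x.ofLp ⬝ᵥ ((Kᵀ * M.R * K) *ᵥ x.ofLp) +
      x.ofLp ⬝ᵥ ((-(2 : ℝ) • (Kᵀ * M.R)) *ᵥ η.ofLp) + η.ofLp ⬝ᵥ (M.R *ᵥ η.ofLp) := by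
  have h1 : (action K x η).ofLp = -(K *ᵥ x.ofLp) + η.ofLp := by
    simp [action, Matrix.toLpLin_apply]
  have hR : M.Rᵀ = M.R := transpose_eq_of_nonneg M.R_nonneg
  have h2 : ∀ v : Fin k → ℝ, x.ofLp ⬝ᵥ ((Kᵀ * M.R) *ᵥ v) = (K *ᵥ x.ofLp) ⬝ᵥ (M.R *ᵥ v) := by
    intro v
    rw [← Matrix.mulVec_mulVec, dotProduct_mulVec, vecMul_transpose]
  have h3 : η.ofLp ⬝ᵥ (M.R *ᵥ (K *ᵥ x.ofLp)) = (K *ᵥ x.ofLp) ⬝ᵥ (M.R *ᵥ η.ofLp) := by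
    rw [dotProduct_mulVec, dotProduct_comm, ← mulVec_transpose, hR]
  rw [quad, h1, smul_mulVec, dotProduct_smul, h2, ← Matrix.mulVec_mulVec, h2]
  simp only [mulVec_add, mulVec_neg, add_dotProduct, dotProduct_add, neg_dotProduct,
    dotProduct_neg, h3, smul_eq_mul]
  ring

/-- The log-density at u = −Kx + η depends on η alone, so the entropy term has the same law at all
times and for all gains. -/
theorem stageCost_eq (hS : S.PosDef) (K : Matrix (Fin k) (Fin n) ℝ) (p : Vec n × Noise n k)
    (t : ℕ) : M.stageCost K S p.1 p.2 t =
      (quad M.Q (M.state K p.1 p.2 t) + quad M.R (M.control K p.1 p.2 t)) +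
        M.entropyTerm S (p.2.2 t) := by
  rw [stageCost, log_gaussianDensity hS, entropyTerm]
  have : M.control K p.1 p.2 t - -(Matrix.toEuclideanLin K (M.state K p.1 p.2 t)) = p.2.2 t := by
    simp [control, action]
  rw [this]

theorem measurable_entropyTerm (S : Matrix (Fin k) (Fin k) ℝ) :
    Measurable (M.entropyTerm S) :=
  (((measurable_quad S⁻¹).const_mul _).sub_const _).const_mul _

theorem integrable_quad_randomization (G : Matrix (Fin k) (Fin k) ℝ) (t : ℕ) :
    Integrable (fun p : Vec n × Noise n k => quad G (p.2.2 t)) (M.sampleLaw S) :=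
  integrable_dotProduct_mulVec (f := fun p : Vec n × Noise n k => (p.2.2 t).ofLp)
    (g := fun p => (p.2.2 t).ofLp) (M.memLp_randomization S t) (M.memLp_randomization S t) G

theorem integral_quad_randomization (hS : 0 ≤ S) (G : Matrix (Fin k) (Fin k) ℝ) (t : ℕ) :
    ∫ p : Vec n × Noise n k, quad G (p.2.2 t) ∂(M.sampleLaw S) = (G * S).trace :=
  integral_dotProduct_mulVec (f := fun p : Vec n × Noise n k => (p.2.2 t).ofLp)
    (g := fun p => (p.2.2 t).ofLp) (M.memLp_randomization S t) (M.memLp_randomization S t) G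
    fun i j => by
      have h := M.integral_randomization_mul hS t t j i
      rw [if_pos rfl] at h
      rw [← h]
      exact integral_congr_ae (Filter.Eventually.of_forall fun p => mul_comm _ _)

theorem integrable_entropyTerm (S : Matrix (Fin k) (Fin k) ℝ) (t : ℕ) :
    Integrable (fun p : Vec n × Noise n k => M.entropyTerm S (p.2.2 t)) (M.sampleLaw S) :=
  (((M.integrable_quad_randomization S⁻¹ t).const_mul _).sub (integrable_const _)).const_mul _

theorem integral_entropyTerm (hS : S.PosDef) (t : ℕ) :
    ∫ p : Vec n × Noise n k, M.entropyTerm S (p.2.2 t) ∂(M.sampleLaw S) =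
      -(M.τ / 2 * (k + Real.log ((2 * Real.pi) ^ k * S.det))) := by
  have hdet : IsUnit S.det := (Matrix.isUnit_iff_isUnit_det _).1 hS.isUnit
  simp only [entropyTerm]
  rw [integral_const_mul, integral_sub ((M.integrable_quad_randomization S⁻¹ t).const_mul _)
    (integrable_const _), integral_const_mul,
    M.integral_quad_randomization (Matrix.nonneg_iff_posSemidef.2 hS.posSemidef),
    Matrix.nonsing_inv_mul _ hdet]
  simp
  ring

/-- The quadratic part of the stage cost. -/
def quadCost (K : Matrix (Fin k) (Fin n) ℝ) (t : ℕ) (p : Vec n × Noise n k) : ℝ :=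
  quad M.Q (M.state K p.1 p.2 t) + quad M.R (M.control K p.1 p.2 t)

theorem quadCost_nonneg (K : Matrix (Fin k) (Fin n) ℝ) (t : ℕ) (p : Vec n × Noise n k) :
    0 ≤ M.quadCost K t p :=
  add_nonneg (quad_nonneg M.Q_nonneg _) (quad_nonneg M.R_nonneg _)

theorem quadCost_eq (K : Matrix (Fin k) (Fin n) ℝ) (t : ℕ) (p : Vec n × Noise n k) :
    M.quadCost K t p = M.stateFun K t p ⬝ᵥ (M.stageMatrix K *ᵥ M.stateFun K t p) +
      M.stateFun K t p ⬝ᵥ ((-(2 : ℝ) • (Kᵀ * M.R)) *ᵥ (p.2.2 t).ofLp) +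
      quad M.R (p.2.2 t) := by
  have h : M.stateFun K t p = (M.state K p.1 p.2 t).ofLp := rfl
  rw [quadCost, control, quad_action, stageMatrix, add_mulVec, dotProduct_add, h, quad, quad]
  ring

theorem integrable_quadCost (K : Matrix (Fin k) (Fin n) ℝ) (t : ℕ) :
    Integrable (M.quadCost K t) (M.sampleLaw S) := by
  have h : M.quadCost K t = _ := funext (M.quadCost_eq K t)
  rw [h]
  exact ((integrable_dotProduct_mulVec (M.memLp_stateFun K t) (M.memLp_stateFun K t) _).add
    (integrable_dotProduct_mulVec (M.memLp_stateFun K t) (M.memLp_randomization S t) _)).add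
    (M.integrable_quad_randomization M.R t)

theorem integral_quadCost (hS : 0 ≤ S) (K : Matrix (Fin k) (Fin n) ℝ) (t : ℕ) :
    ∫ p, M.quadCost K t p ∂(M.sampleLaw S) =
      (M.stageMatrix K * M.stateMoment K S t).trace + (M.R * S).trace := by
  have i1 := integrable_dotProduct_mulVec (M.memLp_stateFun (S := S) K t)
    (M.memLp_stateFun K t) (M.stageMatrix K)
  have i2 := integrable_dotProduct_mulVec (M.memLp_stateFun (S := S) K t)
    (M.memLp_randomization S t) (-(2 : ℝ) • (Kᵀ * M.R))
  have i3 := M.integrable_quad_randomization (S := S) M.R t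
  have i12 : Integrable (fun p => M.stateFun K t p ⬝ᵥ (M.stageMatrix K *ᵥ M.stateFun K t p) +
      M.stateFun K t p ⬝ᵥ ((-(2 : ℝ) • (Kᵀ * M.R)) *ᵥ (p.2.2 t).ofLp)) (M.sampleLaw S) :=
    i1.add i2
  rw [integral_congr_ae (Filter.Eventually.of_forall (M.quadCost_eq K t)), integral_add i12 i3,
    integral_add i1 i2, M.integral_quad_randomization hS,
    integral_dotProduct_mulVec (M.memLp_stateFun K t) (M.memLp_stateFun K t) _
      (V := M.stateMoment K S t) fun i j => by
        rw [← M.integral_stateFun_mul hS K t j i]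
        exact integral_congr_ae (Filter.Eventually.of_forall fun p => mul_comm _ _),
    integral_dotProduct_mulVec (M.memLp_stateFun K t) (M.memLp_randomization S t) _
      (V := 0) fun i j => by simpa using M.integral_stateFun_mul_randomization hS K t i j]
  simp

theorem measurable_stageCost (hS : S.PosDef) (K : Matrix (Fin k) (Fin n) ℝ) (t : ℕ) :
    Measurable fun p : Vec n × Noise n k => M.stageCost K S p.1 p.2 t := by
  simp only [M.stageCost_eq hS]
  have h2 : Measurable fun p : Vec n × Noise n k => p.2.2 t := by fun_prop
  exact (((measurable_quad M.Q).comp (M.measurable_state K t)).add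
    ((measurable_quad M.R).comp (M.measurable_control K t))).add
      ((M.measurable_entropyTerm S).comp h2)

theorem integrable_stageCost (hS : S.PosDef) (K : Matrix (Fin k) (Fin n) ℝ) (t : ℕ) :
    Integrable (fun p : Vec n × Noise n k => M.stageCost K S p.1 p.2 t) (M.sampleLaw S) := by
  simp only [M.stageCost_eq hS]
  exact (M.integrable_quadCost K t).add (M.integrable_entropyTerm S t)

theorem integral_stageCost (hS : S.PosDef) (K : Matrix (Fin k) (Fin n) ℝ) (t : ℕ) :
    ∫ p : Vec n × Noise n k, M.stageCost K S p.1 p.2 t ∂(M.sampleLaw S) =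
      (M.stageMatrix K * M.stateMoment K S t).trace + M.randomizationCost S := by
  simp only [M.stageCost_eq hS]
  have h := integral_add (M.integrable_quadCost (S := S) K t) (M.integrable_entropyTerm S t)
  refine h.trans ?_
  rw [M.integral_quadCost (Matrix.nonneg_iff_posSemidef.2 hS.posSemidef),
    M.integral_entropyTerm hS, randomizationCost]
  ring

/-- The quadratic part is nonnegative, so the absolute value costs only a constant independent of t,
summable after discounting. Finite cost thus becomes summability of the expected quadratic costs. -/
theorem integral_abs_stageCost_le (hS : S.PosDef) (K : Matrix (Fin k) (Fin n) ℝ) (t : ℕ) :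
    ∫ p : Vec n × Noise n k, |M.stageCost K S p.1 p.2 t| ∂(M.sampleLaw S) ≤
      (M.stageMatrix K * M.stateMoment K S t).trace + ((M.R * S).trace +
        ∫ η, |M.entropyTerm S η| ∂(multivariateGaussian (0 : Vec k) S)) := by
  have h1 := M.integrable_quadCost (S := S) K t
  have h2 := (M.integrable_entropyTerm S t).abs
  have h3 := integral_comp_measurePreserving (M.measurePreserving_randomization S t)
    (M.measurable_entropyTerm S).abs
  rw [← h3, ← add_assoc, ← M.integral_quadCost (Matrix.nonneg_iff_posSemidef.2 hS.posSemidef),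
    ← integral_add h1 h2]
  refine integral_mono (M.integrable_stageCost hS K t).abs (h1.add h2) fun p => ?_
  rw [M.stageCost_eq hS]
  exact (abs_add_le _ _).trans (add_le_add_left (abs_of_nonneg (M.quadCost_nonneg K t p)).le _)

/-! ### Finiteness of the cost and summation over time -/

theorem summable_discount : Summable fun t : ℕ => M.γ ^ t :=
  summable_geometric_of_lt_one M.γ_pos.le M.γ_lt_one

theorem finiteCost_iff (hS : S.PosDef) (K : Matrix (Fin k) (Fin n) ℝ) :
    M.FiniteCost K S ↔ Summable fun t : ℕ =>
      ∫ p : Vec n × Noise n k, ‖M.γ ^ t * M.stageCost K S p.1 p.2 t‖ ∂(M.sampleLaw S) := by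
  have hm : ∀ t, Measurable fun p : Vec n × Noise n k =>
      ENNReal.ofReal (M.γ ^ t * |M.stageCost K S p.1 p.2 t|) := fun t =>
    ((M.measurable_stageCost hS K t).abs.const_mul _).ennreal_ofReal
  have h0 : ∀ t (p : Vec n × Noise n k), M.γ ^ t * |M.stageCost K S p.1 p.2 t| =
      ‖M.γ ^ t * M.stageCost K S p.1 p.2 t‖ := fun t p => by
    rw [Real.norm_eq_abs, abs_mul, abs_of_nonneg (pow_nonneg M.γ_pos.le t)]
  have hi : ∀ t, Integrable (fun p : Vec n × Noise n k => M.γ ^ t * M.stageCost K S p.1 p.2 t)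
      (M.sampleLaw S) := fun t => (M.integrable_stageCost hS K t).const_mul _
  have h1 : ∫⁻ x, ∫⁻ ω, ∑' t : ℕ, ENNReal.ofReal (M.γ ^ t * |M.stageCost K S x ω t|)
      ∂(M.noiseLaw S) ∂M.init = ∑' t : ℕ, ENNReal.ofReal
        (∫ p : Vec n × Noise n k, ‖M.γ ^ t * M.stageCost K S p.1 p.2 t‖ ∂(M.sampleLaw S)) := by
    rw [← lintegral_prod (fun p : Vec n × Noise n k =>
      ∑' t : ℕ, ENNReal.ofReal (M.γ ^ t * |M.stageCost K S p.1 p.2 t|))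
      (Measurable.tsum hm).aemeasurable, lintegral_tsum fun t => (hm t).aemeasurable]
    refine tsum_congr fun t => ?_
    rw [ofReal_integral_eq_lintegral_ofReal (hi t).norm
      (Filter.Eventually.of_forall fun p => norm_nonneg _)]
    simp only [h0]
    rfl
  rw [FiniteCost, h1]
  constructor
  · intro h
    refine (ENNReal.summable_toReal h.ne).congr fun t => ?_
    rw [ENNReal.toReal_ofReal (integral_nonneg fun p => norm_nonneg _)]
  · intro h
    rw [← ENNReal.ofReal_tsum_of_nonneg (fun t => integral_nonneg fun p => norm_nonneg _) h]
    exact ENNReal.ofReal_lt_top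

theorem finiteCost_iff_summable_trace (hS : S.PosDef) (K : Matrix (Fin k) (Fin n) ℝ) :
    M.FiniteCost K S ↔ Summable fun t : ℕ =>
      M.γ ^ t * (M.stageMatrix K * M.stateMoment K S t).trace := by
  have hS0 : 0 ≤ S := Matrix.nonneg_iff_posSemidef.2 hS.posSemidef
  rw [M.finiteCost_iff hS]
  constructor
  · intro h
    have h1 : Summable fun t : ℕ =>
        ∫ p : Vec n × Noise n k, M.γ ^ t * M.stageCost K S p.1 p.2 t ∂(M.sampleLaw S) :=
      h.of_norm_bounded fun t => norm_integral_le_integral_norm _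
    have h2 := h1.sub (M.summable_discount.mul_right (M.randomizationCost S))
    refine h2.congr fun t => ?_
    rw [integral_const_mul, M.integral_stageCost hS]
    ring
  · intro h
    have h2 := h.add (M.summable_discount.mul_right ((M.R * S).trace +
        ∫ η, |M.entropyTerm S η| ∂(multivariateGaussian (0 : Vec k) S)))
    refine Summable.of_nonneg_of_le (fun t => integral_nonneg fun p => norm_nonneg _)
      (fun t => ?_) h2
    simp only [Real.norm_eq_abs, abs_mul, abs_of_nonneg (pow_nonneg M.γ_pos.le t)]
    rw [integral_const_mul, ← mul_add]
    exact mul_le_mul_of_nonneg_left (M.integral_abs_stageCost_le hS K t)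
      (pow_nonneg M.γ_pos.le t)

theorem cost_eq_tsum (hS : S.PosDef) (K : Matrix (Fin k) (Fin n) ℝ) (h : M.FiniteCost K S) :
    M.cost K S = ∑' t : ℕ, M.γ ^ t * (M.stageMatrix K * M.stateMoment K S t).trace +
      (1 - M.γ)⁻¹ * M.randomizationCost S := by
  have hm : ∀ t, Measurable fun p : Vec n × Noise n k => M.γ ^ t * M.stageCost K S p.1 p.2 t :=
    fun t => (M.measurable_stageCost hS K t).const_mul _
  have hi : ∀ t, Integrable (fun p : Vec n × Noise n k => M.γ ^ t * M.stageCost K S p.1 p.2 t)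
      (M.sampleLaw S) := fun t => (M.integrable_stageCost hS K t).const_mul _
  have h1 := hasSum_iterated_integral hm hi ((M.finiteCost_iff hS K).1 h)
  have h2 := ((M.finiteCost_iff_summable_trace hS K).1 h).hasSum.add
    ((hasSum_geometric_of_lt_one M.γ_pos.le M.γ_lt_one).mul_right (M.randomizationCost S))
  refine h1.unique (h2.congr_fun fun t => ?_)
  change ∫ p, M.γ ^ t * M.stageCost K S p.1 p.2 t ∂(M.sampleLaw S) = _
  rw [integral_const_mul, M.integral_stageCost hS, mul_add]

/-! The expected cost in terms of the value matrix. -/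

theorem trace_valueMatrixTerm_mul (K : Matrix (Fin k) (Fin n) ℝ) (t : ℕ)
    (D : Matrix (Fin n) (Fin n) ℝ) : (M.valueMatrixTerm K t * D).trace =
      M.γ ^ t * (M.stageMatrix K * ((M.A - M.B * K) ^ t * D * (M.A - M.B * K)ᵀ ^ t)).trace := by
  rw [valueMatrixTerm, Matrix.smul_mul, trace_smul, smul_eq_mul]
  congr 1
  change ((M.A - M.B * K)ᵀ ^ t * M.stageMatrix K * (M.A - M.B * K) ^ t * D).trace = _
  rw [Matrix.mul_assoc, Matrix.mul_assoc, trace_mul_comm]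
  simp only [Matrix.mul_assoc]

theorem hasSum_trace_valueMatrixTerm_mul {K : Matrix (Fin k) (Fin n) ℝ}
    (h : Summable (M.valueMatrixTerm K)) (D : Matrix (Fin n) (Fin n) ℝ) :
    HasSum (fun t => (M.valueMatrixTerm K t * D).trace) (M.valueMatrix K * D).trace :=
  h.hasSum.map
    ({ toFun := fun P => (P * D).trace, map_zero' := by simp,
       map_add' := fun P P' => by rw [Matrix.add_mul, trace_add] } :
      Matrix (Fin n) (Fin n) ℝ →+ ℝ) (by change Continuous fun P => (P * D).trace; fun_prop)

/-- Meant for u t = γ^t ∑_{j<t} a_j and f t = γ^t a_t. The partial sums of u stay below the fixed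
point of s = γ(s + b), which is then the sum; no double series is rearranged. -/
theorem hasSum_of_discounted_recursion {γ b : ℝ} (hγ0 : 0 ≤ γ) (hγ1 : γ < 1) {u f : ℕ → ℝ}
    (hf : HasSum f b) (hf0 : ∀ t, 0 ≤ f t) (hu0 : u 0 = 0)
    (hu : ∀ t, u (t + 1) = γ * (u t + f t)) : HasSum u (γ / (1 - γ) * b) := by
  have h1γ : 0 < 1 - γ := by linarith
  have hnn : ∀ t, 0 ≤ u t := by
    intro t
    induction t with
    | zero => exact hu0.ge
    | succ t ih => rw [hu]; exact mul_nonneg hγ0 (add_nonneg ih (hf0 t))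
  have hb : 0 ≤ b := hf.nonneg hf0
  have hpart : ∀ T, ∑ t ∈ Finset.range T, u t ≤ γ / (1 - γ) * b := by
    intro T
    induction T with
    | zero => simp; positivity
    | succ T ih =>
      rw [Finset.sum_range_succ', hu0, add_zero]
      simp only [hu]
      rw [← Finset.mul_sum, Finset.sum_add_distrib]
      have h2 : ∑ t ∈ Finset.range T, f t ≤ b := sum_le_hasSum _ (fun t _ => hf0 t) hf
      calc γ * (∑ t ∈ Finset.range T, u t + ∑ t ∈ Finset.range T, f t)
          ≤ γ * (γ / (1 - γ) * b + b) := by gcongr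
        _ = γ / (1 - γ) * b := by field_simp; ring
  have hs : Summable u := summable_of_sum_range_le hnn hpart
  have h3 : ∑' t, u t = γ * (∑' t, u t + b) := by
    conv_lhs => rw [hs.tsum_eq_zero_add, hu0, zero_add]
    simp only [hu]
    rw [tsum_mul_left, hs.tsum_add hf.summable, hf.tsum_eq]
  have h4 : ∑' t, u t = γ / (1 - γ) * b := by
    field_simp
    linarith
  rw [← h4]
  exact hs.hasSum

/-- The discounted second moment of the initial state and all disturbances. -/
def sourceMatrix (S : Matrix (Fin k) (Fin k) ℝ) : Matrix (Fin n) (Fin n) ℝ :=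
  M.D0 + (M.γ / (1 - M.γ)) • M.disturbance S

/-- The state moment splits into the propagated D₀ and the accumulated disturbances. A disturbance
acts like a fresh initial state at each time from 1 on, whence the weight γ/(1−γ) in the source. -/
theorem hasSum_trace_stateMoment (hS : 0 ≤ S) {K : Matrix (Fin k) (Fin n) ℝ}
    (h : Summable (M.valueMatrixTerm K)) :
    HasSum (fun t : ℕ => M.γ ^ t * (M.stageMatrix K * M.stateMoment K S t).trace)
      (M.valueMatrix K * M.sourceMatrix S).trace := by
  set F := M.A - M.B * K with hF
  set N := M.disturbance S with hN
  have hN0 : 0 ≤ N := M.disturbance_nonneg hS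
  have h1 := M.hasSum_trace_valueMatrixTerm_mul h M.D0
  have h2 := M.hasSum_trace_valueMatrixTerm_mul h N
  have h3 := hasSum_of_discounted_recursion M.γ_pos.le M.γ_lt_one (u := fun t : ℕ =>
      M.γ ^ t * ∑ j ∈ Finset.range t, (M.stageMatrix K * (F ^ j * N * Fᵀ ^ j)).trace) h2
    (fun t => trace_mul_nonneg (M.valueMatrixTerm_nonneg K t) hN0) (by simp) fun t => by
      rw [M.trace_valueMatrixTerm_mul, Finset.sum_range_succ, pow_succ]
      ring
  have h4 : (M.valueMatrix K * M.sourceMatrix S).trace = (M.valueMatrix K * M.D0).trace +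
      M.γ / (1 - M.γ) * (M.valueMatrix K * N).trace := by
    rw [sourceMatrix, Matrix.mul_add, trace_add, Matrix.mul_smul, trace_smul, smul_eq_mul]
  rw [h4]
  convert h1.add h3 using 2 with t
  rw [M.trace_valueMatrixTerm_mul, stateMoment, momentSeq_eq, Matrix.mul_add, trace_add,
    Finset.mul_sum, trace_sum, mul_add]

theorem finiteCost_of_summable (hS : S.PosDef) {K : Matrix (Fin k) (Fin n) ℝ}
    (h : Summable (M.valueMatrixTerm K)) : M.FiniteCost K S :=
  (M.finiteCost_iff_summable_trace hS K).2
    (M.hasSum_trace_stateMoment (Matrix.nonneg_iff_posSemidef.2 hS.posSemidef) h).summable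

theorem cost_eq (hS : S.PosDef) {K : Matrix (Fin k) (Fin n) ℝ}
    (h : Summable (M.valueMatrixTerm K)) :
    M.cost K S = (M.valueMatrix K * M.sourceMatrix S).trace +
      (1 - M.γ)⁻¹ * M.randomizationCost S := by
  rw [M.cost_eq_tsum hS K (M.finiteCost_of_summable hS h),
    (M.hasSum_trace_stateMoment (Matrix.nonneg_iff_posSemidef.2 hS.posSemidef) h).tsum_eq]

theorem mu_smul_one_le_D0 : M.mu • (1 : Matrix (Fin n) (Fin n) ℝ) ≤ M.D0 :=
  sigmaMin_smul_one_le M.D0_nonneg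

/-- Since D₀ ≥ μ, the trace of the t-th term of the value series is at most 1/μ times the discounted
expected state cost at time t; the noise only increases that cost. -/
theorem summable_of_finiteCost (hμ : 0 < M.mu) (hS : S.PosDef) {K : Matrix (Fin k) (Fin n) ℝ}
    (h : M.FiniteCost K S) : Summable (M.valueMatrixTerm K) := by
  have hN0 : 0 ≤ M.disturbance S :=
    M.disturbance_nonneg (Matrix.nonneg_iff_posSemidef.2 hS.posSemidef)
  have h1 := (M.finiteCost_iff_summable_trace hS K).1 h
  refine summable_of_trace_summable (M.valueMatrixTerm_nonneg K) ?_
  refine Summable.of_nonneg_of_le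
    (fun t => trace_nonneg_of_nonneg (M.valueMatrixTerm_nonneg K t)) (fun t => ?_)
    (h1.mul_left M.mu⁻¹)
  rw [inv_mul_eq_div, le_div_iff₀ hμ]
  have h2 := trace_mul_mono (M.valueMatrixTerm_nonneg K t) M.mu_smul_one_le_D0
  rw [Matrix.mul_smul, Matrix.mul_one, trace_smul, smul_eq_mul, M.trace_valueMatrixTerm_mul] at h2
  rw [mul_comm]
  refine h2.trans (mul_le_mul_of_nonneg_left ?_ (pow_nonneg M.γ_pos.le t))
  refine trace_mul_mono (M.stageMatrix_nonneg K) ?_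
  rw [stateMoment, momentSeq_eq]
  refine le_add_of_nonneg_right (Finset.sum_nonneg fun j _ => ?_)
  rw [← transpose_pow]
  exact congr_nonneg' hN0 _

/-! The state correlation matrix of a stable closed loop. -/

theorem norm_stateMoment_le {K : Matrix (Fin k) (Fin n) ℝ} {ρ : ℝ} (hρ1 : ρ < 1)
    (hρ : ‖M.A - M.B * K‖ ≤ ρ) (t : ℕ) :
    ‖M.stateMoment K S t‖ ≤ ‖M.D0‖ + ‖M.disturbance S‖ / (1 - ρ ^ 2) := by
  have hρ0 : 0 ≤ ρ := (norm_nonneg _).trans hρ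
  have h1 : 0 < 1 - ρ ^ 2 := by nlinarith
  -- Chosen to be invariant under the recursion: ρ²C + ‖N‖ ≤ C for the disturbance moment N.
  set C := ‖M.D0‖ + ‖M.disturbance S‖ / (1 - ρ ^ 2) with hC
  have hC0 : 0 ≤ C := by positivity
  induction t with
  | zero =>
    change ‖M.D0‖ ≤ C
    exact le_add_of_nonneg_right (by positivity)
  | succ t ih =>
    change ‖(M.A - M.B * K) * M.stateMoment K S t * (M.A - M.B * K)ᵀ + M.disturbance S‖ ≤ C
    calc _ ≤ ‖M.A - M.B * K‖ * ‖M.stateMoment K S t‖ * ‖(M.A - M.B * K)ᵀ‖ +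
          ‖M.disturbance S‖ := (norm_add_le _ _).trans (add_le_add_left ((norm_mul_le _ _).trans
            (mul_le_mul_of_nonneg_right (norm_mul_le _ _) (norm_nonneg _))) _)
      _ ≤ ρ * C * ρ + ‖M.disturbance S‖ := by rw [norm_transpose]; gcongr
      _ ≤ C := by
        have h2 : (1 - ρ ^ 2) * C = (1 - ρ ^ 2) * ‖M.D0‖ + ‖M.disturbance S‖ := by
          rw [hC]; field_simp
        nlinarith [mul_nonneg h1.le (norm_nonneg M.D0)]

theorem summable_stateMoment {K : Matrix (Fin k) (Fin n) ℝ} {ρ : ℝ} (hρ1 : ρ < 1)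
    (hρ : ‖M.A - M.B * K‖ ≤ ρ) : Summable fun t : ℕ => M.γ ^ t • M.stateMoment K S t := by
  refine Summable.of_norm_bounded (M.summable_discount.mul_right
    (‖M.D0‖ + ‖M.disturbance S‖ / (1 - ρ ^ 2))) fun t => ?_
  rw [norm_smul, Real.norm_eq_abs, abs_of_nonneg (pow_nonneg M.γ_pos.le t)]
  exact mul_le_mul_of_nonneg_left (M.norm_stateMoment_le hρ1 hρ t) (pow_nonneg M.γ_pos.le t)

theorem hasSum_stateCorr (hS : 0 ≤ S) {K : Matrix (Fin k) (Fin n) ℝ} {ρ : ℝ} (hρ1 : ρ < 1)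
    (hρ : ‖M.A - M.B * K‖ ≤ ρ) :
    HasSum (fun t : ℕ => M.γ ^ t • M.stateMoment K S t) (M.stateCorr K S) := by
  have hs := M.summable_stateMoment (S := S) hρ1 hρ
  have hent : ∀ i j, HasSum (fun t : ℕ => M.γ ^ t * M.stateMoment K S t i j)
      ((∑' t : ℕ, M.γ ^ t • M.stateMoment K S t) i j) := fun i j =>
    hs.hasSum.map (Matrix.entryAddMonoidHom ℝ i j)
      (by change Continuous fun P : Matrix (Fin n) (Fin n) ℝ => P i j; fun_prop)
  have hmeas : ∀ t i, Measurable fun p => M.stateFun K t p i := fun t i => by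
    have h1 : Measurable fun x : Vec n => x i := by fun_prop
    exact h1.comp (M.measurable_state K t)
  have hint : ∀ t i j, Integrable (fun p => M.stateFun K t p i * M.stateFun K t p j)
      (M.sampleLaw S) := fun t i j =>
    (M.memLp_stateFun K t i).integrable_mul (M.memLp_stateFun K t j)
  have heq : M.stateCorr K S = ∑' t : ℕ, M.γ ^ t • M.stateMoment K S t := by
    ext i j
    have h1 := hasSum_iterated_integral (μ := M.init) (ν := M.noiseLaw S)
      (f := fun t p => M.γ ^ t * (M.stateFun K t p i * M.stateFun K t p j))
      (fun t => ((hmeas t i).mul (hmeas t j)).const_mul _)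
      (fun t => (hint t i j).const_mul _) ?_
    · refine h1.unique ((hent i j).congr_fun fun t => ?_)
      change ∫ p, M.γ ^ t * (M.stateFun K t p i * M.stateFun K t p j) ∂(M.sampleLaw S) = _
      rw [integral_const_mul, M.integral_stateFun_mul hS]
    -- Off-diagonal entries are dominated by diagonal ones: |x_i x_j| ≤ x_i² + x_j².
    · refine Summable.of_nonneg_of_le (fun t => integral_nonneg fun p => norm_nonneg _)
        (fun t => ?_) ((hent i i).summable.add (hent j j).summable)
      rw [← mul_add, ← M.integral_stateFun_mul hS, ← M.integral_stateFun_mul hS,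
        ← integral_add (hint t i i) (hint t j j)]
      change ∫ p, ‖M.γ ^ t * (M.stateFun K t p i * M.stateFun K t p j)‖ ∂(M.sampleLaw S) ≤ _
      simp only [Real.norm_eq_abs, abs_mul, abs_of_nonneg (pow_nonneg M.γ_pos.le t)]
      rw [integral_const_mul]
      refine mul_le_mul_of_nonneg_left ?_ (pow_nonneg M.γ_pos.le t)
      refine integral_mono ?_ ((hint t i i).add (hint t j j)) fun p => ?_
      · have := (hint t i j).abs
        simpa only [abs_mul] using this
      · nlinarith [sq_nonneg (|M.stateFun K t p i| - |M.stateFun K t p j|),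
          sq_abs (M.stateFun K t p i), sq_abs (M.stateFun K t p j),
          sq_nonneg (M.stateFun K t p i), sq_nonneg (M.stateFun K t p j)]
  rw [heq]
  exact hs.hasSum

theorem stateCorr_eq (hS : 0 ≤ S) {K : Matrix (Fin k) (Fin n) ℝ} {ρ : ℝ} (hρ1 : ρ < 1)
    (hρ : ‖M.A - M.B * K‖ ≤ ρ) :
    M.stateCorr K S = M.sourceMatrix S +
      M.γ • ((M.A - M.B * K) * M.stateCorr K S * (M.A - M.B * K)ᵀ) :=
  hasSum_discounted_moments M.γ_pos.le M.γ_lt_one (fun _ => rfl) (M.hasSum_stateCorr hS hρ1 hρ)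

theorem stateCorr_nonneg (hS : 0 ≤ S) {K : Matrix (Fin k) (Fin n) ℝ} {ρ : ℝ} (hρ1 : ρ < 1)
    (hρ : ‖M.A - M.B * K‖ ≤ ρ) : 0 ≤ M.stateCorr K S :=
  hasSum_nonneg_matrix (M.hasSum_stateCorr hS hρ1 hρ) fun t =>
    smul_nonneg (pow_nonneg M.γ_pos.le t) (M.stateMoment_nonneg hS K t)

end Model

/-! ### Comparison of costs and optimality conditions -/

namespace Model

variable {n k : ℕ} (M : Model n k)

/-- The covariance that is optimal for the feedback gain `K`. -/
def bestCov (K : Matrix (Fin k) (Fin n) ℝ) : Matrix (Fin k) (Fin k) ℝ :=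
  (M.τ / 2) • (M.hess K)⁻¹

theorem bestCov_posDef (K : Matrix (Fin k) (Fin n) ℝ) : (M.bestCov K).PosDef :=
  (M.hess_posDef K).inv.smul (half_pos M.τ_pos)

theorem nonneg_of_posDef {d : ℕ} {S : Matrix (Fin d) (Fin d) ℝ} (hS : S.PosDef) : 0 ≤ S :=
  Matrix.nonneg_iff_posSemidef.2 hS.posSemidef

theorem cost_sub_cost_of_cov_eq {K L : Matrix (Fin k) (Fin n) ℝ} {S : Matrix (Fin k) (Fin k) ℝ}
    (hS : S.PosDef) (hK : Summable (M.valueMatrixTerm K)) (hL : Summable (M.valueMatrixTerm L)) :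
    M.cost K S - M.cost L S =
      ((M.valueMatrix K - M.valueMatrix L) * M.sourceMatrix S).trace := by
  rw [M.cost_eq hS hK, M.cost_eq hS hL, Matrix.sub_mul, trace_sub]
  ring

/-- The direct control cost of Σ and the cost of the noise BΣBᵀ, propagated by P_K, combine to
tr(H_K Σ)/(1−γ). -/
theorem cost_eq_hess {K : Matrix (Fin k) (Fin n) ℝ} {S : Matrix (Fin k) (Fin k) ℝ}
    (hS : S.PosDef) (hK : Summable (M.valueMatrixTerm K)) :
    M.cost K S = (M.valueMatrix K * (M.D0 + (M.γ / (1 - M.γ)) • M.W)).trace +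
      (1 - M.γ)⁻¹ * ((M.hess K * S).trace -
        M.τ / 2 * (k + Real.log ((2 * Real.pi) ^ k) + Real.log S.det)) := by
  have h1 : (M.valueMatrix K * (M.B * S * M.Bᵀ)).trace =
      (M.Bᵀ * M.valueMatrix K * M.B * S).trace := by
    rw [trace_mul_comm (M.valueMatrix K), Matrix.mul_assoc (M.B * S), trace_mul_comm (M.B * S)]
    simp only [Matrix.mul_assoc]
  rw [M.cost_eq hS hK, randomizationCost, sourceMatrix, disturbance, hess,
    Real.log_mul (by positivity) hS.det_pos.ne']
  simp only [Matrix.mul_add, Matrix.add_mul, trace_add, Matrix.mul_smul, Matrix.smul_mul,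
    trace_smul, smul_eq_mul, smul_add, h1]
  ring

/-- Up to a constant the cost is τ/(2(1−γ)) times tr((2/τ)H_K Σ) − log det Σ, whose only minimizer
is the inverse of (2/τ)H_K. -/
theorem cost_bestCov_le {K : Matrix (Fin k) (Fin n) ℝ} {S : Matrix (Fin k) (Fin k) ℝ}
    (hS : S.PosDef) (hK : Summable (M.valueMatrixTerm K)) :
    M.cost K (M.bestCov K) ≤ M.cost K S ∧
      (M.cost K S ≤ M.cost K (M.bestCov K) → S = M.bestCov K) := by
  have hτ := M.τ_pos
  have h1γ : 0 < (1 - M.γ)⁻¹ := inv_pos.2 (by linarith [M.γ_lt_one])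
  have hH : ((2 / M.τ) • M.hess K).PosDef := (M.hess_posDef K).smul (by positivity)
  have hdet := M.isUnit_det_hess K
  have hinv : ((2 / M.τ) • M.hess K)⁻¹ = M.bestCov K := by
    refine Matrix.inv_eq_right_inv ?_
    rw [bestCov, Matrix.smul_mul, Matrix.mul_smul, Matrix.mul_nonsing_inv _ hdet, smul_smul]
    field_simp
    simp
  have hval : ((2 / M.τ) • M.hess K * M.bestCov K).trace - Real.log (M.bestCov K).det =
      k + Real.log ((2 / M.τ) • M.hess K).det := by
    rw [← hinv, Matrix.mul_nonsing_inv _ ((Matrix.isUnit_iff_isUnit_det _).1 hH.isUnit),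
      Matrix.det_nonsing_inv, Ring.inverse_eq_inv', Real.log_inv]
    simp
  obtain ⟨h1, h2⟩ := trace_mul_sub_log_det_ge hH hS
  rw [← hval] at h1 h2
  rw [hinv] at h2
  simp only [Matrix.smul_mul, trace_smul, smul_eq_mul] at h1 h2
  have e : ∀ Z : Matrix (Fin k) (Fin k) ℝ, (M.hess K * Z).trace -
      M.τ / 2 * (k + Real.log ((2 * Real.pi) ^ k) + Real.log Z.det) =
        M.τ / 2 * (2 / M.τ * (M.hess K * Z).trace - Real.log Z.det) -
          M.τ / 2 * (k + Real.log ((2 * Real.pi) ^ k)) := fun Z => by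
    field_simp
    ring
  rw [M.cost_eq_hess hS hK, M.cost_eq_hess (M.bestCov_posDef K) hK, e, e]
  refine ⟨by gcongr, fun h => h2 ?_⟩
  have h3 := le_of_mul_le_mul_left (le_of_add_le_add_left h) h1γ
  exact le_of_mul_le_mul_left (by linarith) (half_pos hτ)

theorem mu_smul_one_le_sourceMatrix {S : Matrix (Fin k) (Fin k) ℝ} (hS : 0 ≤ S) :
    M.mu • (1 : Matrix (Fin n) (Fin n) ℝ) ≤ M.sourceMatrix S :=
  M.mu_smul_one_le_D0.trans (le_add_of_nonneg_right
    (smul_nonneg (div_nonneg M.γ_pos.le (by linarith [M.γ_lt_one])) (M.disturbance_nonneg hS)))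

theorem mu_mul_trace_le {S : Matrix (Fin k) (Fin k) ℝ} (hS : 0 ≤ S)
    {G : Matrix (Fin n) (Fin n) ℝ} (hG : 0 ≤ G) :
    M.mu * G.trace ≤ (G * M.sourceMatrix S).trace := by
  have h := trace_mul_mono hG (M.mu_smul_one_le_sourceMatrix hS)
  rwa [Matrix.mul_smul, Matrix.mul_one, trace_smul, smul_eq_mul] at h

variable {Kst : Matrix (Fin k) (Fin n) ℝ} {Sst : Matrix (Fin k) (Fin k) ℝ}

theorem IsOptimal.summable (hμ : 0 < M.mu) (hopt : M.IsOptimal Kst Sst) :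
    Summable (M.valueMatrixTerm Kst) :=
  M.summable_of_finiteCost hμ hopt.1 hopt.2.1

/-- Otherwise policy improvement at the same covariance would lower the cost by at least μ times the
trace of the decrement. -/
theorem IsOptimal.gradE_eq_zero (hμ : 0 < M.mu) (hopt : M.IsOptimal Kst Sst) :
    M.gradE Kst = 0 := by
  have hs := IsOptimal.summable M hμ hopt
  obtain ⟨h1, h2⟩ := M.newton_summable_and_le hs
  have h3 := hopt.2.2 (M.newton Kst) Sst hopt.1 (M.finiteCost_of_summable hopt.1 h1)
  have h4 := M.cost_sub_cost_of_cov_eq hopt.1 hs h1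
  have hS := nonneg_of_posDef hopt.1
  have hX0 : 0 ≤ M.sourceMatrix Sst :=
    (smul_nonneg hμ.le zero_le_one).trans (M.mu_smul_one_le_sourceMatrix hS)
  have h5 := trace_mul_mono_left hX0 (le_sub_comm.1 h2)
  have h6 := M.mu_mul_trace_le hS (M.decrement_nonneg Kst)
  have h7 : (M.decrement Kst).trace ≤ 0 := by
    by_contra h
    have := mul_pos hμ (not_le.1 h)
    linarith
  rw [← M.decrement_eq_zero_iff, ← norm_le_zero_iff]
  exact (norm_le_trace (M.decrement_nonneg Kst)).trans h7

theorem IsOptimal.cov_eq (hμ : 0 < M.mu) (hopt : M.IsOptimal Kst Sst) : Sst = M.bestCov Kst := by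
  have hs := IsOptimal.summable M hμ hopt
  exact (M.cost_bestCov_le hopt.1 hs).2 (hopt.2.2 Kst _ (M.bestCov_posDef Kst)
    (M.finiteCost_of_summable (M.bestCov_posDef Kst) hs))

/-- Optimality compares only traces against source matrices; this upgrades it to the Loewner order.
Finite cost of K does not make its closed loop stable, Q being only semidefinite, so policy
iteration from K is compared with the closed loop of K*. -/
theorem IsOptimal.valueMatrix_le (hμ : 0 < M.mu) (hopt : M.IsOptimal Kst Sst)
    (hstab : ‖M.A - M.B * Kst‖ ≤ 1) {K : Matrix (Fin k) (Fin n) ℝ}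
    (hK : Summable (M.valueMatrixTerm K)) : M.valueMatrix Kst ≤ M.valueMatrix K := by
  have hs := IsOptimal.summable M hμ hopt
  refine M.valueMatrix_le_of_policy_iteration (K := fun j => M.newton^[j] K) hK
    (fun j => Function.iterate_succ_apply' _ _ _) hs hstab hμ
    (M.mu_smul_one_le_sourceMatrix (nonneg_of_posDef hopt.1)) fun j hj => ?_
  have h1 := hopt.2.2 _ Sst hopt.1 (M.finiteCost_of_summable hopt.1 hj)
  have h2 := M.cost_sub_cost_of_cov_eq hopt.1 hj hs
  rw [Matrix.sub_mul, trace_sub] at h2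
  linarith

/-! ### One step of iterative policy optimization -/

section Step

variable {K : Matrix (Fin k) (Fin n) ℝ} {S : Matrix (Fin k) (Fin k) ℝ}

/-- Replacing K by K* at fixed Σ gains tr((P_K − P_{K*}) X_Σ), where X_Σ ≥ μ; the resulting policy
is still no better than the optimum. -/
theorem mu_mul_trace_sub_le_gap (hμ : 0 < M.mu) (hopt : M.IsOptimal Kst Sst)
    (hstab : ‖M.A - M.B * Kst‖ ≤ 1) (hS : S.PosDef) (hK : Summable (M.valueMatrixTerm K)) :
    M.mu * (M.valueMatrix K - M.valueMatrix Kst).trace ≤ M.cost K S - M.cost Kst Sst := by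
  have hs := IsOptimal.summable M hμ hopt
  have h1 := hopt.2.2 Kst S hS (M.finiteCost_of_summable hS hs)
  have h2 := M.cost_sub_cost_of_cov_eq hS hK hs
  have h3 := M.mu_mul_trace_le (nonneg_of_posDef hS)
    (sub_nonneg.2 (IsOptimal.valueMatrix_le M hμ hopt hstab hK))
  linarith

/-- The best covariance for K does at least as well as Σ*. At covariance Σ* the gap is a trace
against the source matrix, which duality moves to S*; the Lyapunov inequality for L = K* then
applies. -/
theorem gap_le (hμ : 0 < M.mu) (hopt : M.IsOptimal Kst Sst) {ρ : ℝ} (hρ1 : ρ < 1)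
    (hρ : ‖M.A - M.B * Kst‖ ≤ ρ) (hK : Summable (M.valueMatrixTerm K)) :
    M.cost K S - M.cost Kst Sst ≤ (M.decrement K * M.stateCorr Kst Sst).trace +
      (M.cost K S - M.cost K (M.bestCov K)) := by
  have hs := IsOptimal.summable M hμ hopt
  have hS := nonneg_of_posDef hopt.1
  have h1 := (M.cost_bestCov_le hopt.1 hK).1
  have h2 := M.cost_sub_cost_of_cov_eq hopt.1 hK hs
  rw [trace_mul_lyapunov (M.stateCorr_eq hS hρ1 hρ)] at h2
  have h3 := trace_mul_mono_left (M.stateCorr_nonneg hS hρ1 hρ)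
    (sub_le_iff_le_add.2 (M.valueMatrix_sub_le hK hs))
  linarith

/-- Only P_{K'} ≤ P_K − G_K and X_Σ ≥ μ enter, so the new closed loop need not be stable. This also
gives the monotonicity of the costs. -/
theorem cost_sub_newton_ge (hK : Summable (M.valueMatrixTerm K)) :
    M.mu * (M.decrement K).trace + (M.cost K S - M.cost K (M.bestCov K)) ≤
      M.cost K S - M.cost (M.newton K) (M.bestCov K) := by
  obtain ⟨h1, h2⟩ := M.newton_summable_and_le hK
  have hS := nonneg_of_posDef (M.bestCov_posDef K)
  have h3 := M.cost_sub_cost_of_cov_eq (M.bestCov_posDef K) hK h1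
  have hX0 : 0 ≤ M.sourceMatrix (M.bestCov K) :=
    add_nonneg M.D0_nonneg
      (smul_nonneg (div_nonneg M.γ_pos.le (by linarith [M.γ_lt_one])) (M.disturbance_nonneg hS))
  have h4 := trace_mul_mono_left hX0 (le_sub_comm.1 h2)
  have h5 := M.mu_mul_trace_le hS (M.decrement_nonneg K)
  linarith

theorem cost_sub_newton_eq {ρ : ℝ} (hρ1 : ρ < 1) (hρ : ‖M.A - M.B * M.newton K‖ ≤ ρ)
    (hK : Summable (M.valueMatrixTerm K)) :
    M.cost K S - M.cost (M.newton K) (M.bestCov K) =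
      (M.decrement K * M.stateCorr (M.newton K) (M.bestCov K)).trace +
        (M.cost K S - M.cost K (M.bestCov K)) := by
  obtain ⟨h1, h2⟩ := M.newton_summable_and_le hK
  have hS := nonneg_of_posDef (M.bestCov_posDef K)
  have h3 := M.cost_sub_cost_of_cov_eq (M.bestCov_posDef K) hK h1
  rw [trace_mul_lyapunov (M.stateCorr_eq hS hρ1 hρ)] at h3
  have h4 := M.valueMatrix_sub_newton hK
  rw [← sub_eq_iff_eq_add] at h4
  rw [h4] at h3
  linarith

theorem sourceMatrix_le_stateCorr {ρ : ℝ} (hS : 0 ≤ S) (hρ1 : ρ < 1)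
    (hρ : ‖M.A - M.B * K‖ ≤ ρ) : M.sourceMatrix S ≤ M.stateCorr K S := by
  conv_rhs => rw [M.stateCorr_eq hS hρ1 hρ]
  exact le_add_of_nonneg_right
    (smul_nonneg M.γ_pos.le (congr_nonneg' (M.stateCorr_nonneg hS hρ1 hρ) _))

/-- Linear convergence. -/
theorem gap_newton_le (hμ : 0 < M.mu) (hopt : M.IsOptimal Kst Sst) {ρ : ℝ} (hρ1 : ρ < 1)
    (hρ : ‖M.A - M.B * Kst‖ ≤ ρ) (hL : M.mu ≤ ‖M.stateCorr Kst Sst‖)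
    (hS : S.PosDef) (hK : Summable (M.valueMatrixTerm K)) :
    M.cost (M.newton K) (M.bestCov K) - M.cost Kst Sst ≤
      (1 - M.mu / ‖M.stateCorr Kst Sst‖) * (M.cost K S - M.cost Kst Sst) := by
  have h1 := M.gap_le (S := S) hμ hopt hρ1 hρ hK
  have h2 := M.cost_sub_newton_ge (S := S) hK
  have h3 := (M.cost_bestCov_le hS hK).1
  have hG := M.decrement_nonneg K
  have h4 := (abs_le.1 (abs_trace_mul_le hG (isHermitian_of_nonneg
    (M.stateCorr_nonneg (nonneg_of_posDef hopt.1) hρ1 hρ)))).2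
  set L := ‖M.stateCorr Kst Sst‖
  have hL0 : 0 < L := hμ.trans_le hL
  have h5 : M.mu / L ≤ 1 := (div_le_one hL0).2 hL
  have h6 : 0 < M.mu / L := div_pos hμ hL0
  have h7 : M.mu / L * (L * (M.decrement K).trace) = M.mu * (M.decrement K).trace := by
    field_simp
  -- With e the gain from the covariance alone, μ tr G ≥ (μ/L)(gap − e), and e ≥ 0 is absorbed
  -- because μ/L ≤ 1.
  nlinarith [mul_le_mul_of_nonneg_left (h1.trans (add_le_add_left h4 _)) h6.le,
    mul_le_mul_of_nonneg_right h5 (sub_nonneg.2 h3)]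

/-- The gap contracts by the relative change of the state correlation matrix. -/
theorem gap_newton_le_of_stable (hμ : 0 < M.mu) (hopt : M.IsOptimal Kst Sst) {ρ : ℝ}
    (hρ1 : ρ < 1) (hρ : ‖M.A - M.B * Kst‖ ≤ ρ) (hρ' : ‖M.A - M.B * M.newton K‖ ≤ ρ)
    (hm : 0 < sigmaMin (M.stateCorr Kst Sst)) (hS : S.PosDef)
    (hK : Summable (M.valueMatrixTerm K)) :
    M.cost (M.newton K) (M.bestCov K) - M.cost Kst Sst ≤
      ‖M.stateCorr (M.newton K) (M.bestCov K) - M.stateCorr Kst Sst‖ /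
        sigmaMin (M.stateCorr Kst Sst) * (M.cost K S - M.cost Kst Sst) := by
  have h1 := M.gap_le (S := S) hμ hopt hρ1 hρ hK
  have h2 := M.cost_sub_newton_eq (S := S) hρ1 hρ' hK
  have h3 := (M.cost_bestCov_le hS hK).1
  have hgap := hopt.2.2 K S hS (M.finiteCost_of_summable hS hK)
  have hmono := M.cost_sub_newton_ge (S := S) hK
  have hG := M.decrement_nonneg K
  have hGt := trace_nonneg_of_nonneg hG
  have hSc := M.stateCorr_nonneg (nonneg_of_posDef hopt.1) hρ1 hρ
  have hSc' := M.stateCorr_nonneg (nonneg_of_posDef (M.bestCov_posDef K)) hρ1 hρ'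
  have h4 := (abs_le.1 (abs_trace_mul_le hG
    ((isHermitian_of_nonneg hSc').sub (isHermitian_of_nonneg hSc)))).1
  rw [Matrix.mul_sub, trace_sub] at h4
  have h5 := trace_mul_mono hG (sigmaMin_smul_one_le hSc)
  rw [Matrix.mul_smul, Matrix.mul_one, trace_smul, smul_eq_mul] at h5
  set m := sigmaMin (M.stateCorr Kst Sst)
  set Δ := ‖M.stateCorr (M.newton K) (M.bestCov K) - M.stateCorr Kst Sst‖ with hΔ
  set r := Δ / m with hr
  have hr0 : 0 ≤ r := div_nonneg (norm_nonneg _) hm.le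
  have hΔr : Δ = r * m := by rw [hr]; field_simp
  -- For r ≤ 1, tr(G S') ≥ (1−r) tr(G S*) ≥ (1−r)(gap − e), with e the gain from the covariance
  -- alone. For r > 1 it suffices that the cost does not increase.
  rcases le_or_gt r 1 with hr1 | hr1
  · rw [hΔr] at h4
    nlinarith [mul_le_mul_of_nonneg_left h5 hr0, mul_nonneg hr0 (sub_nonneg.2 h3),
      mul_le_mul_of_nonneg_left h1 (sub_nonneg.2 hr1)]
  · nlinarith [mul_nonneg hμ.le hGt, mul_le_mul_of_nonneg_right hr1.le (sub_nonneg.2 hgap)]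

/-! ### Perturbation of the gain and of the covariance in one step -/

theorem hess_sub_hess (K L : Matrix (Fin k) (Fin n) ℝ) :
    M.hess K - M.hess L = M.γ • (M.Bᵀ * (M.valueMatrix K - M.valueMatrix L) * M.B) := by
  simp only [hess, Matrix.mul_sub, Matrix.sub_mul, smul_sub]
  abel

theorem norm_hess_inv_le (hk : 0 < k) (hμ : 0 < M.mu) (hopt : M.IsOptimal Kst Sst)
    (hstab : ‖M.A - M.B * Kst‖ ≤ 1) (hK : Summable (M.valueMatrixTerm K)) :
    ‖(M.hess K)⁻¹‖ ≤ (sigmaMin (M.hess Kst))⁻¹ := by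
  refine norm_inv_le (sigmaMin_pos_of_posDef hk (M.hess_posDef Kst)) ?_
  refine (sigmaMin_smul_one_le (M.hess_nonneg Kst)).trans ?_
  rw [← sub_nonneg, hess_sub_hess]
  exact smul_nonneg M.γ_pos.le (congr_nonneg
    (sub_nonneg.2 (IsOptimal.valueMatrix_le M hμ hopt hstab hK)) M.B)

/-- The Newton step converges quadratically in the gain. -/
theorem norm_mul_newton_sub_le (hk : 0 < k) (hμ : 0 < M.mu) (hopt : M.IsOptimal Kst Sst)
    {ρ : ℝ} (hρ1 : ρ < 1) (hρ : ‖M.A - M.B * Kst‖ ≤ ρ)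
    (hK : Summable (M.valueMatrixTerm K)) :
    ‖M.B * (M.newton K - Kst)‖ ≤ M.γ * ρ * (‖M.B‖ ^ 2 *
      ((sigmaMin (M.hess Kst))⁻¹ * ‖M.valueMatrix K - M.valueMatrix Kst‖)) := by
  have hγ := M.γ_pos
  have h1 := M.norm_hess_inv_le hk hμ hopt (hρ.trans hρ1.le) hK
  rw [M.newton_sub_of_gradE_eq_zero (IsOptimal.gradE_eq_zero M hμ hopt)]
  have h2 : ‖M.γ • (M.Bᵀ * (M.valueMatrix K - M.valueMatrix Kst) * (M.A - M.B * Kst))‖ ≤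
      M.γ * (‖M.B‖ * ‖M.valueMatrix K - M.valueMatrix Kst‖ * ρ) := by
    rw [norm_smul, Real.norm_eq_abs, abs_of_pos hγ]
    gcongr
    refine (l2_opNorm_mul _ _).trans ?_
    gcongr
    refine (l2_opNorm_mul _ _).trans ?_
    rw [norm_transpose]
  refine (l2_opNorm_mul _ _).trans ?_
  refine (mul_le_mul_of_nonneg_left (l2_opNorm_mul _ _) (norm_nonneg _)).trans ?_
  have hs0 : 0 ≤ (sigmaMin (M.hess Kst))⁻¹ := inv_nonneg.2 (sigmaMin_nonneg _)
  calc _ ≤ ‖M.B‖ * ((sigmaMin (M.hess Kst))⁻¹ *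
        (M.γ * (‖M.B‖ * ‖M.valueMatrix K - M.valueMatrix Kst‖ * ρ))) := by gcongr
    _ = _ := by ring

/-- The resolvent identity for H_K⁻¹ − H_{K*}⁻¹ keeps Σ* as a factor. The product BΣ*Bᵀ appears and
is dominated by the whole disturbance, as W ≥ 0; the bound is therefore relative. -/
theorem norm_disturbance_bestCov_sub_le (hk : 0 < k) (hμ : 0 < M.mu)
    (hopt : M.IsOptimal Kst Sst) (hstab : ‖M.A - M.B * Kst‖ ≤ 1)
    (hK : Summable (M.valueMatrixTerm K)) :
    ‖M.disturbance (M.bestCov K) - M.disturbance Sst‖ ≤ M.γ * (‖M.B‖ ^ 2 *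
      ((sigmaMin (M.hess Kst))⁻¹ * ‖M.valueMatrix K - M.valueMatrix Kst‖)) *
        ‖M.disturbance Sst‖ := by
  have hγ := M.γ_pos
  have h1 := M.norm_hess_inv_le hk hμ hopt hstab hK
  have hS := IsOptimal.cov_eq M hμ hopt
  have hN0 : 0 ≤ M.B * Sst * M.Bᵀ := congr_nonneg' (nonneg_of_posDef hopt.1) M.B
  have h2 : ‖M.B * Sst * M.Bᵀ‖ ≤ ‖M.disturbance Sst‖ :=
    norm_mono_of_nonneg hN0 (le_add_of_nonneg_right M.W_nonneg)
  set D := M.valueMatrix K - M.valueMatrix Kst with hD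
  have h3 : M.bestCov K - Sst = -(M.γ • ((M.hess K)⁻¹ * (M.Bᵀ * D * M.B) * Sst)) := by
    have h4 : (M.hess K)⁻¹ - (M.hess Kst)⁻¹ =
        -((M.hess K)⁻¹ * (M.hess K - M.hess Kst) * (M.hess Kst)⁻¹) := by
      rw [Matrix.mul_sub, Matrix.nonsing_inv_mul _ (M.isUnit_det_hess K), Matrix.sub_mul,
        Matrix.mul_assoc, Matrix.mul_nonsing_inv _ (M.isUnit_det_hess Kst)]
      simp
    rw [hS, bestCov, bestCov, ← smul_sub, h4, hess_sub_hess, ← hD]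
    simp only [Matrix.mul_smul, Matrix.smul_mul, smul_neg]
    rw [smul_comm]
  have h5 : M.disturbance (M.bestCov K) - M.disturbance Sst =
      -(M.γ • (M.B * (M.hess K)⁻¹ * M.Bᵀ * D * (M.B * Sst * M.Bᵀ))) := by
    have h6 : M.disturbance (M.bestCov K) - M.disturbance Sst =
        M.B * (M.bestCov K - Sst) * M.Bᵀ := by
      simp only [disturbance, Matrix.mul_sub, Matrix.sub_mul]
      abel
    rw [h6, h3]
    simp only [Matrix.mul_neg, Matrix.neg_mul, Matrix.mul_smul, Matrix.smul_mul, Matrix.mul_assoc]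
  have hs0 : 0 ≤ (sigmaMin (M.hess Kst))⁻¹ := inv_nonneg.2 (sigmaMin_nonneg _)
  have h7 : ‖M.B * (M.hess K)⁻¹ * M.Bᵀ‖ ≤ ‖M.B‖ * (sigmaMin (M.hess Kst))⁻¹ * ‖M.B‖ := by
    refine (l2_opNorm_mul _ _).trans ?_
    rw [norm_transpose]
    gcongr
    exact (l2_opNorm_mul _ _).trans (by gcongr)
  rw [h5, norm_neg, norm_smul, Real.norm_eq_abs, abs_of_pos hγ]
  refine (mul_le_mul_of_nonneg_left ?_ hγ.le).trans_eq (mul_assoc _ _ _).symm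
  calc _ ≤ ‖M.B * (M.hess K)⁻¹ * M.Bᵀ‖ * ‖D‖ * ‖M.B * Sst * M.Bᵀ‖ :=
        (norm_mul_le _ _).trans (mul_le_mul_of_nonneg_right (norm_mul_le _ _) (norm_nonneg _))
    _ ≤ ‖M.B‖ * (sigmaMin (M.hess Kst))⁻¹ * ‖M.B‖ * ‖D‖ * ‖M.disturbance Sst‖ := by gcongr
    _ = _ := by ring

end Step

end Model

/-! ### Local superlinear convergence -/

section Scalar

variable {g r y q d ν L E e h : ℝ}

/-- Dictionary for the scalar lemmas: g = γ, r = ρ, y is ‖B‖ times the normalised root of the gap, d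
= ‖D₀‖, ν = ‖BΣ*Bᵀ + W‖, L = ‖S*‖, q = 1 − μ/L, E = 1 − ρ², e = 1 − γρ², h = γν/(1−γ). -/
theorem initial_part_le (hg0 : 0 < g) (hg1 : g < 1) (hr0 : 0 < r) (hy : 0 ≤ y)
    (hyq : 2 * r * y ≤ 1) (hd : 0 ≤ d) (he : 0 < e) :
    2 * r ^ 2 * g ^ 2 * y * d / e ^ 2 ≤ 2 * r * (g * d / e ^ 2) := by
  rw [← mul_div_assoc]
  gcongr ?_ / _
  have h1 : g * (r * y) ≤ 1 * 1 := by
    have : r * y ≤ 1 := by nlinarith [mul_nonneg hr0.le hy]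
    gcongr
  calc _ = 2 * r * (g * d) * (g * (r * y)) := by ring
    _ ≤ 2 * r * (g * d) * (1 * 1) := by gcongr
    _ = _ := by ring

theorem noise_part_le (hg0 : 0 < g) (hg1 : g < 1) (hr0 : 0 < r) (hy : 0 ≤ y)
    (hyr : y ≤ 2 * r) (hyq : 2 * r * y ≤ 1) (hν : 0 ≤ ν) (hE : 0 < E) (hEe : E ≤ e) (hh : 0 ≤ h)
    (hhν : h ≤ ν / (1 - g)) :
    g * y * h / e + 2 * r ^ 2 * g ^ 2 * y * h / e ^ 2 ≤
      2 * r * ((1 + E) / (E ^ 2 * (1 - g)) * ν) := by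
  have h1g : 0 < 1 - g := by linarith
  have he : 0 < e := hE.trans_le hEe
  have h1 : g * y / e ≤ 2 * r / E := by
    refine div_le_div₀ (by positivity) ?_ hE hEe
    calc g * y ≤ 1 * (2 * r) := by gcongr
      _ = _ := one_mul _
  have h2 : 2 * r ^ 2 * g ^ 2 * y / e ^ 2 ≤ r / E ^ 2 := by
    refine div_le_div₀ hr0.le ?_ (by positivity) (by gcongr)
    have hgg : g ^ 2 ≤ 1 := by nlinarith
    calc 2 * r ^ 2 * g ^ 2 * y = r * ((2 * r * y) * g ^ 2) := by ring
      _ ≤ r * (1 * 1) := by gcongr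
      _ = r := by ring
  have h3 : 2 * r / E + r / E ^ 2 ≤ 2 * r * (1 + E) / E ^ 2 := by
    have h4 : 2 * r / E = 2 * r * E / E ^ 2 := by
      field_simp
    rw [h4, ← add_div]
    gcongr
    linarith
  have h5 : 0 ≤ ν / (1 - g) := by positivity
  calc g * y * h / e + 2 * r ^ 2 * g ^ 2 * y * h / e ^ 2
      = (g * y / e + 2 * r ^ 2 * g ^ 2 * y / e ^ 2) * h := by ring
    _ ≤ (2 * r * (1 + E) / E ^ 2) * (ν / (1 - g)) :=
      mul_le_mul ((add_le_add h1 h2).trans h3) hhν hh (by positivity)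
    _ = _ := by field_simp

/-- For q ≤ 1/4 the noise is a small part of the source, h ≤ qL ≤ (4/3)qd, and qy ≤ r/2. So the
noise terms can be charged to d. -/
theorem small_ratio_le (hg0 : 0 < g) (hg1 : g < 1) (hr0 : 0 < r) (hy : 0 ≤ y)
    (hyq : 2 * r * y ≤ q) (hq0 : 0 ≤ q) (hq : q ≤ 1 / 4) (hqy : q * y ^ 2 ≤ r ^ 2) (hd : 0 ≤ d)
    (hL : (1 - q) * L ≤ d) (he : 0 < e) (he1 : e ≤ 1) (hh : 0 ≤ h) (hhL : h ≤ q * L) :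
    g * y * h / e + 2 * r ^ 2 * g ^ 2 * y * (d + h) / e ^ 2 ≤ r * (g * d / e ^ 2) := by
  have hLd : L ≤ 4 / 3 * d := by
    rcases le_or_gt L 0 with h0 | h0
    · linarith
    · nlinarith
  have hhd : h ≤ q * (4 / 3 * d) := hhL.trans (mul_le_mul_of_nonneg_left hLd hq0)
  have hqy2 : q * y ≤ r / 2 := by
    refine (sq_le_sq₀ (mul_nonneg hq0 hy) (by positivity)).1 ?_
    calc (q * y) ^ 2 = q * (q * y ^ 2) := by ring
      _ ≤ 1 / 4 * r ^ 2 := by gcongr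
      _ = _ := by ring
  have hyh : y * h ≤ 2 / 3 * (r * d) := by
    calc y * h ≤ y * (q * (4 / 3 * d)) := by gcongr
      _ = (q * y) * (4 / 3 * d) := by ring
      _ ≤ (r / 2) * (4 / 3 * d) := by gcongr
      _ = _ := by ring
  have h1 : g * y * h / e ≤ 2 / 3 * (r * (g * d / e ^ 2)) := by
    calc g * y * h / e = g * (y * h) * e / e ^ 2 := by field_simp
      _ ≤ g * (2 / 3 * (r * d)) * 1 / e ^ 2 := by gcongr
      _ = _ := by ring
  have h2 : 2 * r ^ 2 * g ^ 2 * y * (d + h) / e ^ 2 ≤ 1 / 3 * (r * (g * d / e ^ 2)) := by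
    have h3 : d + h ≤ 4 / 3 * d := by nlinarith
    have h4 : 2 * r * y * g ≤ 1 / 4 * 1 := by
      have : 2 * r * y ≤ 1 / 4 := hyq.trans hq
      gcongr
    calc 2 * r ^ 2 * g ^ 2 * y * (d + h) / e ^ 2
        = r * g * ((2 * r * y * g) * (d + h)) / e ^ 2 := by ring
      _ ≤ r * g * ((1 / 4 * 1) * (4 / 3 * d)) / e ^ 2 := by gcongr
      _ = _ := by ring
  linarith

/-- The left side is of order y², the right side of order y, so one factor y must be absorbed. If q
≥ 1/4, then qy² ≤ r² gives y ≤ 2r, and the d and ν parts are bounded separately. If q < 1/4, then y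
may exceed 2r, but the noise is small compared with d. -/
theorem perturbation_bound (hg0 : 0 < g) (hg1 : g < 1) (hr0 : 0 < r)
    (hr1 : r < 1) (hy : 0 ≤ y) (hyq : 2 * r * y ≤ q) (hq1 : q ≤ 1) (hqy : q * y ^ 2 ≤ r ^ 2)
    (hd : 0 ≤ d) (hν : 0 ≤ ν) (hL : (1 - q) * L ≤ d) (hνL : g / (1 - g) * ν ≤ q * L) :
    (g / (1 - g) * (g * y ^ 2 * ν) + g * (2 * r * (g * r * y ^ 2) *
        ((d + g / (1 - g) * ν) / (1 - g * r ^ 2)))) / (1 - g * r ^ 2) ≤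
      2 * r * y * ((1 - g * r ^ 2 + g) / (1 - g * r ^ 2) ^ 2 * d +
        ((2 - r ^ 2) / ((1 - r ^ 2) ^ 2 * (1 - g)) + 1 / ((1 - r ^ 2) ^ 2 * (1 - g * r ^ 2))) *
          ν) := by
  have hr2 : r ^ 2 < 1 := by nlinarith
  have hE : 0 < 1 - r ^ 2 := by linarith
  have hEe : 1 - r ^ 2 ≤ 1 - g * r ^ 2 := by nlinarith [sq_nonneg r]
  have he : 0 < 1 - g * r ^ 2 := hE.trans_le hEe
  have he1 : 1 - g * r ^ 2 ≤ 1 := by nlinarith [sq_nonneg r]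
  have h1g : 0 < 1 - g := by linarith
  have hq0 : 0 ≤ q := le_trans (by positivity) hyq
  have hEE : 2 - r ^ 2 = 1 + (1 - r ^ 2) := by ring
  have hgh : g / (1 - g) * (g * y ^ 2 * ν) = g * y ^ 2 * (g / (1 - g) * ν) := by ring
  rw [hEE, hgh]
  generalize 1 - r ^ 2 = E at *
  generalize 1 - g * r ^ 2 = e at *
  have hh0 : 0 ≤ g / (1 - g) * ν := by positivity
  have hhν : g / (1 - g) * ν ≤ ν / (1 - g) := by
    rw [div_mul_eq_mul_div]
    exact div_le_div_of_nonneg_right (mul_le_of_le_one_left hν hg1.le) h1g.le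
  generalize g / (1 - g) * ν = h at *
  have hξ : r * (2 * (g * d / e ^ 2)) ≤ r * (2 * ((e + g) / e ^ 2 * d)) := by
    have : g * d / e ^ 2 ≤ (e + g) / e ^ 2 * d := by
      rw [div_mul_eq_mul_div]
      gcongr
      linarith
    gcongr
  have hζ : r * (2 * ((1 + E) / (E ^ 2 * (1 - g)) * ν)) ≤
      r * (2 * (((1 + E) / (E ^ 2 * (1 - g)) + 1 / (E ^ 2 * e)) * ν)) := by
    have : (1 + E) / (E ^ 2 * (1 - g)) ≤ (1 + E) / (E ^ 2 * (1 - g)) + 1 / (E ^ 2 * e) :=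
      le_add_of_nonneg_right (by positivity)
    gcongr
  have hζ0 : 0 ≤ r * (2 * (((1 + E) / (E ^ 2 * (1 - g)) + 1 / (E ^ 2 * e)) * ν)) := by
    positivity
  have hd0 : 0 ≤ r * (g * d / e ^ 2) := by positivity
  have key : g * y * h / e + 2 * r ^ 2 * g ^ 2 * y * (d + h) / e ^ 2 ≤
      2 * r * ((e + g) / e ^ 2 * d + ((1 + E) / (E ^ 2 * (1 - g)) + 1 / (E ^ 2 * e)) * ν) := by
    rcases le_or_gt (1 / 4) q with hq | hq
    · have hy2 : y ≤ 2 * r := by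
        refine (sq_le_sq₀ hy (by positivity)).1 ?_
        nlinarith [sq_nonneg y]
      have h1 := initial_part_le hg0 hg1 hr0 hy (hyq.trans hq1) hd he
      have h2 := noise_part_le hg0 hg1 hr0 hy hy2 (hyq.trans hq1) hν hE hEe hh0 hhν
      rw [mul_add (2 * r ^ 2 * g ^ 2 * y), add_div]
      linarith
    · have h1 := small_ratio_le hg0 hg1 hr0 hy hyq hq0 hq.le hqy hd hL he he1 hh0 hνL
      linarith
  calc _ = y * (g * y * h / e + 2 * r ^ 2 * g ^ 2 * y * (d + h) / e ^ 2) := by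
        field_simp
    _ ≤ _ := (mul_le_mul_of_nonneg_left key hy).trans_eq (by ring)

/-- Compare squares: (g r y²)² = (g r y)² y² with (g r y)² ≤ r y ≤ q. The left side bounds the
displacement of the closed-loop matrix, and a is the margin ρ − ‖A − BK*‖. -/
theorem step_le_margin {g r y q a : ℝ} (hg0 : 0 < g) (hg1 : g < 1) (hr0 : 0 < r) (hy : 0 ≤ y)
    (hyq : 2 * r * y ≤ q) (hq1 : q ≤ 1) (ha : 0 ≤ a) (hqy : q * y ^ 2 ≤ a ^ 2) :
    g * r * y ^ 2 ≤ a := by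
  refine (sq_le_sq₀ (by positivity) ha).1 (le_trans ?_ hqy)
  have h0 : 0 ≤ r * y := by positivity
  have h1 : r * y ≤ 1 := by linarith
  have h2 : g ^ 2 * (r * y) ^ 2 ≤ q := by
    calc g ^ 2 * (r * y) ^ 2 ≤ 1 ^ 2 * ((r * y) * 1) := by
          rw [sq (r * y)]
          gcongr
      _ ≤ q := by linarith
  calc (g * r * y ^ 2) ^ 2 = (g ^ 2 * (r * y) ^ 2) * y ^ 2 := by ring
    _ ≤ q * y ^ 2 := by gcongr

end Scalar

namespace Model

variable {n k : ℕ} (M : Model n k) {Kst : Matrix (Fin k) (Fin n) ℝ}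
  {Sst : Matrix (Fin k) (Fin k) ℝ} {ρ : ℝ}

/-! ### Signs and sizes of the constants -/

theorem one_sub_mul_sq_pos (hρ0 : 0 < ρ) (hρ1 : ρ < 1) : 0 < 1 - M.γ * ρ ^ 2 := by
  have h1 : ρ ^ 2 < 1 := by nlinarith
  nlinarith [M.γ_lt_one, M.γ_pos, sq_nonneg ρ]

theorem xi_pos (hρ0 : 0 < ρ) (hρ1 : ρ < 1) : 0 < M.xi ρ := by
  have := M.one_sub_mul_sq_pos hρ0 hρ1
  have := M.γ_pos
  rw [xi]
  positivity

theorem zeta_nonneg (hρ0 : 0 < ρ) (hρ1 : ρ < 1) : 0 ≤ M.zeta ρ := by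
  have := M.one_sub_mul_sq_pos hρ0 hρ1
  have h1 : ρ ^ 2 < 1 := by nlinarith
  have h2 : 0 < 1 - ρ ^ 2 := by linarith
  have h3 : 0 < 2 - ρ ^ 2 := by linarith
  have h4 : 0 < 1 - M.γ := by linarith [M.γ_lt_one]
  rw [zeta]
  positivity

theorem omega_nonneg (hρ0 : 0 < ρ) (hρ1 : ρ < 1) : 0 ≤ M.omega ρ := by
  have := M.one_sub_mul_sq_pos hρ0 hρ1
  have h1 : ρ ^ 2 < 1 := by nlinarith
  have h2 : 0 < 1 - ρ ^ 2 := by linarith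
  have h4 : 0 < 1 - M.γ := by linarith [M.γ_lt_one]
  rw [omega]
  positivity

theorem kappa_nonneg (hρ0 : 0 < ρ) : 0 ≤ M.kappa ρ :=
  div_nonneg (by positivity) (sigmaMin_nonneg _)

theorem c_nonneg (hμ : 0 < M.mu) (hρ0 : 0 < ρ) (hρ1 : ρ < 1) : 0 ≤ M.c ρ Kst Sst := by
  have := (M.xi_pos hρ0 hρ1).le
  have := M.kappa_nonneg hρ0
  rw [c]
  positivity

theorem c₂_nonneg (hμ : 0 < M.mu) (hρ0 : 0 < ρ) (hρ1 : ρ < 1) : 0 ≤ M.c₂ ρ Kst Sst := by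
  have := M.c_nonneg (Kst := Kst) (Sst := Sst) hμ hρ0 hρ1
  have := M.omega_nonneg hρ0 hρ1
  have := M.τ_pos
  have := M.γ_pos
  rw [c₂]
  positivity

theorem le_c₁ (hμ : 0 < M.mu) (hρ0 : 0 < ρ) (hρ1 : ρ < 1) :
    (M.xi ρ * ‖M.D0‖ + M.zeta ρ * ‖M.disturbance Sst‖) * (2 * ρ * ‖M.B‖) ≤ M.c₁ ρ Kst Sst := by
  have := (M.xi_pos hρ0 hρ1).le
  have := M.zeta_nonneg hρ0 hρ1
  have := M.kappa_nonneg hρ0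
  have := M.c_nonneg (Kst := Kst) (Sst := Sst) hμ hρ0 hρ1
  have := M.γ_pos
  have h1 := sigmaMin_nonneg M.R
  refine le_mul_of_one_le_right (by positivity) ?_
  rw [add_assoc]
  exact le_add_of_nonneg_right (by positivity)

theorem le_xi (hρ0 : 0 < ρ) (hρ1 : ρ < 1) : 1 / (1 - M.γ * ρ ^ 2) ≤ M.xi ρ := by
  have h := M.one_sub_mul_sq_pos hρ0 hρ1
  rw [xi, div_le_div_iff₀ h (by positivity)]
  nlinarith [mul_pos M.γ_pos h]

theorem le_zeta (hρ0 : 0 < ρ) (hρ1 : ρ < 1) :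
    M.γ / (1 - M.γ) / (1 - M.γ * ρ ^ 2) ≤ M.zeta ρ := by
  have h := M.one_sub_mul_sq_pos hρ0 hρ1
  have hγ := M.γ_pos
  have hγ1 := M.γ_lt_one
  have h1γ : 0 < 1 - M.γ := by linarith
  have h1 : ρ ^ 2 < 1 := by nlinarith
  have hE : 0 < 1 - ρ ^ 2 := by linarith
  have hEe : 1 - ρ ^ 2 ≤ 1 - M.γ * ρ ^ 2 := by nlinarith [sq_nonneg ρ]
  have hE1 : 1 - ρ ^ 2 ≤ 1 := by nlinarith [sq_nonneg ρ]
  have h2 : M.γ / (1 - M.γ) / (1 - M.γ * ρ ^ 2) ≤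
      (2 - ρ ^ 2) / ((1 - ρ ^ 2) ^ 2 * (1 - M.γ)) := by
    rw [div_div, mul_comm (1 - M.γ)]
    refine div_le_div₀ (by linarith) (by linarith) (by positivity) ?_
    gcongr
    nlinarith
  refine h2.trans (le_add_of_nonneg_right (by positivity))

/-- D₀ ≥ μ already uses up μ of the bound X_{Σ*} ≤ S* ≤ ‖S*‖, which leaves ‖S*‖ − μ for the noise.
-/
theorem disturbance_norm_le (hS : 0 ≤ Sst) (hρ1 : ρ < 1)
    (hρ : ‖M.A - M.B * Kst‖ ≤ ρ) (hL : M.mu ≤ ‖M.stateCorr Kst Sst‖) :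
    M.γ / (1 - M.γ) * ‖M.disturbance Sst‖ ≤ ‖M.stateCorr Kst Sst‖ - M.mu := by
  have hγ := M.γ_pos
  have h1γ : 0 < 1 - M.γ := by linarith [M.γ_lt_one]
  have hg : 0 ≤ M.γ / (1 - M.γ) := by positivity
  have h1 : M.sourceMatrix Sst ≤ ‖M.stateCorr Kst Sst‖ • 1 :=
    (M.sourceMatrix_le_stateCorr hS hρ1 hρ).trans
      (le_norm_smul_one (isHermitian_of_nonneg (M.stateCorr_nonneg hS hρ1 hρ)))
  have h2 : (M.γ / (1 - M.γ)) • M.disturbance Sst ≤ (‖M.stateCorr Kst Sst‖ - M.mu) • 1 := by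
    rw [sub_smul]
    refine le_sub_iff_add_le'.2 (le_trans ?_ h1)
    exact add_le_add_left M.mu_smul_one_le_D0 _
  have h3 := norm_le_of_le_smul_one (smul_nonneg hg (M.disturbance_nonneg hS))
    (sub_nonneg.2 hL) h2
  rwa [norm_smul, Real.norm_eq_abs, abs_of_nonneg hg] at h3

theorem norm_sourceMatrix_le (S : Matrix (Fin k) (Fin k) ℝ) :
    ‖M.sourceMatrix S‖ ≤ ‖M.D0‖ + M.γ / (1 - M.γ) * ‖M.disturbance S‖ := by
  have hg : 0 ≤ M.γ / (1 - M.γ) := div_nonneg M.γ_pos.le (by linarith [M.γ_lt_one])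
  refine (norm_add_le _ _).trans_eq ?_
  rw [norm_smul, Real.norm_eq_abs, abs_of_nonneg hg]

theorem norm_stateCorr_le (hS : 0 ≤ Sst) (hρ0 : 0 < ρ) (hρ1 : ρ < 1)
    (hρ : ‖M.A - M.B * Kst‖ ≤ ρ) :
    ‖M.stateCorr Kst Sst‖ ≤ M.xi ρ * ‖M.D0‖ + M.zeta ρ * ‖M.disturbance Sst‖ := by
  have he := M.one_sub_mul_sq_pos hρ0 hρ1
  refine (norm_le_of_lyapunov M.γ_pos.le (by linarith) hρ
    (M.stateCorr_eq hS hρ1 hρ)).trans ?_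
  calc _ ≤ (‖M.D0‖ + M.γ / (1 - M.γ) * ‖M.disturbance Sst‖) / (1 - M.γ * ρ ^ 2) := by
        gcongr
        exact M.norm_sourceMatrix_le Sst
    _ = 1 / (1 - M.γ * ρ ^ 2) * ‖M.D0‖ +
        M.γ / (1 - M.γ) / (1 - M.γ * ρ ^ 2) * ‖M.disturbance Sst‖ := by ring
    _ ≤ _ := by
        gcongr
        · exact M.le_xi hρ0 hρ1
        · exact M.le_zeta hρ0 hρ1

/-- Perturbation of the state correlation matrix under one step, when the value matrix is within
`y²` of the optimal one in the scale `‖B‖⁻² σ_min(R + γ Bᵀ P_* B)`. -/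
theorem norm_stateCorr_newton_sub_le (hn : 0 < n) (hk : 0 < k) (hμ : 0 < M.mu)
    (hopt : M.IsOptimal Kst Sst) (hρ0 : 0 < ρ) (hρ1 : ρ < 1) (hρ : ‖M.A - M.B * Kst‖ ≤ ρ)
    (hL : M.mu ≤ ‖M.stateCorr Kst Sst‖) {K : Matrix (Fin k) (Fin n) ℝ}
    (hK : Summable (M.valueMatrixTerm K)) {y : ℝ} (hy0 : 0 ≤ y)
    (hy : ‖M.B‖ ^ 2 * ((sigmaMin (M.hess Kst))⁻¹ * ‖M.valueMatrix K - M.valueMatrix Kst‖) ≤ y ^ 2)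
    (hyq : 2 * ρ * y ≤ 1 - M.mu / ‖M.stateCorr Kst Sst‖)
    (hqy : (1 - M.mu / ‖M.stateCorr Kst Sst‖) * y ^ 2 ≤ ρ ^ 2)
    (hρ' : ‖M.A - M.B * M.newton K‖ ≤ ρ) :
    ‖M.stateCorr (M.newton K) (M.bestCov K) - M.stateCorr Kst Sst‖ ≤
      2 * ρ * y * (M.xi ρ * ‖M.D0‖ + M.zeta ρ * ‖M.disturbance Sst‖) := by
  have hγ := M.γ_pos
  have h1γ : 0 < 1 - M.γ := by linarith [M.γ_lt_one]
  have hg : 0 ≤ M.γ / (1 - M.γ) := by positivity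
  have he := M.one_sub_mul_sq_pos hρ0 hρ1
  have hL0 : 0 < ‖M.stateCorr Kst Sst‖ := hμ.trans_le hL
  have hS := nonneg_of_posDef hopt.1
  have hS' := nonneg_of_posDef (M.bestCov_posDef K)
  have hF : ‖(M.A - M.B * M.newton K) - (M.A - M.B * Kst)‖ ≤ M.γ * ρ * y ^ 2 := by
    have e1 : (M.A - M.B * M.newton K) - (M.A - M.B * Kst) = -(M.B * (M.newton K - Kst)) := by
      rw [Matrix.mul_sub]
      abel
    rw [e1, norm_neg]
    exact (M.norm_mul_newton_sub_le hk hμ hopt hρ1 hρ hK).trans (by gcongr)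
  have hX : ‖M.sourceMatrix (M.bestCov K) - M.sourceMatrix Sst‖ ≤
      M.γ / (1 - M.γ) * (M.γ * y ^ 2 * ‖M.disturbance Sst‖) := by
    have e1 : M.sourceMatrix (M.bestCov K) - M.sourceMatrix Sst =
        (M.γ / (1 - M.γ)) • (M.disturbance (M.bestCov K) - M.disturbance Sst) := by
      rw [sourceMatrix, sourceMatrix, smul_sub]
      abel
    rw [e1, norm_smul, Real.norm_eq_abs, abs_of_nonneg hg]
    gcongr
    exact (M.norm_disturbance_bestCov_sub_le hk hμ hopt (hρ.trans hρ1.le) hK).trans (by gcongr)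
  have h1 := norm_lyapunov_sub_le hγ.le (by linarith) hρ hρ' (M.stateCorr_eq hS hρ1 hρ)
    (M.stateCorr_eq hS' hρ1 hρ')
  have hX0 := M.norm_sourceMatrix_le Sst
  have hd : M.mu ≤ ‖M.D0‖ := sigmaMin_le_norm hn M.D0_nonneg
  refine (h1.trans ?_).trans (perturbation_bound (L := ‖M.stateCorr Kst Sst‖) hγ M.γ_lt_one hρ0
    hρ1 hy0 hyq (sub_le_self _ (by positivity)) hqy (norm_nonneg _) (norm_nonneg _) ?_ ?_)
  · gcongr
  · refine le_trans (le_of_eq ?_) hd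
    field_simp
    ring
  · refine (M.disturbance_norm_le hS hρ1 hρ hL).trans_eq ?_
    field_simp

theorem gap_step (hμ : 0 < M.mu) (hB : 0 < sigmaMin M.B) (hopt : M.IsOptimal Kst Sst)
    (hρ0 : 0 < ρ) (hρ1 : ρ < 1) (hρ : ‖M.A - M.B * Kst‖ ≤ ρ)
    {K : Matrix (Fin k) (Fin n) ℝ} {S : Matrix (Fin k) (Fin k) ℝ} (hS : S.PosDef)
    (hK : Summable (M.valueMatrixTerm K))
    (hgap : M.cost K S - M.cost Kst Sst ≤ (1 / M.mu - 1 / ‖M.stateCorr Kst Sst‖)⁻¹ *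
      sigmaMin (M.hess Kst) * M.delta ρ Kst Sst ^ 2) :
    M.cost (M.newton K) (M.bestCov K) - M.cost Kst Sst ≤
      (M.c₁ ρ Kst Sst + M.c₂ ρ Kst Sst) * (M.cost K S - M.cost Kst Sst) ^ (3 / 2 : ℝ) /
        (sigmaMin (M.stateCorr Kst Sst) * √(M.mu * sigmaMin (M.hess Kst))) := by
  have hn : 0 < n := sigmaMin_pos_left hB
  have hk : 0 < k := sigmaMin_pos_right hB
  have hγ := M.γ_pos
  have hSst := nonneg_of_posDef hopt.1
  have hSc := M.stateCorr_nonneg hSst hρ1 hρ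
  have hm : M.mu ≤ sigmaMin (M.stateCorr Kst Sst) := le_sigmaMin hn
    ((M.mu_smul_one_le_sourceMatrix hSst).trans (M.sourceMatrix_le_stateCorr hSst hρ1 hρ))
  have hm0 := hμ.trans_le hm
  have hmL := sigmaMin_le_norm hn hSc
  have hL := hm.trans hmL
  have hL0 := hμ.trans_le hL
  have hLT := M.norm_stateCorr_le hSst hρ0 hρ1 hρ
  have hb : 0 < ‖M.B‖ := norm_pos_iff.2 (sigmaMin_pos_ne_zero hB)
  have hs : 0 < sigmaMin (M.hess Kst) := sigmaMin_pos_of_posDef hk (M.hess_posDef Kst)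
  have hc : (M.xi ρ * ‖M.D0‖ + M.zeta ρ * ‖M.disturbance Sst‖) * (2 * ρ * ‖M.B‖) ≤
      M.c₁ ρ Kst Sst + M.c₂ ρ Kst Sst :=
    (M.le_c₁ hμ hρ0 hρ1).trans (le_add_of_nonneg_right (M.c₂_nonneg hμ hρ0 hρ1))
  have hgap0 : 0 ≤ M.cost K S - M.cost Kst Sst :=
    sub_nonneg.2 (hopt.2.2 K S hS (M.finiteCost_of_summable hS hK))
  have hD0 := sub_nonneg.2 (IsOptimal.valueMatrix_le M hμ hopt (hρ.trans hρ1.le) hK)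
  have htr := M.mu_mul_trace_sub_le_gap hμ hopt (hρ.trans hρ1.le) hS hK
  have hDtr := norm_le_trace hD0
  have hlin := M.gap_newton_le hμ hopt hρ1 hρ hL hS hK
  have hsup := fun h => M.gap_newton_le_of_stable hμ hopt hρ1 hρ h hm0 hS hK
  have hpert := fun y => M.norm_stateCorr_newton_sub_le (y := y) hn hk hμ hopt hρ0 hρ1 hρ hL hK
  have hnewt := M.norm_mul_newton_sub_le hk hμ hopt hρ1 hρ hK
  have hδ : M.delta ρ Kst Sst * ‖M.B‖ ≤ ρ - ‖M.A - M.B * Kst‖ := by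
    rw [← le_div_iff₀ hb]
    exact min_le_right _ _
  set T := M.xi ρ * ‖M.D0‖ + M.zeta ρ * ‖M.disturbance Sst‖
  set C := M.c₁ ρ Kst Sst + M.c₂ ρ Kst Sst
  set G := M.cost K S - M.cost Kst Sst
  set s := sigmaMin (M.hess Kst)
  set m := sigmaMin (M.stateCorr Kst Sst)
  set L := ‖M.stateCorr Kst Sst‖
  set D := M.valueMatrix K - M.valueMatrix Kst
  set q := 1 - M.mu / L with hq
  have hT : 0 < T := hL0.trans_le hLT
  have hC : 0 < C := lt_of_lt_of_le (by positivity) hc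
  have hδ0 : 0 ≤ M.delta ρ Kst Sst := le_min (mul_nonneg (one_div_nonneg.2 hC.le) hm0.le)
    (div_nonneg (sub_nonneg.2 hρ) hb.le)
  -- Normalised so that the value matrix error is at most s·ε² and the claimed bound reads
  -- (C/m)·ε·G.
  obtain ⟨ε, hε⟩ : ∃ ε, ε = √(G / (M.mu * s)) := ⟨_, rfl⟩
  have hε0 : 0 ≤ ε := hε ▸ Real.sqrt_nonneg _
  have hεG : G = M.mu * s * ε ^ 2 := by
    rw [hε, Real.sq_sqrt (by positivity)]
    field_simp
  have hrhs : C * G ^ (3 / 2 : ℝ) / (m * √(M.mu * s)) = C / m * ε * G := by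
    have h32 : G ^ (3 / 2 : ℝ) = G * √G := by
      rw [show (3 / 2 : ℝ) = 1 + 1 / 2 by norm_num, Real.rpow_add_of_nonneg hgap0 one_pos.le
        (by norm_num), Real.rpow_one, Real.sqrt_eq_rpow]
    rw [h32, hε, Real.sqrt_div hgap0]
    field_simp
  rw [hrhs]
  -- For a large gap the linear rate is already good enough. This case contains q = 0, where the
  -- inverse in the hypothesis on the gap has the default value 0.
  rcases le_or_gt q (C / m * ε) with hcase | hcase
  · exact hlin.trans (mul_le_mul_of_nonneg_right hcase hgap0)
  have hCm : C * ε < q * m := by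
    rw [div_mul_eq_mul_div, div_lt_iff₀ hm0] at hcase
    exact hcase
  have hq0 : 0 < q := by
    by_contra h
    have := mul_nonneg hC.le hε0
    nlinarith
  -- C is at least 2ρ‖B‖T, and Cε < qm with m ≤ L ≤ T; the factor T cancels.
  have hyq : 2 * ρ * (‖M.B‖ * ε) ≤ q := by
    have h1 : T * (2 * ρ * ‖M.B‖) * ε ≤ q * T :=
      (mul_le_mul_of_nonneg_right hc hε0).trans (hCm.le.trans (by gcongr; exact hmL.trans hLT))
    refine le_of_mul_le_mul_left ?_ hT
    linarith
  -- The coefficient (1/μ − 1/L)⁻¹ equals μ/q, so the hypothesis on the gap bounds qε² rather than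
  -- ε².
  have hεδ : q * ε ^ 2 ≤ M.delta ρ Kst Sst ^ 2 := by
    have h1 : (1 / M.mu - 1 / L)⁻¹ = M.mu / q := by
      have h2 : 1 / M.mu - 1 / L = q / M.mu := by
        rw [hq]
        field_simp
      rw [h2, inv_div]
    rw [h1, hεG, div_mul_eq_mul_div, div_mul_eq_mul_div, le_div_iff₀ hq0] at hgap
    refine le_of_mul_le_mul_left ?_ (mul_pos hμ hs)
    linarith
  have hqy : q * (‖M.B‖ * ε) ^ 2 ≤ (ρ - ‖M.A - M.B * Kst‖) ^ 2 := by
    calc q * (‖M.B‖ * ε) ^ 2 = q * ε ^ 2 * ‖M.B‖ ^ 2 := by ring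
      _ ≤ M.delta ρ Kst Sst ^ 2 * ‖M.B‖ ^ 2 := by gcongr
      _ = (M.delta ρ Kst Sst * ‖M.B‖) ^ 2 := by ring
      _ ≤ _ := by gcongr
  have hDy : ‖M.B‖ ^ 2 * (s⁻¹ * ‖D‖) ≤ (‖M.B‖ * ε) ^ 2 := by
    have h1 : ‖D‖ ≤ s * ε ^ 2 := by
      refine hDtr.trans (le_of_mul_le_mul_left ?_ hμ)
      linarith
    calc ‖M.B‖ ^ 2 * (s⁻¹ * ‖D‖) ≤ ‖M.B‖ ^ 2 * (s⁻¹ * (s * ε ^ 2)) := by gcongr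
      _ = _ := by field_simp
  set y := ‖M.B‖ * ε with hy
  have hy0 : 0 ≤ y := by positivity
  have ha0 := norm_nonneg (M.A - M.B * Kst)
  -- The displacement of the closed loop fits into the margin, so the new closed loop keeps the
  -- bound ρ.
  have hstab : M.γ * ρ * y ^ 2 ≤ ρ - ‖M.A - M.B * Kst‖ := by
    have hq1 : q ≤ 1 := sub_le_self _ (by positivity)
    exact step_le_margin hγ M.γ_lt_one hρ0 hy0 hyq hq1 (sub_nonneg.2 hρ) hqy
  have hρ' : ‖M.A - M.B * M.newton K‖ ≤ ρ := by
    have e1 : M.A - M.B * M.newton K = (M.A - M.B * Kst) - M.B * (M.newton K - Kst) := by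
      rw [Matrix.mul_sub]
      abel
    rw [e1]
    have h1 : M.γ * ρ * (‖M.B‖ ^ 2 * (s⁻¹ * ‖D‖)) ≤ M.γ * ρ * y ^ 2 := by gcongr
    linarith [norm_sub_le (M.A - M.B * Kst) (M.B * (M.newton K - Kst))]
  have hqρ : q * y ^ 2 ≤ ρ ^ 2 := hqy.trans (by gcongr; linarith)
  refine (hsup hρ').trans ?_
  rw [div_mul_eq_mul_div C m ε]
  gcongr
  refine (hpert y hy0 hDy hyq hqρ hρ').trans ?_
  calc 2 * ρ * y * T = T * (2 * ρ * ‖M.B‖) * ε := by rw [hy]; ring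
    _ ≤ C * ε := by gcongr

end Model

end EntropyLQC

end

theorem theorem4 {n k : ℕ} (M : EntropyLQC.Model n k)
    (hμ : 0 < M.mu) (hB : 0 < EntropyLQC.sigmaMin M.B)
    (Kst : Matrix (Fin k) (Fin n) ℝ) (Sst : Matrix (Fin k) (Fin k) ℝ)
    (hopt : M.IsOptimal Kst Sst)
    (ρ : ℝ) (hρ0 : 0 < ρ) (hρ1 : ρ < 1) (hρ : ‖M.A - M.B * Kst‖ ≤ ρ)
    (K : ℕ → Matrix (Fin k) (Fin n) ℝ) (S : ℕ → Matrix (Fin k) (Fin k) ℝ)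
    (hIPO : M.IsIPO K S)
    (hS0 : (S 0).PosDef) (hfin : M.FiniteCost (K 0) (S 0))
    (hinit : M.cost (K 0) (S 0) - M.cost Kst Sst ≤
      (1 / M.mu - 1 / ‖M.stateCorr Kst Sst‖)⁻¹ * EntropyLQC.sigmaMin (M.hess Kst) *
        M.delta ρ Kst Sst ^ 2) :
    ∀ t : ℕ,
      (S (t + 1)).PosDef ∧ M.FiniteCost (K (t + 1)) (S (t + 1)) ∧
      M.cost (K (t + 1)) (S (t + 1)) - M.cost Kst Sst ≤
        (M.c₁ ρ Kst Sst + M.c₂ ρ Kst Sst) *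
            (M.cost (K t) (S t) - M.cost Kst Sst) ^ (3 / 2 : ℝ) /
          (EntropyLQC.sigmaMin (M.stateCorr Kst Sst) *
            √(M.mu * EntropyLQC.sigmaMin (M.hess Kst))) := by
  -- `newton` and `bestCov` are definitionally the two updates of the iteration.
  have hnext : ∀ t, K (t + 1) = M.newton (K t) ∧ S (t + 1) = M.bestCov (K t) := hIPO
  have hpos : ∀ t, (S (t + 1)).PosDef := fun t => (hnext t).2 ▸ M.bestCov_posDef (K t)
  -- The costs do not increase along the iteration, so the smallness condition on the initial gap
  -- holds at every step.
  have main : ∀ t, (S t).PosDef ∧ Summable (M.valueMatrixTerm (K t)) ∧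
      M.cost (K t) (S t) - M.cost Kst Sst ≤
        (1 / M.mu - 1 / ‖M.stateCorr Kst Sst‖)⁻¹ * EntropyLQC.sigmaMin (M.hess Kst) *
          M.delta ρ Kst Sst ^ 2 := by
    intro t
    induction t with
    | zero => exact ⟨hS0, M.summable_of_finiteCost hμ hS0 hfin, hinit⟩
    | succ t ih =>
      obtain ⟨hS, hK, hgap⟩ := ih
      have h1 := M.cost_sub_newton_ge (S := S t) hK
      have h2 := (M.cost_bestCov_le hS hK).1
      have h3 := mul_nonneg hμ.le (EntropyLQC.trace_nonneg_of_nonneg (M.decrement_nonneg (K t)))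
      refine ⟨hpos t, (hnext t).1 ▸ (M.newton_summable_and_le hK).1, ?_⟩
      rw [(hnext t).1, (hnext t).2]
      linarith
  intro t
  obtain ⟨hS, hK, hgap⟩ := main t
  refine ⟨hpos t, M.finiteCost_of_summable (hpos t) (main (t + 1)).2.1, ?_⟩
  rw [(hnext t).1, (hnext t).2]
  exact M.gap_step hμ hB hopt hρ0 hρ1 hρ hS hK hgap
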